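/- Let $n\in\mathbf N$, let $L(dx)$ be Lebesgue measure on $\mathbf C^n\simeq\mathbf R^{2n}$, and let $\Phi_0$ be a strictly plurisubharmonic real quadratic form on $\mathbf C^n$. Put $\xi_{\Phi_0}(x)=\frac{2}{i}\frac{\partial\Phi_0}{\partial x}(x)$ and $\Lambda_{\Phi_0}=\{(x,\xi_{\Phi_0}(x)) : x\in\mathbf C^n\}\subset\mathbf C^{2n}$. Let $s>1$, $A>0$, $C>0$. We say that $a:\Lambda_{\Phi_0}\to\mathbf C$ belongs to $\mathcal G^s_b(\Lambda_{\Phi_0})$ with constants $A,C$ if the function $\tilde a(x)=a(x,\xi_{\Phi_0}(x))$ is $C^\infty$ on $\mathbf R^{2n}$ and $$|\partial^\alpha \tilde a(x)|\le A\,C^{|\alpha|}(\alpha!)^s,\qquad x\in\mathbf R^{2n},\ \alpha\in\mathbf N^{2n}.$$ For $0<h\le 1$ and an entire function $u$ with $u(x)=\mathcal O_{h,N}(1)\langle x\rangle^{-N}e^{\Phi_0(x)/h}$ for all $N\in\mathbf N$, the Weyl quantization of $a$ is given by the absolutely convergent integral $$\mathrm{Op}^w_h(a)u(x)=\frac{1}{(2\pi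 h)^n}\iint_{\Gamma(x)}e^{\frac{i}{h}(x-y)\cdot\theta}\,a\Big(\frac{x+y}{2},\theta\Big)u(y)\,dy\wedge d\theta,\qquad \Gamma(x):\ \theta=\frac{2}{i}\frac{\partial\Phi_0}{\partial x}\Big(\frac{x+y}{2}\Big),\ y\in\mathbf C^n,$$ where $\Gamma(x)$ is oriented so that $dy\wedge d\theta$ is positive on it. For a continuous weight $\Phi$ let $H_\Phi(\mathbf C^n)=\mathrm{Hol}(\mathbf C^n)\cap L^2(\mathbf C^n,e^{-2\Phi/h}L(dx))$, with the norm of $L^2(\mathbf C^n,e^{-2\Phi/h}L(dx))$. Then there are constants $K>0$ and $M>0$, depending only on $n,\Phi_0,s,A,C$, such that the following holds for all $h\in(0,1]$, all $\Phi_1=\Phi_0+\psi\in C^{1,1}(\mathbf C^n;\mathbf R)$ with $$\|\nabla^k\psi\|_{L^\infty(\mathbf C^n)}\le \frac1K\,h^{1-\frac1s},\qquad k=0,1,2,$$ and all $a\in\mathcal G^s_b(\Lambda_{\Phi_0})$ with constants $A,C$: every $u$ as above belongs to $H_{\Phi_1}(\mathbf C^n)$, and $\mathrm{Op}^w_h(a)$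 extends from these $u$ to a bounded linear operator $$H_{\Phi_1}(\mathbf C^n)\to H_{\Phi_1}(\mathbf C^n)$$ of norm at most $M$; thus the extension is bounded uniformly in $h$. -/

import Mathlib

open MeasureTheory
open scoped ENNReal NNReal ContDiff ComplexOrder

noncomputable section

namespace GevreyWeyl

/-- `ℂⁿ` with its Euclidean norm; `volume` on it is Lebesgue measure `L(dx)` on `ℂⁿ ≅ ℝ²ⁿ`. -/
abbrev Cn (n : ℕ) : Type := EuclideanSpace ℂ (Fin n)

variable {n : ℕ}

/-- The real coordinate directions of `ℂⁿ ≅ ℝ²ⁿ`: `e_j` (second index `0`) and `i e_j`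
(second index `1`). -/
def realDir (p : Fin n × Fin 2) : Cn n :=
  EuclideanSpace.single p.1 (if p.2 = 0 then (1 : ℂ) else Complex.I)

/-- `∂f/∂x_j = (∂f/∂(Re x_j) - i ∂f/∂(Im x_j)) / 2`. -/
def dz (j : Fin n) (f : Cn n → ℂ) (x : Cn n) : ℂ :=
  (1 / 2) * (fderiv ℝ f x (realDir (j, 0)) - Complex.I * fderiv ℝ f x (realDir (j, 1)))

/-- `∂f/∂x̄_j = (∂f/∂(Re x_j) + i ∂f/∂(Im x_j)) / 2`. -/
def dzbar (j : Fin n) (f : Cn n → ℂ) (x : Cn n) : ℂ :=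
  (1 / 2) * (fderiv ℝ f x (realDir (j, 0)) + Complex.I * fderiv ℝ f x (realDir (j, 1)))

/-- Strict plurisubharmonicity of a `C²` function: its Levi matrix
`(∂²Φ/∂x̄_j∂x_k)` is positive definite at every point. -/
def StrictlyPlurisubharmonic (Φ : Cn n → ℝ) : Prop :=
  ∀ x, (Matrix.of fun j k : Fin n => dzbar j (dz k fun y => (Φ y : ℂ)) x).PosDef

/-- The fibre variable `ξ = (2/i) ∂Φ/∂x (x)` of `Λ_Φ` over `x`. -/
def xiMap (Φ : Cn n → ℝ) (x : Cn n) : Cn n :=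
  WithLp.toLp 2 fun j => (2 / Complex.I) * dz j (fun y => (Φ y : ℂ)) x

/-- `Λ_Φ = {(x, (2/i) ∂Φ/∂x (x)) : x ∈ ℂⁿ} ⊂ ℂⁿ × ℂⁿ`. -/
def Lam (Φ : Cn n → ℝ) : Set (Cn n × Cn n) :=
  Set.range fun x => (x, xiMap Φ x)

/-- The inverse `ℂⁿ → Λ_Φ` of the projection `(x, ξ) ↦ x`. -/
def lamPoint (Φ : Cn n → ℝ) (x : Cn n) : Lam Φ :=
  ⟨(x, xiMap Φ x), x, rfl⟩

/-- `u ∈ C^∞(ℂⁿ)` and `|∂^α u| ≤ A C^|α| (α!)^s` on all of `ℂⁿ ≅ ℝ²ⁿ`, for every multi-index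
`α ∈ ℕ²ⁿ`. A multi-index of length `k` is given by a word `σ` of `k` coordinate directions,
`α_p` being the number of occurrences of `p` in `σ`. -/
def GevreyBound (s A C : ℝ) (u : Cn n → ℂ) : Prop :=
  ContDiff ℝ ∞ u ∧
    ∀ (k : ℕ) (σ : Fin k → Fin n × Fin 2) (x : Cn n),
      ‖iteratedFDeriv ℝ k u x fun i => realDir (σ i)‖ ≤
        A * C ^ k *
          ((∏ p, (Finset.univ.filter fun i => σ i = p).card.factorial : ℕ) : ℝ) ^ s

/-- `a ∈ 𝒢^s_b(Λ_Φ)` with Gevrey constants `A`, `C`, where `Λ_Φ` is identified with `ℂⁿ` by the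
projection `(x, ξ) ↦ x`. -/
def GevreySymbol (Φ : Cn n → ℝ) (s A C : ℝ) (a : Lam Φ → ℂ) : Prop :=
  GevreyBound s A C fun x => a (lamPoint Φ x)

/-- `C^{1,1}`: continuously differentiable with (globally) Lipschitz gradient. -/
def IsC11 (f : Cn n → ℝ) : Prop :=
  ContDiff ℝ 1 f ∧ ∃ L : ℝ≥0, LipschitzWith L (fderiv ℝ f)

/-- The measure `e^{-2Φ/h} L(dx)`. -/
def weightMeasure (Φ : Cn n → ℝ) (h : ℝ) : Measure (Cn n) :=
  volume.withDensity fun x => ENNReal.ofReal (Real.exp (-2 * Φ x / h))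

/-- `H_Φ(ℂⁿ) = Hol(ℂⁿ) ∩ L²(ℂⁿ, e^{-2Φ/h} L(dx))`; its norm is
`eLpNorm · 2 (weightMeasure Φ h)`. -/
def HSpace (Φ : Cn n → ℝ) (h : ℝ) : Submodule ℂ (Cn n → ℂ) where
  carrier := {u | Differentiable ℂ u ∧ MemLp u 2 (weightMeasure Φ h)}
  add_mem' hu hv := ⟨hu.1.add hv.1, hu.2.add hv.2⟩
  zero_mem' := ⟨differentiable_const 0, MemLp.zero⟩
  smul_mem' c _ hu := ⟨hu.1.const_smul c, hu.2.const_smul c⟩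

/-- The initial domain of the Weyl quantization: entire `u` such that, for every `N`,
`u(x) = O(⟨x⟩^{-N}) e^{Φ(x)/h}`, where `⟨x⟩ = (1 + |x|²)^{1/2}`. -/
def weylDomain (Φ : Cn n → ℝ) (h : ℝ) : Set (Cn n → ℂ) :=
  {u | Differentiable ℂ u ∧ ∀ N : ℕ, ∃ B : ℝ, ∀ x,
    ‖u x‖ ≤ B * (Real.sqrt (1 + ‖x‖ ^ 2))⁻¹ ^ N * Real.exp (Φ x / h)}

/-- The density with respect to `L(dy)` of the pull-back of
`dy ∧ dθ = dy₁ ∧ ⋯ ∧ dyₙ ∧ dθ₁ ∧ ⋯ ∧ dθₙ` to the contour `y ↦ (y, θ(y))`: the value of the form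
on the frame `(e₁, …, eₙ, -i e₁, …, -i eₙ)`. On the contour used below this frame gives the
orientation for which `dy ∧ dθ` is positive, so that the symbol `1` is quantized to the identity. -/
def contourDensity (θ : Cn n → Cn n) (y : Cn n) : ℂ :=
  (Matrix.fromBlocks (1 : Matrix (Fin n) (Fin n) ℂ) (-(Complex.I • 1))
    (Matrix.of fun j k => (fderiv ℝ θ y (realDir (k, 0))) j)
    (Matrix.of fun j k => -(fderiv ℝ θ y (realDir (k, 1))) j)).det

/-- The natural contour `Γ(x)`: `θ = (2/i) ∂Φ/∂x ((x+y)/2)`. -/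
def contour (Φ : Cn n → ℝ) (x y : Cn n) : Cn n :=
  xiMap Φ ((1 / 2 : ℝ) • (x + y))

/-- The integrand, as a function of `y ∈ ℂⁿ`, of the integral over `Γ(x)` of
`e^{(i/h)(x-y)·θ} a((x+y)/2, θ) u(y) dy ∧ dθ`. On `Γ(x)` the point `((x+y)/2, θ)` is the point of
`Λ_Φ` over `(x+y)/2`. -/
def weylIntegrand (Φ : Cn n → ℝ) (h : ℝ) (a : Lam Φ → ℂ) (u : Cn n → ℂ) (x y : Cn n) : ℂ :=
  Complex.exp (Complex.I / h * ∑ j, (x j - y j) * contour Φ x y j) *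
    a (lamPoint Φ ((1 / 2 : ℝ) • (x + y))) * u y * contourDensity (contour Φ x) y

/-- The semiclassical Weyl quantization
`Op_h^w(a) u(x) = (2πh)^{-n} ∬_{Γ(x)} e^{(i/h)(x-y)·θ} a((x+y)/2, θ) u(y) dy ∧ dθ`. -/
def weylOp (Φ : Cn n → ℝ) (h : ℝ) (a : Lam Φ → ℂ) (u : Cn n → ℂ) (x : Cn n) : ℂ :=
  1 / ((2 * Real.pi * h : ℝ) : ℂ) ^ n * ∫ y, weylIntegrand Φ h a u x y

end GevreyWeyl

end

noncomputable section

namespace GevreyWeyl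

variable {n : ℕ}

/-! ### Decay and integrability -/

/-! A strictly plurisubharmonic quadratic form is |Ax|² + Re f(x), with A complex linear and
invertible and f a holomorphic quadratic form (`exists_herm_decomposition`). In the Weyl phase f
contributes only f(x) - f(y) (`weylIntegrand_eq`), so conjugation by e^{f/h} reduces to the weight
|Ax|². There entire functions satisfy a Bargmann reproducing formula. Inserting it into the Weyl
integral and integrating in y first gives a kernel that is the reproducing kernel times `wick`, the
polarized Gaussian average of the symbol (`integral_weylPhase_eq`).

The trivial bound e^{|A(x-ζ)|²/h} on `wick`, up to the Gaussian mass, cancels all the off-diagonal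
Gaussian decay of the reproducing kernel, so decay must come from the Gevrey bounds. Along x = w +
te, ζ = w - te, integration by parts turns each t-derivative of `wick` into a derivative of the
symbol in the direction ie (`hasDerivAt_wickLine`). Taylor expansion in t, stopped at the smallest
Gevrey term, plays the role of an almost holomorphic extension of the symbol (`norm_wick_le`).
Optimizing the length of the expansion gains a Gaussian or a factor exp(-c(|x-ζ|/h)^{1/s})
(`exists_norm_wick_le_decay`); within a small multiple of h^{1-1/s} of the diagonal there is no
growth at all (`exists_norm_wick_le_near`).

Now perturb the weight by ψ = O(ε h^{1-1/s}) in C^{1,1}. Against the Gaussian, the linear part of ψ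
at x may cost exp(h^{1-2/s}), which is unbounded for s < 2. But the reproducing formula survives a
constant shift δ of the antiholomorphic variable, and δ = δ(x) with 2 Re⟨Aδ, Av⟩ = ψ'(x)v cancels
this linear part. The quadratic remainder near the diagonal, and all of ψ far from it, are absorbed
by the decay (`exists_kernel_bound`). The operator does not depend on δ (`wickOp_eq_wickOp_zero`),
so a different shift may be used to estimate it at each x.

The conjugated kernel is thus dominated by a convolution kernel of mass O(h^n) times constants in
which the remaining powers of h cancel, and Young's inequality concludes. Since the Wick integral
converges on all of H_{Φ₁}, it is itself the extension; no density argument is needed. -/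

theorem exp_neg_mul_rpow_le {c p : ℝ} (hc : 0 < c) (hp : 0 < p) (N : ℕ) :
    ∃ B : ℝ, 0 < B ∧ ∀ t : ℝ, 0 ≤ t → Real.exp (-(c * t ^ p)) ≤ B * ((1 + t) ^ N)⁻¹ := by
  -- One Taylor term y^k/k! ≤ e^y at y = c t^p suffices as soon as pk ≥ N.
  obtain ⟨k, hk⟩ := exists_nat_ge (N / p)
  have hkN : (N : ℝ) ≤ p * k := by
    rw [div_le_iff₀ hp] at hk
    linarith
  refine ⟨2 ^ N + k.factorial / c ^ k * 2 ^ N, by positivity, fun t ht => ?_⟩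
  rw [← div_eq_mul_inv, le_div_iff₀ (by positivity)]
  rcases le_total t 1 with h1 | h1
  · have : Real.exp (-(c * t ^ p)) ≤ 1 := by
      rw [Real.exp_le_one_iff]
      have := Real.rpow_nonneg ht p
      nlinarith [mul_nonneg hc.le this]
    calc Real.exp (-(c * t ^ p)) * (1 + t) ^ N ≤ 1 * 2 ^ N := by
          gcongr
          linarith
      _ ≤ _ := by
          have : 0 ≤ k.factorial / c ^ k * 2 ^ N := by positivity
          linarith
  · have hy : 0 < c * t ^ p := by positivity
    have h2 := Real.pow_div_factorial_le_exp (c * t ^ p) hy.le k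
    have h3 : t ^ N ≤ (t ^ p) ^ k := by
      rw [← Real.rpow_natCast, ← Real.rpow_natCast, ← Real.rpow_mul ht]
      exact Real.rpow_le_rpow_of_exponent_le h1 hkN
    have h4 : (1 + t) ^ N ≤ 2 ^ N * t ^ N := by
      rw [← mul_pow]
      gcongr
      linarith
    rw [Real.exp_neg]
    have h5 : c ^ k * t ^ N ≤ k.factorial * Real.exp (c * t ^ p) := by
      rw [div_le_iff₀ (by positivity), mul_pow] at h2
      calc c ^ k * t ^ N ≤ c ^ k * (t ^ p) ^ k := by gcongr
        _ ≤ _ := by linarith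
    have h6 : (Real.exp (c * t ^ p))⁻¹ * t ^ N ≤ k.factorial / c ^ k := by
      rw [inv_mul_le_iff₀ (Real.exp_pos _), mul_div_assoc', le_div_iff₀ (by positivity)]
      linarith
    calc (Real.exp (c * t ^ p))⁻¹ * (1 + t) ^ N
        ≤ (Real.exp (c * t ^ p))⁻¹ * (2 ^ N * t ^ N) := by gcongr
      _ = ((Real.exp (c * t ^ p))⁻¹ * t ^ N) * 2 ^ N := by ring
      _ ≤ k.factorial / c ^ k * 2 ^ N := by gcongr
      _ ≤ _ := by
        have : (0 : ℝ) ≤ 2 ^ N := by positivity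
        linarith

theorem finrank_real_Cn : Module.finrank ℝ (Cn n) = 2 * n := by
  have h : Module.finrank ℝ (Cn n) = Module.finrank ℝ (Fin n → ℂ) :=
    (WithLp.linearEquiv 2 ℝ (Fin n → ℂ)).finrank_eq
  rw [h, Module.finrank_pi_fintype]
  simp [Complex.finrank_real_complex, mul_comm]

theorem integrable_inv_one_add_norm_pow :
    Integrable fun x : Cn n => ((1 + ‖x‖) ^ (2 * n + 1))⁻¹ := by
  have := integrable_one_add_norm (E := Cn n) (μ := volume) (r := ((2 * n + 1 : ℕ) : ℝ))
    (by rw [finrank_real_Cn]; push_cast; linarith)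
  refine this.congr (Filter.Eventually.of_forall fun x => ?_)
  simp only
  rw [Real.rpow_neg (by positivity), Real.rpow_natCast]

theorem integrable_exp_neg_mul_rpow {c p : ℝ} (hc : 0 < c) (hp : 0 < p) :
    Integrable fun x : Cn n => Real.exp (-(c * ‖x‖ ^ p)) := by
  obtain ⟨B, -, hB⟩ := exp_neg_mul_rpow_le hc hp (2 * n + 1)
  refine (integrable_inv_one_add_norm_pow.const_mul B).mono' ?_
    (Filter.Eventually.of_forall fun x => ?_)
  · have : Continuous fun x : Cn n => Real.exp (-(c * ‖x‖ ^ p)) := by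
      have := Real.continuous_rpow_const hp.le
      fun_prop
    exact this.aestronglyMeasurable
  · rw [Real.norm_of_nonneg (Real.exp_pos _).le]
    exact hB _ (norm_nonneg _)

theorem integrable_exp_neg_mul_sq {c : ℝ} (hc : 0 < c) :
    Integrable fun x : Cn n => Real.exp (-(c * ‖x‖ ^ 2)) := by
  simpa using integrable_exp_neg_mul_rpow (n := n) hc (p := 2) (by norm_num)

theorem integral_comp_inv_smul {F : Type*} [NormedAddCommGroup F] [NormedSpace ℝ F]
    (f : Cn n → F) {r : ℝ} (hr : 0 < r) :
    ∫ x, f (r⁻¹ • x) = (r ^ 2) ^ n • ∫ x, f x := by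
  rw [Measure.integral_comp_smul, finrank_real_Cn, abs_of_nonneg (by positivity)]
  congr 1
  rw [inv_pow, inv_inv, pow_mul]

/-! ### Convolution with an integrable kernel on `L²` -/

/-- Young's inequality L¹ * L² ⊂ L²: Cauchy–Schwarz with k split as k^{1/2} · k^{1/2}, then Tonelli
and translation invariance. -/
theorem lintegral_convolution_sq_le (k V : Cn n → ℝ≥0∞) (hk : Measurable k) (hV : Measurable V) :
    ∫⁻ x, (∫⁻ z, k (x - z) * V z) ^ 2 ≤ (∫⁻ x, k x) ^ 2 * ∫⁻ z, V z ^ 2 := by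
  have hI : ∀ x : Cn n, ∫⁻ z, k (x - z) = ∫⁻ z, k z := fun x =>
    lintegral_sub_left_eq_self (μ := volume) k x
  have h1 : ∀ x : Cn n, (∫⁻ z, k (x - z) * V z) ^ 2 ≤
      (∫⁻ z, k z) * ∫⁻ z, k (x - z) * V z ^ 2 := by
    intro x
    have hf : Measurable fun z => k (x - z) ^ (1 / 2 : ℝ) :=
      (hk.comp (measurable_const.sub measurable_id)).pow_const _
    have := ENNReal.lintegral_mul_le_Lp_mul_Lq (volume : Measure (Cn n))
      (Real.HolderConjugate.two_two) (f := fun z => k (x - z) ^ (1 / 2 : ℝ))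
      (g := fun z => k (x - z) ^ (1 / 2 : ℝ) * V z) hf.aemeasurable (hf.mul hV).aemeasurable
    have e0 : ∀ y : ℝ≥0∞, y ^ (1 / 2 : ℝ) * y ^ (1 / 2 : ℝ) = y := fun y => by
      rw [← ENNReal.rpow_add_of_nonneg _ _ (by norm_num) (by norm_num)]
      norm_num
    have e1 : ∀ z, ((fun z => k (x - z) ^ (1 / 2 : ℝ)) *
        fun z => k (x - z) ^ (1 / 2 : ℝ) * V z) z = k (x - z) * V z := fun z => by
      simp only [Pi.mul_apply]
      rw [← mul_assoc, e0]
    have e2 : ∀ z, (k (x - z) ^ (1 / 2 : ℝ)) ^ (2 : ℝ) = k (x - z) := fun z => by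
      rw [← ENNReal.rpow_mul]
      norm_num
    have e3 : ∀ z, (k (x - z) ^ (1 / 2 : ℝ) * V z) ^ (2 : ℝ) = k (x - z) * V z ^ 2 := fun z => by
      rw [ENNReal.mul_rpow_of_nonneg _ _ (by norm_num), e2]
      norm_num
    simp only [e1, e2, e3, hI] at this
    calc _ ≤ ((∫⁻ z, k z) ^ (1 / 2 : ℝ) * (∫⁻ z, k (x - z) * V z ^ 2) ^ (1 / 2 : ℝ)) ^ 2 := by
          gcongr
      _ = _ := by
          rw [mul_pow, pow_two, pow_two, e0, e0]
  have hm : Measurable (Function.uncurry fun x z : Cn n => k (x - z) * V z ^ 2) :=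
    (hk.comp (measurable_fst.sub measurable_snd)).mul ((hV.comp measurable_snd).pow_const 2)
  calc ∫⁻ x, (∫⁻ z, k (x - z) * V z) ^ 2
      ≤ ∫⁻ x, (∫⁻ z, k z) * ∫⁻ z, k (x - z) * V z ^ 2 := lintegral_mono h1
    _ = (∫⁻ z, k z) * ∫⁻ x, ∫⁻ z, k (x - z) * V z ^ 2 :=
        lintegral_const_mul _ hm.lintegral_prod_right
    _ = (∫⁻ z, k z) * ∫⁻ z, ∫⁻ x, k (x - z) * V z ^ 2 := by
        rw [lintegral_lintegral_swap hm.aemeasurable]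
    _ = (∫⁻ z, k z) * ∫⁻ z, (∫⁻ x, k x) * V z ^ 2 := by
        congr 1
        refine lintegral_congr fun z => ?_
        have hkz : Measurable fun x => k (x - z) := hk.comp (measurable_id.sub measurable_const)
        rw [lintegral_mul_const _ hkz, lintegral_sub_right_eq_self (μ := volume) k z]
    _ = _ := by
        rw [lintegral_const_mul _ (hV.pow_const 2), ← mul_assoc, pow_two]

/-! ### The reproducing formula -/

/-- The Hermitian form `⟨Ax, Ay⟩`. -/
abbrev herm (A : Cn n ≃L[ℂ] Cn n) (x y : Cn n) : ℂ := inner ℂ (A x) (A y)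

theorem herm_self (A : Cn n ≃L[ℂ] Cn n) (x : Cn n) : herm A x x = (‖A x‖ : ℂ) ^ 2 := by
  rw [herm, inner_self_eq_norm_sq_to_K (𝕜 := ℂ) (A x)]
  rfl

theorem differentiable_herm (A : Cn n ≃L[ℂ] Cn n) (x : Cn n) :
    Differentiable ℂ fun y => herm A x y :=
  ((innerSL ℂ (A x)).comp (A : Cn n →L[ℂ] Cn n)).differentiable

/-- Multiplication by `e^{it}` as a real linear isometry. -/
def rotation (t : ℝ) : Cn n ≃ₗᵢ[ℝ] Cn n where
  toFun x := Complex.exp (t * Complex.I) • x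
  invFun x := Complex.exp (-(t * Complex.I)) • x
  map_add' x y := smul_add _ x y
  map_smul' r x := smul_comm _ r x
  left_inv x := by
    change Complex.exp (-(t * Complex.I)) • (Complex.exp (t * Complex.I) • x) = x
    rw [smul_smul, ← Complex.exp_add]
    simp
  right_inv x := by
    change Complex.exp (t * Complex.I) • (Complex.exp (-(t * Complex.I)) • x) = x
    rw [smul_smul, ← Complex.exp_add]
    simp
  norm_map' x := by
    change ‖Complex.exp (t * Complex.I) • x‖ = ‖x‖
    rw [norm_smul, Complex.norm_exp_ofReal_mul_I, one_mul]

theorem rotation_apply (t : ℝ) (x : Cn n) : rotation t x = Complex.exp (t * Complex.I) • x := rfl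

/-- Averaging over the rotations w ↦ e^{it}w leaves the integral unchanged, while the mean value
property on the complex line through w replaces g(w) by g(0). -/
theorem integral_mul_eq_of_rotation_invariant {ρ : Cn n → ℝ} (hρ : Continuous ρ)
    (hinv : ∀ (t : ℝ) x, ρ (Complex.exp (t * Complex.I) • x) = ρ x)
    {g : Cn n → ℂ} (hg : Differentiable ℂ g) (hint : Integrable fun w => ρ w * g w) :
    ∫ w, (ρ w : ℂ) * g w = (∫ w, (ρ w : ℂ)) * g 0 := by
  have hgc := hg.continuous
  have hrot : ∀ t : ℝ, ∫ w, (ρ w : ℂ) * g (Complex.exp (t * Complex.I) • w) =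
      ∫ w, (ρ w : ℂ) * g w := by
    intro t
    have := (rotation (n := n) t).measurePreserving.integral_comp
      (rotation t).toHomeomorph.measurableEmbedding fun w => (ρ w : ℂ) * g w
    simpa only [rotation_apply, hinv] using this
  have hmean : ∀ w, ∫ t in (0 : ℝ)..2 * Real.pi, (ρ w : ℂ) * g (Complex.exp (t * Complex.I) • w) =
      2 * Real.pi * (ρ w * g 0) := by
    intro w
    have hd : Differentiable ℂ fun ζ : ℂ => g (ζ • w) :=
      hg.comp (differentiable_id.smul_const w)
    have := (hd.diffContOnCl (s := Metric.ball 0 |1|)).circleAverage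
    rw [Real.circleAverage_def] at this
    simp only [circleMap, zero_add, Complex.ofReal_one, one_mul, zero_smul] at this
    rw [intervalIntegral.integral_const_mul]
    have hpi : (Real.pi : ℂ) ≠ 0 := by exact_mod_cast Real.pi_ne_zero
    rw [← this]
    rw [Complex.real_smul, mul_left_comm (2 * Real.pi : ℂ), ← mul_assoc (2 * Real.pi : ℂ)]
    push_cast
    rw [mul_inv_cancel₀ (by simp), one_mul]
  have hsw : ∫ t in (0 : ℝ)..2 * Real.pi, ∫ w, (ρ w : ℂ) * g (Complex.exp (t * Complex.I) • w) =
      ∫ w, ∫ t in (0 : ℝ)..2 * Real.pi, (ρ w : ℂ) * g (Complex.exp (t * Complex.I) • w) := by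
    refine intervalIntegral_integral_swap ?_
    have hc : Continuous (Function.uncurry fun (t : ℝ) (w : Cn n) =>
        (ρ w : ℂ) * g (Complex.exp (t * Complex.I) • w)) := by
      unfold Function.uncurry
      fun_prop
    rw [integrable_prod_iff hc.aestronglyMeasurable]
    have hI : ∀ t : ℝ, Integrable fun w => (ρ w : ℂ) * g (Complex.exp (t * Complex.I) • w) := by
      intro t
      have := (rotation (n := n) t).measurePreserving.integrable_comp_of_integrable hint
      refine this.congr (Filter.Eventually.of_forall fun w => ?_)
      simp only [Function.comp, rotation_apply, hinv]
    refine ⟨Filter.Eventually.of_forall fun t => hI t, ?_⟩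
    have : ∀ t : ℝ, ∫ w, ‖(ρ w : ℂ) * g (Complex.exp (t * Complex.I) • w)‖ =
        ∫ w, ‖(ρ w : ℂ) * g w‖ := by
      intro t
      have := (rotation (n := n) t).measurePreserving.integral_comp
        (rotation t).toHomeomorph.measurableEmbedding fun w => ‖(ρ w : ℂ) * g w‖
      simpa only [rotation_apply, hinv] using this
    simp only [Function.uncurry, this]
    rw [Set.uIoc_of_le (by positivity)]
    exact integrable_const _
  simp only [hrot, hmean] at hsw
  rw [intervalIntegral.integral_const, integral_const_mul, integral_mul_const] at hsw
  have hpi : (2 * Real.pi : ℂ) ≠ 0 := by exact_mod_cast (by positivity : (2 * Real.pi : ℝ) ≠ 0)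
  rw [Complex.real_smul] at hsw
  push_cast at hsw
  rw [sub_zero] at hsw
  exact mul_left_cancel₀ hpi hsw

theorem exists_norm_equiv (A : Cn n ≃L[ℂ] Cn n) :
    ∃ κ : ℝ, 0 < κ ∧ κ ≤ 1 ∧ ∀ x, κ * ‖x‖ ^ 2 ≤ ‖A x‖ ^ 2 := by
  refine ⟨((‖(A.symm : Cn n →L[ℂ] Cn n)‖ + 1) ^ 2)⁻¹, by positivity, ?_, fun x => ?_⟩
  · refine inv_le_one_of_one_le₀ (one_le_pow₀ ?_)
    linarith [norm_nonneg (A.symm : Cn n →L[ℂ] Cn n)]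
  · rw [inv_mul_le_iff₀ (by positivity), ← mul_pow]
    have := (A.symm : Cn n →L[ℂ] Cn n).le_opNorm (A x)
    simp only [ContinuousLinearEquiv.coe_coe, ContinuousLinearEquiv.symm_apply_apply] at this
    gcongr
    nlinarith [norm_nonneg (A x)]

theorem integrable_gaussian (A : Cn n ≃L[ℂ] Cn n) {c : ℝ} (hc : 0 < c) :
    Integrable fun x => Real.exp (-(c * ‖A x‖ ^ 2)) := by
  obtain ⟨κ, hκ, -, h⟩ := exists_norm_equiv A
  refine (integrable_exp_neg_mul_sq (n := n) (mul_pos hc hκ)).mono' ?_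
    (Filter.Eventually.of_forall fun x => ?_)
  · have : Continuous fun x => Real.exp (-(c * ‖A x‖ ^ 2)) := by fun_prop
    exact this.aestronglyMeasurable
  · rw [Real.norm_of_nonneg (Real.exp_pos _).le, Real.exp_le_exp]
    have := mul_le_mul_of_nonneg_left (h x) hc.le
    linarith

/-- The total mass of the Gaussian `e^{-c|Ax|²}`. -/
def gaussMass (A : Cn n ≃L[ℂ] Cn n) (c : ℝ) : ℝ := ∫ x, Real.exp (-(c * ‖A x‖ ^ 2))

theorem gaussMass_pos (A : Cn n ≃L[ℂ] Cn n) {c : ℝ} (hc : 0 < c) : 0 < gaussMass A c :=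
  integral_exp_pos (integrable_gaussian A hc)

/-- Dilation by √h in real dimension 2n. -/
theorem gaussMass_div (A : Cn n ≃L[ℂ] Cn n) (c : ℝ) {h : ℝ} (hh : 0 < h) :
    gaussMass A (c / h) = h ^ n * gaussMass A c := by
  have := integral_comp_inv_smul (n := n) (fun x => Real.exp (-(c * ‖A x‖ ^ 2)))
    (Real.sqrt_pos.2 hh)
  rw [Real.sq_sqrt hh.le, smul_eq_mul] at this
  rw [gaussMass, gaussMass, ← this]
  refine integral_congr_ae (Filter.Eventually.of_forall fun x => ?_)
  have hA : A ((Real.sqrt h)⁻¹ • x) = (Real.sqrt h)⁻¹ • A x := by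
    exact (A.restrictScalars ℝ).map_smul (Real.sqrt h)⁻¹ x
  simp only [hA, norm_smul, mul_pow, norm_inv, Real.norm_eq_abs, sq_abs, inv_pow,
    Real.sq_sqrt hh.le]
  congr 1
  ring

/-- The reproducing kernel, with the antiholomorphic variable moved by `δ`. -/
def shiftKernel (A : Cn n ≃L[ℂ] Cn n) (h : ℝ) (δ y z : Cn n) : ℂ :=
  Complex.exp ((2 * herm A (z + δ) y - 2 * herm A (z + δ) z) / h)

/-- Completing the square: the shift costs |Aδ|²/h and moves the centre of the Gaussian in z to y -
δ. -/
theorem norm_shiftKernel (A : Cn n ≃L[ℂ] Cn n) (h : ℝ) (δ y z : Cn n) :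
    ‖shiftKernel A h δ y z‖ = Real.exp ((‖A y‖ ^ 2 - ‖A z‖ ^ 2 + ‖A δ‖ ^ 2
      - ‖A (y - z - δ)‖ ^ 2) / h) := by
  rw [shiftKernel, Complex.norm_exp]
  congr 1
  rw [Complex.div_ofReal_re]
  congr 1
  simp only [← inner_self_eq_norm_sq (𝕜 := ℂ), herm, map_add, map_sub, inner_add_left,
    inner_sub_left, inner_sub_right]
  have e1 := inner_re_symm (𝕜 := ℂ) (A y) (A z)
  have e2 := inner_re_symm (𝕜 := ℂ) (A y) (A δ)
  have e3 := inner_re_symm (𝕜 := ℂ) (A z) (A δ)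
  simp only [RCLike.re_eq_complex_re] at *
  simp only [Complex.add_re, Complex.sub_re, Complex.mul_re, Complex.re_ofNat, Complex.im_ofNat]
  linarith

/-- Centred at y, the kernel is the radial weight e^{-2|Aw|²/h} times a factor holomorphic in w with
value 1 at w = 0. A constant shift δ changes only that holomorphic factor, so the mean value
property still applies. -/
theorem reproducing_of_integrable (A : Cn n ≃L[ℂ] Cn n) {h : ℝ} (δ y : Cn n)
    {v : Cn n → ℂ} (hv : Differentiable ℂ v) (hint : Integrable fun z => shiftKernel A h δ y z * v z) :
    ∫ z, shiftKernel A h δ y z * v z = gaussMass A (2 / h) * v y := by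
  have key : ∀ w, shiftKernel A h δ y (w + y) * v (w + y) =
      (Real.exp (-(2 / h * ‖A w‖ ^ 2)) : ℂ) *
        (Complex.exp (-2 * herm A (y + δ) w / h) * v (w + y)) := by
    intro w
    rw [← mul_assoc, shiftKernel, Complex.ofReal_exp, ← Complex.exp_add]
    congr 2
    push_cast
    rw [← herm_self]
    simp only [herm, map_add, inner_add_left, inner_add_right]
    ring
  have hd : Differentiable ℂ fun w => Complex.exp (-2 * herm A (y + δ) w / h) * v (w + y) := by
    have h1 := differentiable_herm A (y + δ)
    have h2 : Differentiable ℂ fun w => v (w + y) :=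
      hv.comp (differentiable_id.add_const y)
    have h3 : Differentiable ℂ fun w => -2 * herm A (y + δ) w / (h : ℂ) := by
      simpa only [div_eq_mul_inv] using (h1.const_mul (-2)).mul_const ((h : ℂ)⁻¹)
    exact h3.cexp.mul h2
  have hint' := hint.comp_add_right y
  simp only [key] at hint'
  have := integral_mul_eq_of_rotation_invariant (ρ := fun w => Real.exp (-(2 / h * ‖A w‖ ^ 2)))
    (by fun_prop) (fun t x => by
      simp only [map_smul, norm_smul, Complex.norm_exp_ofReal_mul_I, one_mul]) hd hint'
  rw [← integral_add_right_eq_self _ y]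
  simp only [key]
  rw [this, integral_complex_ofReal]
  simp [gaussMass, herm]

theorem continuous_herm (A : Cn n ≃L[ℂ] Cn n) {X : Type*} [TopologicalSpace X] {f g : X → Cn n}
    (hf : Continuous f) (hg : Continuous g) : Continuous fun x => herm A (f x) (g x) :=
  (A.continuous.comp hf).inner (A.continuous.comp hg)

theorem continuous_shiftKernel (A : Cn n ≃L[ℂ] Cn n) (h : ℝ) {X : Type*} [TopologicalSpace X]
    {d f g : X → Cn n} (hd : Continuous d) (hf : Continuous f) (hg : Continuous g) :
    Continuous fun x => shiftKernel A h (d x) (f x) (g x) := by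
  have h1 := continuous_herm A (hg.add hd) hf
  have h2 := continuous_herm A (hg.add hd) hg
  unfold shiftKernel
  fun_prop

theorem norm_shiftKernel_mul (A : Cn n ≃L[ℂ] Cn n) (h : ℝ) (δ y z : Cn n) (c : ℝ) :
    ‖shiftKernel A h δ y z‖ * c = Real.exp ((‖A y‖ ^ 2 + ‖A δ‖ ^ 2) / h) *
      (Real.exp (-(1 / h * ‖A (y - z - δ)‖ ^ 2)) * (c * Real.exp (-(‖A z‖ ^ 2 / h)))) := by
  rw [norm_shiftKernel, show ∀ p q r s : ℝ, p * (q * (r * s)) = (p * q * s) * r by intros; ring,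
    ← Real.exp_add, ← Real.exp_add]
  congr 2
  ring

theorem integrable_gaussian_sub (A : Cn n ≃L[ℂ] Cn n) {c : ℝ} (hc : 0 < c) (x δ : Cn n) :
    Integrable fun z => Real.exp (-(c * ‖A (x - z - δ)‖ ^ 2)) := by
  have := ((integrable_gaussian A hc).comp_sub_left (x - δ))
  refine this.congr (Filter.Eventually.of_forall fun z => ?_)
  simp only [sub_right_comm]

theorem reproducing_of_bounded (A : Cn n ≃L[ℂ] Cn n) {h : ℝ} (hh : 0 < h) (δ y : Cn n)
    {v : Cn n → ℂ} (hv : Differentiable ℂ v) {B : ℝ}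
    (hB : ∀ z, ‖v z‖ * Real.exp (-(‖A z‖ ^ 2 / h)) ≤ B) :
    ∫ z, shiftKernel A h δ y z * v z = gaussMass A (2 / h) * v y := by
  refine reproducing_of_integrable A δ y hv ?_
  refine (((integrable_gaussian_sub A (one_div_pos.2 hh) y δ).mul_const B).const_mul
    (Real.exp ((‖A y‖ ^ 2 + ‖A δ‖ ^ 2) / h))).mono' ?_ (Filter.Eventually.of_forall fun z => ?_)
  · exact ((continuous_shiftKernel A h continuous_const continuous_const continuous_id).mul
      hv.continuous).aestronglyMeasurable
  · rw [norm_mul, norm_shiftKernel_mul]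
    gcongr
    exact hB z

/-- Point evaluation is controlled by the reproducing formula with δ = 0. Splitting the product of
Gaussian and weighted v into a sum of squares gives both the absolute convergence and a bound
independent of the point. -/
theorem bounded_of_integrable_sq (A : Cn n ≃L[ℂ] Cn n) {h : ℝ} (hh : 0 < h)
    {v : Cn n → ℂ} (hv : Differentiable ℂ v)
    (hint : Integrable fun z => (‖v z‖ * Real.exp (-(‖A z‖ ^ 2 / h))) ^ 2) :
    ∃ B : ℝ, ∀ z, ‖v z‖ * Real.exp (-(‖A z‖ ^ 2 / h)) ≤ B := by
  have hM : 0 < gaussMass A (2 / h) := gaussMass_pos A (by positivity)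
  refine ⟨(gaussMass A (2 / h) + ∫ z, (‖v z‖ * Real.exp (-(‖A z‖ ^ 2 / h))) ^ 2) /
    gaussMass A (2 / h), fun y => ?_⟩
  have hg : Integrable fun z => Real.exp (-(2 / h * ‖A (y - z)‖ ^ 2)) := by
    simpa using integrable_gaussian_sub A (show 0 < 2 / h by positivity) y 0
  have hbd : ∀ z, ‖shiftKernel A h 0 y z * v z‖ ≤ Real.exp (‖A y‖ ^ 2 / h) *
      (Real.exp (-(2 / h * ‖A (y - z)‖ ^ 2)) + (‖v z‖ * Real.exp (-(‖A z‖ ^ 2 / h))) ^ 2) := by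
    intro z
    rw [norm_mul, norm_shiftKernel_mul]
    simp only [map_zero, norm_zero, sub_zero, ne_eq, OfNat.ofNat_ne_zero, not_false_eq_true,
      zero_pow, add_zero]
    gcongr
    have e : Real.exp (-(2 / h * ‖A (y - z)‖ ^ 2)) = Real.exp (-(1 / h * ‖A (y - z)‖ ^ 2)) ^ 2 := by
      rw [← Real.exp_nat_mul]
      congr 1
      push_cast
      ring
    rw [e]
    nlinarith [sq_nonneg (Real.exp (-(1 / h * ‖A (y - z)‖ ^ 2))), 
      sq_nonneg (‖v z‖ * Real.exp (-(‖A z‖ ^ 2 / h))),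
      sq_nonneg (Real.exp (-(1 / h * ‖A (y - z)‖ ^ 2)) - ‖v z‖ * Real.exp (-(‖A z‖ ^ 2 / h)))]
  have hR := reproducing_of_integrable A (h := h) 0 y hv (((hg.add hint).const_mul _).mono'
    ((continuous_shiftKernel A h continuous_const continuous_const continuous_id).mul
      hv.continuous).aestronglyMeasurable (Filter.Eventually.of_forall hbd))
  have h1 : gaussMass A (2 / h) * ‖v y‖ ≤ Real.exp (‖A y‖ ^ 2 / h) *
      (gaussMass A (2 / h) + ∫ z, (‖v z‖ * Real.exp (-(‖A z‖ ^ 2 / h))) ^ 2) := by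
    calc gaussMass A (2 / h) * ‖v y‖ = ‖∫ z, shiftKernel A h 0 y z * v z‖ := by
          rw [hR, norm_mul, Complex.norm_real, Real.norm_of_nonneg hM.le]
      _ ≤ ∫ z, Real.exp (‖A y‖ ^ 2 / h) * (Real.exp (-(2 / h * ‖A (y - z)‖ ^ 2)) +
            (‖v z‖ * Real.exp (-(‖A z‖ ^ 2 / h))) ^ 2) :=
          norm_integral_le_of_norm_le ((hg.add hint).const_mul _) (Filter.Eventually.of_forall hbd)
      _ = _ := by
          rw [integral_const_mul, integral_add hg hint, gaussMass]
          congr 2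
          exact integral_sub_left_eq_self (fun z => Real.exp (-(2 / h * ‖A z‖ ^ 2))) volume y
  rw [le_div_iff₀ hM, mul_right_comm, Real.exp_neg, ← div_eq_mul_inv,
    div_le_iff₀ (Real.exp_pos _)]
  linarith

/-! ### The Wick kernel of a Weyl operator -/

/-- The Gaussian average `∫ a(m) e^{-4⟨A(m-z), A(m-x)⟩/h} dm`. -/
def wick (A : Cn n ≃L[ℂ] Cn n) (h : ℝ) (a : Cn n → ℂ) (x z : Cn n) : ℂ :=
  ∫ m, a m * Complex.exp (-4 * herm A (m - z) (m - x) / h)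

/-- The Weyl phase on the contour, for the weight `|Ax|²`. -/
def weylPhase (A : Cn n ≃L[ℂ] Cn n) (h : ℝ) (x y : Cn n) : ℂ :=
  Complex.exp ((herm A x x - herm A y y - herm A x y + herm A y x) / h)

theorem norm_weylPhase (A : Cn n ≃L[ℂ] Cn n) (h : ℝ) (x y : Cn n) :
    ‖weylPhase A h x y‖ = Real.exp ((‖A x‖ ^ 2 - ‖A y‖ ^ 2) / h) := by
  rw [weylPhase, Complex.norm_exp]
  congr 1
  rw [Complex.div_ofReal_re]
  congr 1
  have e1 := inner_re_symm (𝕜 := ℂ) (A x) (A y)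
  simp only [← inner_self_eq_norm_sq (𝕜 := ℂ), herm]
  simp only [RCLike.re_eq_complex_re] at *
  simp only [Complex.add_re, Complex.sub_re]
  linarith

/-- In the midpoint variable m = (x + y)/2 the phase factors into a part free of m and the Gaussian
of `wick`; this identity produces the Wick kernel. -/
theorem weylPhase_mul_shiftKernel (A : Cn n ≃L[ℂ] Cn n) (h : ℝ) (δ x z m : Cn n) :
    weylPhase A h x ((2 : ℝ) • m - x) * shiftKernel A h δ ((2 : ℝ) • m - x) z =
      shiftKernel A h δ x z * Complex.exp (-4 * herm A (m - (z + δ)) (m - x) / h) := by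
  have hm : A ((2 : ℝ) • m) = A m + A m := by
    rw [two_smul, map_add]
  rw [weylPhase, shiftKernel, shiftKernel, ← Complex.exp_add, ← Complex.exp_add]
  congr 1
  simp only [herm, map_sub, hm, map_add, inner_add_left, inner_add_right, inner_sub_left,
    inner_sub_right]
  ring

theorem integral_comp_two_smul_sub (f : Cn n → ℂ) (x : Cn n) :
    ∫ y, f y = 4 ^ n * ∫ m, f ((2 : ℝ) • m - x) := by
  have h1 := integral_comp_inv_smul (n := n) (fun m => f ((2 : ℝ) • m - x)) (r := 2) two_pos
  rw [← integral_sub_right_eq_self f x]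
  calc ∫ y, f (y - x) = ∫ y, f ((2 : ℝ) • ((2 : ℝ)⁻¹ • y) - x) := by
        simp only [smul_inv_smul₀ (two_ne_zero' ℝ)]
    _ = _ := by
        rw [h1, Complex.real_smul]
        norm_num

theorem integral_weylPhase_eq (A : Cn n ≃L[ℂ] Cn n) {h : ℝ} (hh : 0 < h) {a : Cn n → ℂ}
    (ha : Continuous a) {A₀ : ℝ} (hA₀ : ∀ m, ‖a m‖ ≤ A₀) {v : Cn n → ℂ} (hv : Differentiable ℂ v)
    {B : ℝ} (hB : ∀ z, ‖v z‖ * Real.exp (-(‖A z‖ ^ 2 / h)) ≤ B)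
    (hint : Integrable fun z => ‖v z‖ * Real.exp (-(‖A z‖ ^ 2 / h))) (δ x : Cn n) :
    ∫ y, weylPhase A h x y * a ((1 / 2 : ℝ) • (x + y)) * v y =
      4 ^ n / gaussMass A (2 / h) * ∫ z, shiftKernel A h δ x z * wick A h a x (z + δ) * v z := by
  have hM : (gaussMass A (2 / h) : ℂ) ≠ 0 := by
    exact_mod_cast (gaussMass_pos A (by positivity)).ne'
  have hA0 : 0 ≤ A₀ := (norm_nonneg _).trans (hA₀ 0)
  have hswap : ∫ y, ∫ z, weylPhase A h x y * a ((1 / 2 : ℝ) • (x + y)) *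
        (shiftKernel A h δ y z * v z) =
      ∫ z, ∫ y, weylPhase A h x y * a ((1 / 2 : ℝ) • (x + y)) *
        (shiftKernel A h δ y z * v z) := by
    refine integral_integral_swap ?_
    have hg : Integrable fun w => Real.exp (-(1 / h * ‖A (w - δ)‖ ^ 2)) :=
      (integrable_gaussian A (one_div_pos.2 hh)).comp_sub_right δ
    -- The growth of the kernel in y cancels the decay of the Weyl phase; what remains is a
    -- convolution integrand of weighted v against a Gaussian. This is where integrability of
    -- weighted v is needed.
    have hconv := (hint.convolution_integrand (ContinuousLinearMap.mul ℝ ℝ) hg).const_mul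
      (Real.exp ((‖A x‖ ^ 2 + ‖A δ‖ ^ 2) / h) * A₀)
    refine hconv.mono' ?_ (Filter.Eventually.of_forall fun p => ?_)
    · have c1 := continuous_shiftKernel A h (continuous_const (y := δ)) continuous_fst
        (continuous_snd (X := Cn n) (Y := Cn n))
      have c2 : Continuous fun p : Cn n × Cn n => weylPhase A h x p.1 := by
        have d1 := continuous_herm A (continuous_fst (X := Cn n) (Y := Cn n)) continuous_fst
        have d2 := continuous_herm A (continuous_const (y := x))
          (continuous_fst (X := Cn n) (Y := Cn n))
        have d3 := continuous_herm A (continuous_fst (X := Cn n) (Y := Cn n))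
          (continuous_const (y := x))
        unfold weylPhase
        fun_prop
      have c3 : Continuous fun p : Cn n × Cn n => a ((1 / 2 : ℝ) • (x + p.1)) := by fun_prop
      have c4 : Continuous fun p : Cn n × Cn n => v p.2 := hv.continuous.comp continuous_snd
      exact ((c2.mul c3).mul (c1.mul c4)).aestronglyMeasurable
    · obtain ⟨y, z⟩ := p
      simp only [Function.uncurry, ContinuousLinearMap.mul_apply']
      have e : Real.exp ((‖A x‖ ^ 2 - ‖A y‖ ^ 2) / h) * Real.exp ((‖A y‖ ^ 2 + ‖A δ‖ ^ 2) / h) =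
          Real.exp ((‖A x‖ ^ 2 + ‖A δ‖ ^ 2) / h) := by
        rw [← Real.exp_add]
        congr 1
        ring
      rw [norm_mul, norm_mul, norm_weylPhase, norm_mul, norm_shiftKernel_mul]
      calc Real.exp ((‖A x‖ ^ 2 - ‖A y‖ ^ 2) / h) * ‖a ((1 / 2 : ℝ) • (x + y))‖ *
            (Real.exp ((‖A y‖ ^ 2 + ‖A δ‖ ^ 2) / h) *
            (Real.exp (-(1 / h * ‖A (y - z - δ)‖ ^ 2)) *
              (‖v z‖ * Real.exp (-(‖A z‖ ^ 2 / h)))))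
          = (Real.exp ((‖A x‖ ^ 2 - ‖A y‖ ^ 2) / h) * Real.exp ((‖A y‖ ^ 2 + ‖A δ‖ ^ 2) / h)) *
            ‖a ((1 / 2 : ℝ) • (x + y))‖ * (‖v z‖ * Real.exp (-(‖A z‖ ^ 2 / h)) *
            Real.exp (-(1 / h * ‖A (y - z - δ)‖ ^ 2))) := by ring
        _ ≤ _ := by
          rw [e]
          gcongr
          exact hA₀ _
  have hinner : ∀ z, ∫ y, weylPhase A h x y * a ((1 / 2 : ℝ) • (x + y)) *
        (shiftKernel A h δ y z * v z) =
      4 ^ n * (shiftKernel A h δ x z * wick A h a x (z + δ) * v z) := by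
    intro z
    rw [integral_comp_two_smul_sub _ x]
    congr 1
    have hmid : ∀ m : Cn n, (1 / 2 : ℝ) • (x + ((2 : ℝ) • m - x)) = m := by
      intro m
      rw [add_sub_cancel, smul_smul]
      norm_num
    simp only [hmid]
    rw [wick, ← integral_const_mul, ← integral_mul_const]
    refine integral_congr_ae (Filter.Eventually.of_forall fun m => ?_)
    have := weylPhase_mul_shiftKernel A h δ x z m
    simp only
    linear_combination a m * v z * this
  have houter : ∀ y, ∫ z, weylPhase A h x y * a ((1 / 2 : ℝ) • (x + y)) *
        (shiftKernel A h δ y z * v z) =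
      gaussMass A (2 / h) * (weylPhase A h x y * a ((1 / 2 : ℝ) • (x + y)) * v y) := by
    intro y
    rw [integral_const_mul, reproducing_of_bounded A hh δ y hv hB]
    ring
  simp only [hinner, houter, integral_const_mul] at hswap
  rw [div_mul_eq_mul_div, eq_div_iff hM, mul_comm, hswap]

/-! ### Gevrey bounds for directional derivatives -/

theorem eq_sum_realDir (e : Cn n) :
    e = ∑ p : Fin n × Fin 2, (if p.2 = 0 then (e p.1).re else (e p.1).im) • realDir p := by
  ext j
  rw [WithLp.ofLp_sum, Finset.sum_apply, Fintype.sum_prod_type]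
  simp only [Fin.sum_univ_two, realDir, PiLp.smul_apply, PiLp.single_apply]
  rw [Finset.sum_eq_single j]
  · simp [Complex.re_add_im]
  · intro i _ hi
    simp [Ne.symm hi]
  · simp

/-- Expanding e in the 2n real directions gives (2n)^k words, and each multi-index factorial divides
k!. -/
theorem norm_iteratedFDeriv_apply_const_le {s A₀ C : ℝ} (hs : 0 ≤ s) (hA₀ : 0 ≤ A₀) (hC : 0 ≤ C)
    {a : Cn n → ℂ} (ha : GevreyBound s A₀ C a) (k : ℕ) (m e : Cn n) :
    ‖iteratedFDeriv ℝ k a m fun _ => e‖ ≤ A₀ * (2 * n * C * ‖e‖) ^ k * (k.factorial : ℝ) ^ s := by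
  set c : Fin n × Fin 2 → ℝ := fun p => if p.2 = 0 then (e p.1).re else (e p.1).im with hc
  have hcle : ∀ p, |c p| ≤ ‖e‖ := by
    intro p
    have h1 : ‖e p.1‖ ≤ ‖e‖ := PiLp.norm_apply_le e p.1
    simp only [hc]
    split_ifs
    · exact (Complex.abs_re_le_norm _).trans h1
    · exact (Complex.abs_im_le_norm _).trans h1
  have hfac : ∀ σ : Fin k → Fin n × Fin 2,
      ((∏ p, (Finset.univ.filter fun i => σ i = p).card.factorial : ℕ) : ℝ) ^ s ≤
        (k.factorial : ℝ) ^ s := by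
    intro σ
    refine Real.rpow_le_rpow (Nat.cast_nonneg _) ?_ hs
    have hsum : ∑ p, (Finset.univ.filter fun i => σ i = p).card = k := by
      rw [← Finset.card_eq_sum_card_fiberwise (fun i _ => Finset.mem_univ (σ i))]
      simp
    have := Nat.prod_factorial_dvd_factorial_sum Finset.univ
      fun p => (Finset.univ.filter fun i => σ i = p).card
    rw [hsum] at this
    exact_mod_cast Nat.le_of_dvd (Nat.factorial_pos k) this
  calc ‖iteratedFDeriv ℝ k a m fun _ => e‖
      = ‖iteratedFDeriv ℝ k a m fun _ => ∑ p, c p • realDir p‖ := by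
        rw [← eq_sum_realDir e]
    _ = ‖∑ σ : Fin k → Fin n × Fin 2, iteratedFDeriv ℝ k a m fun i => c (σ i) • realDir (σ i)‖ := by
        rw [ContinuousMultilinearMap.map_sum]
    _ ≤ ∑ σ : Fin k → Fin n × Fin 2,
          ‖iteratedFDeriv ℝ k a m fun i => c (σ i) • realDir (σ i)‖ := norm_sum_le _ _
    _ ≤ ∑ _σ : Fin k → Fin n × Fin 2, ‖e‖ ^ k * (A₀ * C ^ k * (k.factorial : ℝ) ^ s) := by
        refine Finset.sum_le_sum fun σ _ => ?_
        rw [ContinuousMultilinearMap.map_smul_univ, norm_smul, norm_prod]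
        refine mul_le_mul ?_ ((ha.2 k σ m).trans ?_) (norm_nonneg _) (by positivity)
        · calc ∏ i, ‖c (σ i)‖ ≤ ∏ _i : Fin k, ‖e‖ :=
                Finset.prod_le_prod (fun _ _ => norm_nonneg _) fun i _ => hcle _
            _ = ‖e‖ ^ k := by simp
        · have := hfac σ
          gcongr
    _ = _ := by
        rw [Finset.sum_const, Finset.card_univ, Fintype.card_fun, Fintype.card_prod,
          Fintype.card_fin, Fintype.card_fin, Fintype.card_fin, nsmul_eq_mul]
        push_cast
        ring

theorem fderiv_iteratedFDeriv_apply_const {a : Cn n → ℂ} (ha : ContDiff ℝ ∞ a) (k : ℕ)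
    (m e : Cn n) :
    fderiv ℝ (fun m => iteratedFDeriv ℝ k a m fun _ => e) m e =
      iteratedFDeriv ℝ (k + 1) a m fun _ => e := by
  have hd : DifferentiableAt ℝ (iteratedFDeriv ℝ k a) m :=
    (ha.differentiable_iteratedFDeriv (by exact_mod_cast WithTop.coe_lt_top _)) m
  rw [iteratedFDeriv_succ_apply_left]
  have h1 : HasFDerivAt (fun m => iteratedFDeriv ℝ k a m fun _ => e)
      ((ContinuousMultilinearMap.apply ℝ (fun _ : Fin k => Cn n) ℂ fun _ => e).comp
        (fderiv ℝ (iteratedFDeriv ℝ k a) m)) m :=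
    (ContinuousMultilinearMap.apply ℝ (fun _ : Fin k => Cn n) ℂ fun _ => e).hasFDerivAt.comp m
      hd.hasFDerivAt
  rw [h1.fderiv]
  rfl

theorem contDiff_iteratedFDeriv_apply_const {a : Cn n → ℂ} (ha : ContDiff ℝ ∞ a) (k : ℕ)
    (e : Cn n) : ContDiff ℝ 1 fun m => iteratedFDeriv ℝ k a m fun _ => e := by
  have h1 : ContDiff ℝ 1 (iteratedFDeriv ℝ k a) :=
    ha.iteratedFDeriv_right (by exact_mod_cast le_top)
  exact (ContinuousMultilinearMap.apply ℝ (fun _ : Fin k => Cn n) ℂ fun _ => e).contDiff.comp h1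

/-! ### The Wick kernel along complex lines -/

/-- The Gaussian occurring in `wick` at `x = w + te`, `z = w - te`, centred at `w`. -/
def wickGauss (A : Cn n ≃L[ℂ] Cn n) (h : ℝ) (e μ : Cn n) (t : ℝ) : ℂ :=
  Complex.exp (-4 * herm A (μ + t • e) (μ - t • e) / h)

/-- The value of `wick` at `x = w + te`, `z = w - te`. -/
def wickLine (A : Cn n ≃L[ℂ] Cn n) (h : ℝ) (b : Cn n → ℂ) (w e : Cn n) (t : ℝ) : ℂ :=
  ∫ μ, b (w + μ) * wickGauss A h e μ t

theorem map_real_smul (A : Cn n ≃L[ℂ] Cn n) (r : ℝ) (x : Cn n) : A (r • x) = r • A x :=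
  (A.restrictScalars ℝ).map_smul r x

theorem wick_add_sub (A : Cn n ≃L[ℂ] Cn n) (h : ℝ) (a : Cn n → ℂ) (w e : Cn n) :
    wick A h a (w + e) (w - e) = wickLine A h a w e 1 := by
  rw [wick, wickLine, ← integral_add_left_eq_self _ w]
  simp only [wickGauss, one_smul]
  congr 1
  ext μ
  rw [show w + μ - (w - e) = μ + e by abel, show w + μ - (w + e) = μ - e by abel]

/-- The cross terms of ⟨A(μ+te), A(μ-te)⟩ are purely imaginary, leaving |Aμ|² - t²|Ae|²: decay in μ,
growth in t. -/
theorem norm_wickGauss (A : Cn n ≃L[ℂ] Cn n) (h : ℝ) (e μ : Cn n) (t : ℝ) :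
    ‖wickGauss A h e μ t‖ =
      Real.exp (4 * t ^ 2 * ‖A e‖ ^ 2 / h) * Real.exp (-(4 / h * ‖A μ‖ ^ 2)) := by
  rw [wickGauss, Complex.norm_exp, ← Real.exp_add]
  congr 1
  rw [Complex.div_ofReal_re]
  have e1 := inner_re_symm (𝕜 := ℂ) (A μ) (A (t • e))
  have e2 : ‖A (t • e)‖ ^ 2 = t ^ 2 * ‖A e‖ ^ 2 := by
    rw [map_real_smul, norm_smul, mul_pow, Real.norm_eq_abs, sq_abs]
  have e3 : (herm A (μ + t • e) (μ - t • e)).re = ‖A μ‖ ^ 2 - t ^ 2 * ‖A e‖ ^ 2 := by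
    rw [← e2]
    simp only [← inner_self_eq_norm_sq (𝕜 := ℂ), herm, map_add, map_sub, inner_add_left,
      inner_sub_right]
    simp only [RCLike.re_eq_complex_re] at *
    simp only [Complex.add_re, Complex.sub_re]
    linarith
  rw [show (-4 * herm A (μ + t • e) (μ - t • e)).re = -4 * (herm A (μ + t • e) (μ - t • e)).re by
    simp, e3]
  ring

theorem continuous_wickGauss (A : Cn n ≃L[ℂ] Cn n) (h : ℝ) (e : Cn n) (t : ℝ) :
    Continuous fun μ => wickGauss A h e μ t := by
  have := continuous_herm A (f := fun μ => μ + t • e) (g := fun μ => μ - t • e)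
    (by fun_prop) (by fun_prop)
  unfold wickGauss
  fun_prop

/-- Two independent directions allow both uses: (e, -e) for the t-derivative of `wickGauss` and (ie,
ie) for its derivative in μ. -/
theorem hasDerivAt_exp_herm (A : Cn n ≃L[ℂ] Cn n) (h : ℝ) (p q e₁ e₂ : Cn n) (t : ℝ) :
    HasDerivAt (fun t : ℝ => Complex.exp (-4 * herm A (p + t • e₁) (q + t • e₂) / h))
      (Complex.exp (-4 * herm A (p + t • e₁) (q + t • e₂) / h) *
        (-4 * (herm A (p + t • e₁) e₂ + herm A e₁ (q + t • e₂)) / h)) t := by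
  have key : ∀ p e : Cn n, HasDerivAt (fun t : ℝ => A (p + t • e)) (A e) t := by
    intro p e
    have := ((hasDerivAt_id t).smul_const (A e)).const_add (A p)
    rw [one_smul] at this
    refine this.congr_of_eventuallyEq (Filter.Eventually.of_forall fun t => ?_)
    simp [map_real_smul]
  have h1 := ((key p e₁).inner ℂ (key q e₂))
  exact ((h1.const_mul (-4 : ℂ)).div_const (h : ℂ)).cexp

theorem hasDerivAt_wickGauss (A : Cn n ≃L[ℂ] Cn n) (h : ℝ) (e μ : Cn n) (t : ℝ) :
    HasDerivAt (wickGauss A h e μ)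
      (wickGauss A h e μ t * (-4 * (herm A e (μ - t • e) - herm A (μ + t • e) e) / h)) t := by
  have := hasDerivAt_exp_herm A h μ μ e (-e) t
  simp only [smul_neg, ← sub_eq_add_neg] at this
  have e1 : herm A e (μ - t • e) - herm A (μ + t • e) e =
      herm A (μ + t • e) (-e) + herm A e (μ - t • e) := by
    simp only [herm, map_neg, inner_neg_right]
    ring
  rw [e1]
  exact this

theorem differentiable_wickGauss (A : Cn n ≃L[ℂ] Cn n) (h : ℝ) (e : Cn n) (t : ℝ) :
    Differentiable ℝ fun μ => wickGauss A h e μ t := by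
  have h1 : ∀ c : Cn n, Differentiable ℝ fun μ => A (μ + c) := fun c =>
    (A.restrictScalars ℝ).differentiable.comp (differentiable_id.add_const c)
  have h2 : Differentiable ℝ fun μ => herm A (μ + t • e) (μ + -(t • e)) :=
    (h1 _).inner ℂ (h1 _)
  have h3 : Differentiable ℝ fun μ => -4 * herm A (μ + t • e) (μ + -(t • e)) / (h : ℂ) := by
    simpa only [div_eq_mul_inv] using (h2.const_mul (-4 : ℂ)).mul_const ((h : ℂ)⁻¹)
  simpa only [wickGauss, sub_eq_add_neg] using h3.cexp

/-- Because the form is antilinear in its first slot and linear in its second, i times the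
μ-derivative along ie equals the t-derivative. Hence differentiation in t can be integrated by
parts. -/
theorem fderiv_wickGauss (A : Cn n ≃L[ℂ] Cn n) (h : ℝ) (e μ : Cn n) (t : ℝ) :
    Complex.I * fderiv ℝ (fun μ => wickGauss A h e μ t) μ (Complex.I • e) =
      wickGauss A h e μ t * (-4 * (herm A e (μ - t • e) - herm A (μ + t • e) e) / h) := by
  rw [← (differentiable_wickGauss A h e t μ).lineDeriv_eq_fderiv, lineDeriv]
  have h1 := hasDerivAt_exp_herm A h (μ + t • e) (μ - t • e) (Complex.I • e) (Complex.I • e) 0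
  have h2 := h1.congr_of_eventuallyEq
    (f₁ := fun r : ℝ => wickGauss A h e (μ + r • Complex.I • e) t)
    (Filter.Eventually.of_forall fun r => by
      simp only [wickGauss]
      rw [add_right_comm,
        show μ + r • Complex.I • e - t • e = μ - t • e + r • Complex.I • e by abel])
  rw [h2.deriv]
  simp only [zero_smul, add_zero, wickGauss, herm, map_smul, inner_smul_left, inner_smul_right,
    Complex.conj_I]
  linear_combination (Complex.exp (-4 * inner ℂ (A (μ + t • e)) (A (μ - t • e)) / h) * 4 / h *
    (inner ℂ (A e) (A (μ - t • e)) - inner ℂ (A (μ + t • e)) (A e))) * Complex.I_sq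

/-- Absorbs the linear factor of the differentiated Gaussian at the price of half its exponent. -/
theorem add_le_mul_exp {h : ℝ} (hh : 0 < h) {c : ℝ} (hc : 0 ≤ c) (y : ℝ) :
    y + c ≤ (1 + c + h) * Real.exp (2 / h * y ^ 2) := by
  have h1 := Real.add_one_le_exp (2 / h * y ^ 2)
  have h2 : 0 ≤ 2 / h * y ^ 2 := by positivity
  have h3 : 1 ≤ Real.exp (2 / h * y ^ 2) := by linarith
  have h4 : y ≤ 1 + h * (2 / h * y ^ 2) := by
    rw [show h * (2 / h * y ^ 2) = 2 * y ^ 2 by field_simp]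
    nlinarith [sq_nonneg (y - 1)]
  nlinarith [mul_nonneg hh.le h2, mul_le_mul_of_nonneg_left h1 hh.le,
    mul_le_mul_of_nonneg_left h3 hc]

theorem norm_deriv_wickGauss_le (A : Cn n ≃L[ℂ] Cn n) {h : ℝ} (hh : 0 < h) (e : Cn n) (T : ℝ)
    (μ : Cn n) {t : ℝ} (ht : |t| ≤ T) :
    ‖wickGauss A h e μ t * (-4 * (herm A e (μ - t • e) - herm A (μ + t • e) e) / h)‖ ≤
      Real.exp (4 * T ^ 2 * ‖A e‖ ^ 2 / h) * (8 / h * ‖A e‖ * (1 + T * ‖A e‖ + h)) *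
        Real.exp (-(2 / h * ‖A μ‖ ^ 2)) := by
  have hT : 0 ≤ T := (abs_nonneg t).trans ht
  have hA1 : ‖A (μ - t • e)‖ ≤ ‖A μ‖ + T * ‖A e‖ := by
    rw [map_sub, map_real_smul]
    refine (norm_sub_le _ _).trans ?_
    rw [norm_smul, Real.norm_eq_abs]
    gcongr
  have hA2 : ‖A (μ + t • e)‖ ≤ ‖A μ‖ + T * ‖A e‖ := by
    rw [map_add, map_real_smul]
    refine (norm_add_le _ _).trans ?_
    rw [norm_smul, Real.norm_eq_abs]
    gcongr
  have h1 : ‖-4 * (herm A e (μ - t • e) - herm A (μ + t • e) e) / (h : ℂ)‖ ≤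
      8 / h * ‖A e‖ * (‖A μ‖ + T * ‖A e‖) := by
    rw [norm_div, norm_mul, Complex.norm_real, Real.norm_of_nonneg hh.le]
    have h2 : ‖herm A e (μ - t • e) - herm A (μ + t • e) e‖ ≤
        2 * (‖A e‖ * (‖A μ‖ + T * ‖A e‖)) := by
      refine (norm_sub_le _ _).trans ?_
      have h3 := (norm_inner_le_norm (𝕜 := ℂ) (A e) (A (μ - t • e))).trans
        (mul_le_mul_of_nonneg_left hA1 (norm_nonneg _))
      have h4 := (norm_inner_le_norm (𝕜 := ℂ) (A (μ + t • e)) (A e)).trans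
        (mul_le_mul_of_nonneg_right hA2 (norm_nonneg _))
      simp only [herm]
      linarith
    rw [div_le_iff₀ hh]
    have h5 : 8 / h * ‖A e‖ * (‖A μ‖ + T * ‖A e‖) * h = 8 * (‖A e‖ * (‖A μ‖ + T * ‖A e‖)) := by
      field_simp
    rw [h5]
    have h6 : ‖(-4 : ℂ)‖ = 4 := by simp
    rw [h6]
    linarith
  have h7 := add_le_mul_exp hh (c := T * ‖A e‖) (by positivity) ‖A μ‖
  have h8 : Real.exp (-(4 / h * ‖A μ‖ ^ 2)) * Real.exp (2 / h * ‖A μ‖ ^ 2) =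
      Real.exp (-(2 / h * ‖A μ‖ ^ 2)) := by
    rw [← Real.exp_add]
    congr 1
    ring
  have h9 : t ^ 2 ≤ T ^ 2 := by
    rw [← sq_abs t]
    gcongr
  rw [norm_mul, norm_wickGauss]
  calc _ ≤ Real.exp (4 * T ^ 2 * ‖A e‖ ^ 2 / h) * Real.exp (-(4 / h * ‖A μ‖ ^ 2)) *
        (8 / h * ‖A e‖ * ((1 + T * ‖A e‖ + h) * Real.exp (2 / h * ‖A μ‖ ^ 2))) := by
        refine mul_le_mul ?_ (h1.trans ?_) (norm_nonneg _) (by positivity)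
        · gcongr
        · gcongr
    _ = Real.exp (4 * T ^ 2 * ‖A e‖ ^ 2 / h) * (8 / h * ‖A e‖ * (1 + T * ‖A e‖ + h)) *
        (Real.exp (-(4 / h * ‖A μ‖ ^ 2)) * Real.exp (2 / h * ‖A μ‖ ^ 2)) := by ring
    _ = _ := by rw [h8]

theorem integrable_mul_wickGauss (A : Cn n ≃L[ℂ] Cn n) {h : ℝ} (hh : 0 < h) {b : Cn n → ℂ}
    (hb : Continuous b) {M : ℝ} (hM : ∀ m, ‖b m‖ ≤ M) (w e : Cn n) (t : ℝ) :
    Integrable fun μ => b (w + μ) * wickGauss A h e μ t := by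
  refine (((integrable_gaussian A (show 0 < 4 / h by positivity)).const_mul
    (Real.exp (4 * t ^ 2 * ‖A e‖ ^ 2 / h))).const_mul M).mono'
    ((hb.comp (by fun_prop)).mul (continuous_wickGauss A h e t)).aestronglyMeasurable
    (Filter.Eventually.of_forall fun μ => ?_)
  rw [norm_mul, norm_wickGauss]
  gcongr
  exact hM _

theorem norm_wickLine_le (A : Cn n ≃L[ℂ] Cn n) {h : ℝ} (hh : 0 < h) {b : Cn n → ℂ}
    {M : ℝ} (hM : ∀ m, ‖b m‖ ≤ M) (w e : Cn n) (t : ℝ) :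
    ‖wickLine A h b w e t‖ ≤
      M * gaussMass A (4 / h) * Real.exp (4 * t ^ 2 * ‖A e‖ ^ 2 / h) := by
  have hint := ((integrable_gaussian A (show 0 < 4 / h by positivity)).const_mul
    (M * Real.exp (4 * t ^ 2 * ‖A e‖ ^ 2 / h)))
  refine (norm_integral_le_of_norm_le hint (Filter.Eventually.of_forall fun μ => ?_)).trans_eq ?_
  · rw [norm_mul, norm_wickGauss, mul_assoc M]
    exact mul_le_mul_of_nonneg_right (hM _) (by positivity)
  · rw [integral_const_mul, gaussMass]
    ring

/-- Differentiate under the integral, rewrite the t-derivative of the Gaussian as i times its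
derivative along ie, and integrate by parts. The family is closed under d/dt, with b replaced by its
derivative along ie. -/
theorem hasDerivAt_wickLine (A : Cn n ≃L[ℂ] Cn n) {h : ℝ} (hh : 0 < h) {b : Cn n → ℂ}
    (hb : ContDiff ℝ 1 b) {M M' : ℝ} (hM : ∀ m, ‖b m‖ ≤ M) (w e : Cn n)
    (hM' : ∀ m, ‖fderiv ℝ b m (Complex.I • e)‖ ≤ M') (t : ℝ) :
    HasDerivAt (wickLine A h b w e)
      (-Complex.I * wickLine A h (fun m => fderiv ℝ b m (Complex.I • e)) w e t) t := by
  have hb' : Continuous fun m => fderiv ℝ b m (Complex.I • e) :=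
    (hb.continuous_fderiv one_ne_zero).clm_apply continuous_const
  have hbd : Differentiable ℝ fun μ => b (w + μ) :=
    (hb.differentiable one_ne_zero).comp (differentiable_id.const_add w)
  have hfd : ∀ μ, fderiv ℝ (fun μ => b (w + μ)) μ = fderiv ℝ b (w + μ) := fun μ =>
    fderiv_comp_add_left w
  have hcont' : Continuous fun μ =>
      wickGauss A h e μ t * (-4 * (herm A e (μ - t • e) - herm A (μ + t • e) e) / h) := by
    have c1 := continuous_wickGauss A h e t
    have c2 := continuous_herm A (f := fun _ => e) (g := fun μ => μ - t • e)
      (by fun_prop) (by fun_prop)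
    have c3 := continuous_herm A (f := fun μ => μ + t • e) (g := fun _ => e)
      (by fun_prop) (by fun_prop)
    fun_prop
  have hder := hasDerivAt_integral_of_dominated_loc_of_deriv_le (μ := volume)
    (F := fun (t : ℝ) μ => b (w + μ) * wickGauss A h e μ t) (x₀ := t)
    (F' := fun t μ => b (w + μ) *
      (wickGauss A h e μ t * (-4 * (herm A e (μ - t • e) - herm A (μ + t • e) e) / h)))
    (bound := fun μ => M * (Real.exp (4 * (|t| + 1) ^ 2 * ‖A e‖ ^ 2 / h) *
      (8 / h * ‖A e‖ * (1 + (|t| + 1) * ‖A e‖ + h)) * Real.exp (-(2 / h * ‖A μ‖ ^ 2))))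
    (s := Metric.ball t 1) (Metric.ball_mem_nhds t one_pos)
    (Filter.Eventually.of_forall fun t =>
      (integrable_mul_wickGauss A hh hb.continuous hM w e t).aestronglyMeasurable)
    (integrable_mul_wickGauss A hh hb.continuous hM w e t)
    ((hb.continuous.comp (by fun_prop)).mul hcont').aestronglyMeasurable
    (Filter.Eventually.of_forall fun μ r hr => by
      rw [norm_mul]
      have hr' : |r| ≤ |t| + 1 := by
        rw [Metric.mem_ball, Real.dist_eq] at hr
        have := abs_sub_abs_le_abs_sub r t
        linarith
      have h1 := norm_deriv_wickGauss_le A hh e (|t| + 1) μ hr'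
      have h2 := hM (w + μ)
      exact mul_le_mul h2 h1 (norm_nonneg _) ((norm_nonneg _).trans h2))
    (((integrable_gaussian A (show 0 < 2 / h by positivity)).const_mul _).const_mul _)
    (Filter.Eventually.of_forall fun μ r _ => (hasDerivAt_wickGauss A h e μ r).const_mul _)
  refine hder.2.congr_deriv ?_
  have hparts := integral_mul_fderiv_eq_neg_fderiv_mul_of_integrable (μ := volume)
    (f := fun μ => b (w + μ)) (g := fun μ => wickGauss A h e μ t) (v := Complex.I • e)
    (by
      simp only [hfd]
      exact integrable_mul_wickGauss A hh hb' hM' w e t)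
    (by
      refine (hder.1.const_mul (-Complex.I)).congr (Filter.Eventually.of_forall fun μ => ?_)
      simp only
      rw [← fderiv_wickGauss]
      linear_combination (-b (w + μ) *
        fderiv ℝ (fun μ => wickGauss A h e μ t) μ (Complex.I • e)) * Complex.I_sq)
    (integrable_mul_wickGauss A hh hb.continuous hM w e t)
    (fun μ _ => hbd μ) (fun μ _ => differentiable_wickGauss A h e t μ)
  simp only [hfd] at hparts
  simp only [← fderiv_wickGauss]
  rw [wickLine, neg_mul, ← mul_neg, ← hparts, ← integral_const_mul]
  congr 1
  ext μ
  ring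

/-! ### Taylor expansion -/

/-- Induction on the order: the bound for g (k+1) is the derivative of the asserted bound for g k,
and the latter holds at t₀. The unimodular κ is invisible to norms. -/
theorem norm_le_taylor_of_hasDerivAt {g : ℕ → ℝ → ℂ} {κ : ℂ} (hκ : ‖κ‖ = 1)
    (hg : ∀ k t, HasDerivAt (g k) (κ * g (k + 1) t) t) {t₀ t₁ : ℝ} {c : ℕ → ℝ}
    (hc : ∀ k, ‖g k t₀‖ ≤ c k) {M : ℝ} (N : ℕ) :
    ∀ k, (∀ t ∈ Set.Icc t₀ t₁, ‖g (k + N) t‖ ≤ M) → ∀ t ∈ Set.Icc t₀ t₁,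
      ‖g k t‖ ≤ ∑ j ∈ Finset.range N, c (k + j) * ((t - t₀) ^ j / j.factorial) +
        M * ((t - t₀) ^ N / N.factorial) := by
  induction N with
  | zero => 
    intro k hM t ht
    simpa using hM t ht
  | succ N ih =>
    intro k hM t ht
    have h1 := ih (k + 1) (by
      intro t ht
      rw [add_right_comm]
      exact hM t ht)
    have hpow : ∀ (j : ℕ) (t : ℝ), HasDerivAt
        (fun t => (t - t₀) ^ (j + 1) / ((j + 1).factorial : ℝ)) ((t - t₀) ^ j / j.factorial) t := by
      intro j t
      have := (((hasDerivAt_id t).sub_const t₀).pow (j + 1)).div_const ((j + 1).factorial : ℝ)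
      refine this.congr_deriv ?_
      simp only [id, Nat.factorial_succ, Nat.add_sub_cancel]
      push_cast
      field_simp
    have hB : ∀ t, HasDerivAt (fun t => ∑ j ∈ Finset.range (N + 1),
        c (k + j) * ((t - t₀) ^ j / j.factorial) + M * ((t - t₀) ^ (N + 1) / (N + 1).factorial))
        (∑ j ∈ Finset.range N, c (k + 1 + j) * ((t - t₀) ^ j / j.factorial) +
        M * ((t - t₀) ^ N / N.factorial)) t := by
      intro t
      refine HasDerivAt.add ?_ ((hpow N t).const_mul M)
      simp only [Finset.sum_range_succ']
      refine HasDerivAt.congr_deriv (f' := ∑ j ∈ Finset.range N,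
        c (k + 1 + j) * ((t - t₀) ^ j / j.factorial) + 0) (HasDerivAt.add ?_ ?_) (add_zero _)
      · refine HasDerivAt.fun_sum fun j _ => ?_
        rw [add_right_comm, add_assoc k j 1]
        exact (hpow j t).const_mul _
      · simpa using hasDerivAt_const t _
    refine image_norm_le_of_norm_deriv_right_le_deriv_boundary (f := g k)
      (fun t _ => (hg k t).continuousAt.continuousWithinAt)
      (fun t _ => (hg k t).hasDerivWithinAt) ?_ hB ?_ ht
    · rw [Finset.sum_range_succ']
      simpa using hc k
    · intro t ht
      rw [norm_mul, hκ, one_mul]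
      exact h1 t (Set.Ico_subset_Icc_self ht)

/-! ### Bounds on the Wick kernel -/

/-- Truncating a Gevrey series of radius `ρ` at its smallest term. -/
theorem exists_gevrey_truncation {s C₁ ρ : ℝ} (hs : 1 < s) (hC₁ : 0 < C₁) (hρ : 0 < ρ) :
    ∃ N : ℕ, ∑ k ∈ Finset.range N, (C₁ * ρ) ^ k * (k.factorial : ℝ) ^ s / k.factorial ≤ 2 ∧
      (C₁ * ρ) ^ N * (N.factorial : ℝ) ^ s / N.factorial ≤
        Real.exp 1 * Real.exp (-((Real.exp 1 * C₁)⁻¹ / ρ) ^ (1 / (s - 1))) := by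
  have hs' : 0 < s - 1 := by linarith
  set X : ℝ := ((Real.exp 1 * C₁)⁻¹ / ρ) ^ (1 / (s - 1)) with hX
  have hX0 : 0 ≤ X := by positivity
  -- For k ≤ N one has k! ≤ N^k, so the k-th term is at most (C₁ρN^{s-1})^k; the choice of X makes
  -- this e^{-k}.
  set N := ⌊X⌋₊ with hN
  have hNX : (N : ℝ) ≤ X := Nat.floor_le hX0
  have hNs : (N : ℝ) ^ (s - 1) ≤ (Real.exp 1 * C₁)⁻¹ / ρ := by
    calc (N : ℝ) ^ (s - 1) ≤ X ^ (s - 1) := Real.rpow_le_rpow (Nat.cast_nonneg _) hNX hs'.le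
      _ = _ := by
        rw [hX, ← Real.rpow_mul (by positivity), one_div_mul_cancel hs'.ne', Real.rpow_one]
  have hterm : ∀ k ≤ N, (C₁ * ρ) ^ k * (k.factorial : ℝ) ^ s / k.factorial ≤ Real.exp (-1) ^ k := by
    intro k hk
    have h1 : (k.factorial : ℝ) ≤ (N : ℝ) ^ k := by
      exact_mod_cast (Nat.factorial_le_pow k).trans (Nat.pow_le_pow_left hk k)
    have h0 : (0 : ℝ) < k.factorial := by positivity
    have h2 : (k.factorial : ℝ) ^ s / k.factorial ≤ ((N : ℝ) ^ (s - 1)) ^ k := by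
      calc (k.factorial : ℝ) ^ s / k.factorial = (k.factorial : ℝ) ^ (s - 1) := by
            rw [Real.rpow_sub_one h0.ne']
        _ ≤ ((N : ℝ) ^ k) ^ (s - 1) := Real.rpow_le_rpow h0.le h1 hs'.le
        _ = _ := by
          rw [← Real.rpow_natCast, ← Real.rpow_mul (Nat.cast_nonneg _), mul_comm,
            Real.rpow_mul (Nat.cast_nonneg _), Real.rpow_natCast]
    calc (C₁ * ρ) ^ k * (k.factorial : ℝ) ^ s / k.factorial
        = (C₁ * ρ) ^ k * ((k.factorial : ℝ) ^ s / k.factorial) := by ring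
      _ ≤ (C₁ * ρ) ^ k * (((Real.exp 1 * C₁)⁻¹ / ρ)) ^ k := by
          gcongr
          exact h2.trans (by gcongr)
      _ = Real.exp (-1) ^ k := by
          rw [← mul_pow, Real.exp_neg]
          congr 1
          field_simp
  have he : Real.exp (-1) ≤ 1 / 2 := by
    rw [Real.exp_neg, one_div]
    have := Real.add_one_le_exp (1 : ℝ)
    gcongr
    linarith
  refine ⟨N, ?_, ?_⟩
  · calc _ ≤ ∑ k ∈ Finset.range N, (1 / 2 : ℝ) ^ k := by
          refine Finset.sum_le_sum fun k hk => (hterm k (Finset.mem_range.1 hk).le).trans ?_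
          have := (Real.exp_pos (-1)).le
          gcongr
      _ ≤ 2 := sum_geometric_two_le N
  -- The factor e pays for the integer part, since X < N + 1.
  · refine (hterm N le_rfl).trans ?_
    rw [← Real.exp_nat_mul, ← Real.exp_add]
    have := Nat.lt_floor_add_one X
    gcongr
    rw [← hN] at this
    linarith

/-- Taylor expansion in t over a segment of length l ending at t = 1. The main term sees only the
growth at t = 1 - l; the remainder sees the full growth but carries the exponentially small last
Gevrey term, of radius l|e|. -/
theorem norm_wick_le (A : Cn n ≃L[ℂ] Cn n) {s A₀ C : ℝ} (hs : 1 < s) (hA₀ : 0 ≤ A₀) (hC : 0 ≤ C)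
    {a : Cn n → ℂ} (ha : GevreyBound s A₀ C a) {h : ℝ} (hh : 0 < h) (w e : Cn n) (he : e ≠ 0)
    {l : ℝ} (hl : 0 < l) (hl1 : l ≤ 1) :
    ‖wick A h a (w + e) (w - e)‖ ≤ A₀ * gaussMass A (4 / h) *
      (2 * Real.exp (4 * (1 - l) ^ 2 * ‖A e‖ ^ 2 / h) +
        Real.exp 1 * Real.exp (-((Real.exp 1 * (2 * n * C + 1))⁻¹ / (l * ‖e‖)) ^ (1 / (s - 1))) *
          Real.exp (4 * ‖A e‖ ^ 2 / h)) := by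
  have he' : 0 < ‖e‖ := norm_pos_iff.2 he
  -- The added 1 keeps C₁ positive even for n = 0 or C = 0.
  set C₁ : ℝ := 2 * n * C + 1 with hC₁
  have hC₁0 : 0 < C₁ := by positivity
  obtain ⟨N, hN1, hN2⟩ := exists_gevrey_truncation hs hC₁0 (mul_pos hl he')
  set b : ℕ → Cn n → ℂ := fun k m => iteratedFDeriv ℝ k a m fun _ => Complex.I • e with hb
  have hbb : ∀ k m, ‖b k m‖ ≤ A₀ * (C₁ * ‖e‖) ^ k * (k.factorial : ℝ) ^ s := by
    intro k m
    have := norm_iteratedFDeriv_apply_const_le (by linarith) hA₀ hC ha k m (Complex.I • e)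
    rw [norm_smul, Complex.norm_I, one_mul] at this
    refine this.trans ?_
    have : 2 * n * C ≤ C₁ := by linarith
    gcongr
  have hG := (gaussMass_pos A (show 0 < 4 / h by positivity)).le
  have hder : ∀ k t, HasDerivAt (wickLine A h (b k) w e)
      (-Complex.I * wickLine A h (b (k + 1)) w e t) t := by
    intro k t
    have hf : (fun m => fderiv ℝ (b k) m (Complex.I • e)) = b (k + 1) := by
      ext m
      exact fderiv_iteratedFDeriv_apply_const ha.1 k m _
    have := hasDerivAt_wickLine A hh (contDiff_iteratedFDeriv_apply_const ha.1 k (Complex.I • e))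
      (hbb k) w e (fun m => by
        rw [fderiv_iteratedFDeriv_apply_const ha.1]
        exact hbb (k + 1) m) t
    rwa [hf] at this
  have hval : ∀ k t, ‖wickLine A h (b k) w e t‖ ≤ A₀ * (C₁ * ‖e‖) ^ k * (k.factorial : ℝ) ^ s *
      gaussMass A (4 / h) * Real.exp (4 * t ^ 2 * ‖A e‖ ^ 2 / h) := fun k t =>
    norm_wickLine_le A hh (hbb k) w e t
  have hT := norm_le_taylor_of_hasDerivAt (κ := -Complex.I) (by simp) hder (t₀ := 1 - l) (t₁ := 1)
    (fun k => hval k (1 - l))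
    (M := A₀ * (C₁ * ‖e‖) ^ N * (N.factorial : ℝ) ^ s *
      gaussMass A (4 / h) * Real.exp (4 * ‖A e‖ ^ 2 / h)) N 0
    (fun t ht => by
      rw [zero_add]
      refine (hval N t).trans ?_
      have : t ^ 2 ≤ 1 := by nlinarith [ht.1, ht.2]
      have : 4 * t ^ 2 * ‖A e‖ ^ 2 ≤ 4 * ‖A e‖ ^ 2 := by nlinarith [sq_nonneg ‖A e‖]
      gcongr) 1 ⟨by linarith, le_rfl⟩
  have h0 : b 0 = a := by
    ext m
    simp [hb]
  rw [h0, sub_sub_cancel] at hT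
  rw [wick_add_sub]
  refine hT.trans ?_
  set P := Real.exp (4 * (1 - l) ^ 2 * ‖A e‖ ^ 2 / h)
  set Q := Real.exp (4 * ‖A e‖ ^ 2 / h)
  calc _ = A₀ * gaussMass A (4 / h) *
        ((∑ k ∈ Finset.range N, (C₁ * (l * ‖e‖)) ^ k * (k.factorial : ℝ) ^ s / k.factorial) * P +
          ((C₁ * (l * ‖e‖)) ^ N * (N.factorial : ℝ) ^ s / N.factorial) * Q) := by
        rw [mul_add, Finset.sum_mul, Finset.mul_sum]
        congr 1
        · refine Finset.sum_congr rfl fun k _ => ?_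
          rw [zero_add]
          ring_nf
        · ring_nf
    _ ≤ _ := by gcongr

theorem wick_eq_midpoint (A : Cn n ≃L[ℂ] Cn n) (h : ℝ) (a : Cn n → ℂ) (x ζ : Cn n) :
    wick A h a x ζ = wick A h a ((1 / 2 : ℝ) • (x + ζ) + (1 / 2 : ℝ) • (x - ζ))
      ((1 / 2 : ℝ) • (x + ζ) - (1 / 2 : ℝ) • (x - ζ)) := by
  congr 1 <;> module

theorem norm_map_half_sq (A : Cn n ≃L[ℂ] Cn n) (x : Cn n) :
    4 * ‖A ((1 / 2 : ℝ) • x)‖ ^ 2 = ‖A x‖ ^ 2 := by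
  rw [map_real_smul, norm_smul, mul_pow]
  norm_num
  ring

theorem norm_half_smul (x : Cn n) : ‖(1 / 2 : ℝ) • x‖ = ‖x‖ / 2 := by
  rw [norm_smul]
  norm_num
  ring

theorem GevreyBound.norm_le {s A₀ C : ℝ} {a : Cn n → ℂ} (ha : GevreyBound s A₀ C a) (m : Cn n) :
    ‖a m‖ ≤ A₀ := by
  simpa using ha.2 0 Fin.elim0 m

theorem exp_one_le_three : Real.exp 1 ≤ 3 := by
  linarith [Real.exp_one_lt_d9]

theorem half_mul_rpow_le {s : ℝ} (hs : 1 < s) {x : ℝ} (hx : 0 ≤ x) :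
    1 / 2 * x ^ (1 / s) ≤ (x / 2) ^ (1 / s) := by
  have hs0 : 0 < s := by linarith
  rw [Real.div_rpow hx two_pos.le, one_div_mul_eq_div]
  have : (2 : ℝ) ^ (1 / s) ≤ 2 := by
    calc (2 : ℝ) ^ (1 / s) ≤ 2 ^ (1 : ℝ) := by
          refine Real.rpow_le_rpow_of_exponent_le one_le_two ?_
          rw [div_le_one hs0]
          exact hs.le
      _ = 2 := Real.rpow_one 2
  gcongr

/-- Off-diagonal decay of the Wick kernel, normalized by the weight. -/
theorem exists_norm_wick_le_decay (A : Cn n ≃L[ℂ] Cn n) {s C κ : ℝ} (hs : 1 < s) (hC : 0 ≤ C)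
    (hκ : 0 < κ) (hA : ∀ x, κ * ‖x‖ ^ 2 ≤ ‖A x‖ ^ 2) :
    ∃ c : ℝ, 0 < c ∧ ∀ (A₀ : ℝ) (a : Cn n → ℂ), GevreyBound s A₀ C a → ∀ h : ℝ, 0 < h →
      ∀ x ζ : Cn n, ‖wick A h a x ζ‖ ≤ A₀ * gaussMass A (4 / h) *
        (Real.exp (‖A (x - ζ)‖ ^ 2 / h) * (2 * Real.exp (-(κ * (‖x - ζ‖ ^ 2 / h))) +
          5 * Real.exp (-(c * (‖x - ζ‖ / h) ^ (1 / s))))) := by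
  have hs0 : 0 < s := by linarith
  have hs' : 0 < s - 1 := by linarith
  set c₁ : ℝ := (Real.exp 1 * (2 * n * C + 1))⁻¹ with hc₁
  have hc₁0 : 0 < c₁ := by positivity
  set p : ℝ := 1 / (s - 1) with hp
  -- The first entry comes from the Gaussian gain of the main term, the second from the Taylor
  -- remainder; the factors 1/2 arise from r = |x - ζ|/2.
  refine ⟨min (2 * κ) (c₁ ^ p / 2), by positivity, fun A₀ a ha h hh x ζ => ?_⟩
  set c := min (2 * κ) (c₁ ^ p / 2)
  have hA₀ : 0 ≤ A₀ := (norm_nonneg _).trans (ha.norm_le 0)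
  have hG := (gaussMass_pos A (show 0 < 4 / h by positivity)).le
  rcases eq_or_ne x ζ with rfl | hne
  · have h1 := norm_wickLine_le A hh ha.norm_le x 0 1
    rw [← wick_add_sub] at h1
    simp only [add_zero, sub_zero, map_zero, norm_zero] at h1
    rw [sub_self, map_zero, norm_zero]
    simp only [ne_eq, OfNat.ofNat_ne_zero, not_false_eq_true, zero_pow, mul_zero, zero_div,
      Real.exp_zero, mul_one, neg_zero, one_mul] at h1 ⊢
    rw [Real.zero_rpow (by positivity)]
    refine h1.trans ?_
    have := mul_nonneg hA₀ hG
    simp only [mul_zero, neg_zero, Real.exp_zero]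
    linarith
  set e : Cn n := (1 / 2 : ℝ) • (x - ζ) with he
  set r : ℝ := ‖e‖ with hr
  have hd : ‖x - ζ‖ = 2 * r := by
    rw [hr, he, norm_half_smul]
    ring
  have hr0 : 0 < r := by
    have : 0 < ‖x - ζ‖ := norm_pos_iff.2 (sub_ne_zero.2 hne)
    linarith
  have he0 : e ≠ 0 := norm_pos_iff.1 hr0
  have hAe : 4 * ‖A e‖ ^ 2 = ‖A (x - ζ)‖ ^ 2 := norm_map_half_sq A _
  have hAlow : κ * (4 * r ^ 2) ≤ ‖A (x - ζ)‖ ^ 2 := by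
    have := hA (x - ζ)
    rw [hd] at this
    linarith
  have hroot : 1 / 2 * (‖x - ζ‖ / h) ^ (1 / s) ≤ (r / h) ^ (1 / s) := by
    have := half_mul_rpow_le hs (div_nonneg (norm_nonneg (x - ζ)) hh.le)
    rwa [hd, show 2 * r / h / 2 = r / h by ring, ← hd] at this
  have hrh : (h / r) ^ (1 - 1 / s) = ((r / h) ^ (1 - 1 / s))⁻¹ := by
    rw [← Real.inv_rpow (by positivity), inv_div]
  have hcp : ∀ t : ℝ, 0 < t → t ≤ (h / r) ^ (1 - 1 / s) →
      c * (‖x - ζ‖ / h) ^ (1 / s) ≤ (c₁ / t) ^ p := by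
    intro t ht htl
    have h1 : c₁ * (r / h) ^ (1 - 1 / s) ≤ c₁ / t := by
      rw [div_eq_mul_inv]
      refine mul_le_mul_of_nonneg_left ?_ hc₁0.le
      rw [hrh] at htl
      exact (le_inv_comm₀ ht (by positivity)).1 htl
    calc c * (‖x - ζ‖ / h) ^ (1 / s) ≤ c₁ ^ p / 2 * (‖x - ζ‖ / h) ^ (1 / s) := by
          gcongr
          exact min_le_right _ _
      _ = c₁ ^ p * (1 / 2 * (‖x - ζ‖ / h) ^ (1 / s)) := by ring
      _ ≤ c₁ ^ p * (r / h) ^ (1 / s) := by gcongr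
      _ = (c₁ * (r / h) ^ (1 - 1 / s)) ^ p := by
          rw [Real.mul_rpow hc₁0.le (by positivity), ← Real.rpow_mul (by positivity)]
          congr 2
          rw [hp]
          field_simp
      _ ≤ (c₁ / t) ^ p := Real.rpow_le_rpow (by positivity) h1 (by positivity)
  have main : ∀ l : ℝ, 0 < l → l ≤ 1 → l * r ≤ (h / r) ^ (1 - 1 / s) →
      ‖wick A h a x ζ‖ ≤ A₀ * gaussMass A (4 / h) * (Real.exp (‖A (x - ζ)‖ ^ 2 / h) *
        (2 * Real.exp (-(l * (κ * (4 * r ^ 2)) / h)) +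
          3 * Real.exp (-(c * (‖x - ζ‖ / h) ^ (1 / s))))) := by
    intro l hl hl1 hlr
    have h1 := norm_wick_le A hs hA₀ hC ha hh ((1 / 2 : ℝ) • (x + ζ)) e he0 hl hl1
    rw [← wick_eq_midpoint] at h1
    refine h1.trans ?_
    -- Uses (1-l)² ≤ 1 - l, so the shorter growth gains the fraction l of the full exponent.
    have h2 : Real.exp (4 * (1 - l) ^ 2 * ‖A e‖ ^ 2 / h) ≤
        Real.exp (‖A (x - ζ)‖ ^ 2 / h) * Real.exp (-(l * (κ * (4 * r ^ 2)) / h)) := by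
      rw [← Real.exp_add, Real.exp_le_exp, ← neg_div, ← add_div]
      refine div_le_div_of_nonneg_right ?_ hh.le
      rw [← hAe] at hAlow ⊢
      nlinarith [mul_le_mul_of_nonneg_left hAlow hl.le,
        mul_nonneg (mul_nonneg hl.le (sub_nonneg.2 hl1)) (sq_nonneg ‖A e‖)]
    have h3 := hcp (l * r) (by positivity) hlr
    have h4 : Real.exp 1 * Real.exp (-(c₁ / (l * ‖e‖)) ^ p) * Real.exp (4 * ‖A e‖ ^ 2 / h) ≤
        3 * Real.exp (-(c * (‖x - ζ‖ / h) ^ (1 / s))) * Real.exp (‖A (x - ζ)‖ ^ 2 / h) := by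
      rw [hAe]
      have := exp_one_le_three
      gcongr
    calc _ ≤ A₀ * gaussMass A (4 / h) *
          (2 * (Real.exp (‖A (x - ζ)‖ ^ 2 / h) * Real.exp (-(l * (κ * (4 * r ^ 2)) / h))) +
          3 * Real.exp (-(c * (‖x - ζ‖ / h) ^ (1 / s))) * Real.exp (‖A (x - ζ)‖ ^ 2 / h)) := by
          gcongr
      _ = _ := by ring
  rcases le_total r ((h / r) ^ (1 - 1 / s)) with hle | hle
  · refine (main 1 one_pos le_rfl (by rwa [one_mul])).trans ?_
    have e1 : -(1 * (κ * (4 * r ^ 2)) / h) = -(κ * (‖x - ζ‖ ^ 2 / h)) := by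
      rw [hd]
      ring
    rw [e1]
    gcongr
    norm_num
  -- This l balances the two errors: the main term gains l r²/h = (r/h)^{1/s}, and the remainder
  -- exponent is (1/(l r))^{1/(s-1)}, again (r/h)^{1/s} up to a constant. In the other case this
  -- ratio is at least 1 and l = 1 already suffices.
  · set l := (h / r) ^ (1 - 1 / s) / r with hl
    have hlr : l * r = (h / r) ^ (1 - 1 / s) := by
      rw [hl]
      field_simp
    refine (main l (by positivity) (by rwa [hl, div_le_one hr0]) hlr.le).trans ?_
    have h5 : c * (‖x - ζ‖ / h) ^ (1 / s) ≤ l * (κ * (4 * r ^ 2)) / h := by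
      have h6 : l * r * (r / h) = (r / h) ^ (1 / s) := by
        rw [hlr, hrh, Real.rpow_sub (by positivity), Real.rpow_one]
        have : 0 < (r / h) ^ (1 / s) := by positivity
        field_simp
      calc c * (‖x - ζ‖ / h) ^ (1 / s) ≤ 2 * κ * (‖x - ζ‖ / h) ^ (1 / s) := by
            gcongr
            exact min_le_left _ _
        _ = 4 * κ * (1 / 2 * (‖x - ζ‖ / h) ^ (1 / s)) := by ring
        _ ≤ 4 * κ * (l * r * (r / h)) := by
            rw [h6]
            gcongr
        _ = _ := by ring
    have h7 : Real.exp (-(l * (κ * (4 * r ^ 2)) / h)) ≤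
        Real.exp (-(c * (‖x - ζ‖ / h) ^ (1 / s))) := by
      gcongr
    have h8 := (Real.exp_pos (-(κ * (‖x - ζ‖ ^ 2 / h)))).le
    refine mul_le_mul_of_nonneg_left (mul_le_mul_of_nonneg_left ?_ (Real.exp_pos _).le)
      (mul_nonneg hA₀ hG)
    linarith

/-- The Wick kernel is bounded at distance `h^{1-1/s}` of the diagonal. -/
theorem exists_norm_wick_le_near (A : Cn n ≃L[ℂ] Cn n) {s C Λ : ℝ} (hs : 1 < s) (hC : 0 ≤ C)
    (hΛ : 1 ≤ Λ) (hA : ∀ x, ‖A x‖ ^ 2 ≤ Λ * ‖x‖ ^ 2) :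
    ∃ ρ : ℝ, 0 < ρ ∧ ρ ≤ 1 ∧ ∀ (A₀ : ℝ) (a : Cn n → ℂ), GevreyBound s A₀ C a →
      ∀ h : ℝ, 0 < h → h ≤ 1 → ∀ x ζ : Cn n, ‖x - ζ‖ ≤ ρ * h ^ (1 - 1 / s) →
        ‖wick A h a x ζ‖ ≤ A₀ * gaussMass A (4 / h) * 5 := by
  have hs0 : 0 < s := by linarith
  have hs' : 0 < s - 1 := by linarith
  set c₁ : ℝ := (Real.exp 1 * (2 * n * C + 1))⁻¹ with hc₁
  have hc₁0 : 0 < c₁ := by positivity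
  set p : ℝ := 1 / (s - 1) with hp
  -- The bound 2c₁ makes the remainder exponent at least h^{-1/s}; the bound Λ⁻¹ keeps the growth
  -- exponent below the same quantity.
  refine ⟨min (2 * c₁) Λ⁻¹, by positivity, (min_le_right _ _).trans (inv_le_one_of_one_le₀ hΛ),
    fun A₀ a ha h hh hh1 x ζ hxζ => ?_⟩
  set ρ := min (2 * c₁) Λ⁻¹
  have hA₀ : 0 ≤ A₀ := (norm_nonneg _).trans (ha.norm_le 0)
  have hG := (gaussMass_pos A (show 0 < 4 / h by positivity)).le
  rcases eq_or_ne x ζ with rfl | hne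
  · have h1 := norm_wickLine_le A hh ha.norm_le x 0 1
    rw [← wick_add_sub] at h1
    simp only [add_zero, sub_zero, map_zero, norm_zero] at h1
    simp only [ne_eq, OfNat.ofNat_ne_zero, not_false_eq_true, zero_pow, mul_zero, zero_div,
      Real.exp_zero, mul_one] at h1
    have := mul_nonneg hA₀ hG
    linarith
  set e : Cn n := (1 / 2 : ℝ) • (x - ζ) with he
  have hd0 : 0 < ‖x - ζ‖ := norm_pos_iff.2 (sub_ne_zero.2 hne)
  have hre : ‖e‖ = ‖x - ζ‖ / 2 := norm_half_smul _
  have he0 : e ≠ 0 := norm_pos_iff.1 (by rw [hre]; positivity)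
  have h1 := norm_wick_le A hs hA₀ hC ha hh ((1 / 2 : ℝ) • (x + ζ)) e he0 one_pos le_rfl
  rw [← wick_eq_midpoint] at h1
  refine h1.trans ?_
  have hAe : 4 * ‖A e‖ ^ 2 = ‖A (x - ζ)‖ ^ 2 := norm_map_half_sq A _
  have hH : 0 < h ^ (1 - 1 / s) := by positivity
  have hρ0 : 0 < ρ := by positivity
  have h2 : h ^ (-(1 / s)) ≤ (c₁ / (1 * ‖e‖)) ^ p := by
    have h3 : (h ^ (1 - 1 / s))⁻¹ ≤ c₁ / (1 * ‖e‖) := by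
      rw [one_mul, hre, inv_le_comm₀ hH (by positivity), inv_div]
      rw [div_div, div_le_iff₀ (by positivity)]
      have h4 : ρ ≤ 2 * c₁ := min_le_left _ _
      calc ‖x - ζ‖ ≤ ρ * h ^ (1 - 1 / s) := hxζ
        _ ≤ 2 * c₁ * h ^ (1 - 1 / s) := by gcongr
        _ = _ := by ring
    calc h ^ (-(1 / s)) = ((h ^ (1 - 1 / s))⁻¹) ^ p := by
          rw [← Real.rpow_neg hh.le, ← Real.rpow_mul hh.le]
          congr 1
          rw [hp]
          field_simp
      _ ≤ _ := Real.rpow_le_rpow (by positivity) h3 (by positivity)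
  -- With l = 1 the main term does not grow, so only the growth in the remainder matters, and its
  -- exponent is beaten by the one in `h2`. The total 5 is 2 from the main term and 3 ≥ e from the
  -- remainder.
  have h5 : ‖A (x - ζ)‖ ^ 2 / h ≤ h ^ (-(1 / s)) := by
    have h6 : ρ ≤ Λ⁻¹ := min_le_right _ _
    have h7 : Λ * ρ ^ 2 ≤ 1 := by
      calc Λ * ρ ^ 2 ≤ Λ * (Λ⁻¹) ^ 2 := by gcongr
        _ = Λ⁻¹ := by field_simp
        _ ≤ 1 := inv_le_one_of_one_le₀ hΛ
    rw [div_le_iff₀ hh]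
    calc ‖A (x - ζ)‖ ^ 2 ≤ Λ * (ρ * h ^ (1 - 1 / s)) ^ 2 := (hA _).trans (by gcongr)
      _ = Λ * ρ ^ 2 * (h ^ (1 - 1 / s)) ^ 2 := by ring
      _ ≤ 1 * (h ^ (1 - 1 / s)) ^ 2 := by gcongr
      _ = h ^ (2 - 2 / s) := by
          rw [one_mul, ← Real.rpow_natCast, ← Real.rpow_mul hh.le]
          congr 1
          push_cast
          ring
      _ ≤ h ^ (1 - 1 / s) := by
          refine Real.rpow_le_rpow_of_exponent_ge hh hh1 ?_
          have : 1 / s ≤ 1 := by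
            rw [div_le_one hs0]
            exact hs.le
          rw [show 2 / s = 2 * (1 / s) by ring]
          linarith
      _ = h ^ (-(1 / s)) * h := by
          rw [← Real.rpow_add_one hh.ne']
          congr 1
          ring
  have h8 : Real.exp (-(c₁ / (1 * ‖e‖)) ^ p) * Real.exp (4 * ‖A e‖ ^ 2 / h) ≤ 1 := by
    rw [← Real.exp_add, Real.exp_le_one_iff, hAe]
    linarith
  have h9 := exp_one_le_three
  refine mul_le_mul_of_nonneg_left ?_ (mul_nonneg hA₀ hG)
  rw [mul_assoc (Real.exp 1)]
  have h10 := mul_le_mul h9 h8 (by positivity) (by norm_num)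
  simp only [sub_self, ne_eq, OfNat.ofNat_ne_zero, not_false_eq_true, zero_pow, mul_zero,
    zero_mul, zero_div, Real.exp_zero]
  linarith

/-! ### The kernel conjugated by a perturbed weight. -/

theorem exists_norm_sq_le (A : Cn n ≃L[ℂ] Cn n) :
    ∃ Λ : ℝ, 1 ≤ Λ ∧ ∀ x, ‖A x‖ ^ 2 ≤ Λ * ‖x‖ ^ 2 := by
  refine ⟨(‖(A : Cn n →L[ℂ] Cn n)‖ + 1) ^ 2, one_le_pow₀ ?_, fun x => ?_⟩
  · linarith [norm_nonneg (A : Cn n →L[ℂ] Cn n)]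
  · rw [← mul_pow]
    have := (A : Cn n →L[ℂ] Cn n).le_opNorm x
    simp only [ContinuousLinearEquiv.coe_coe] at this
    gcongr
    nlinarith [norm_nonneg x]

theorem exists_pos_mul_le {ι : Type*} (S : Finset ι) (b c : ι → ℝ) (hb : ∀ i ∈ S, 0 ≤ b i)
    (hc : ∀ i ∈ S, 0 < c i) : ∃ ε : ℝ, 0 < ε ∧ ε ≤ 1 ∧ ∀ i ∈ S, ε * b i ≤ c i := by
  classical
  induction S using Finset.induction_on with
  | empty => exact ⟨1, one_pos, le_rfl, by simp⟩
  | insert i S hi ih =>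
    obtain ⟨ε, h0, h1, h2⟩ := ih (fun j hj => hb j (Finset.mem_insert_of_mem hj))
      fun j hj => hc j (Finset.mem_insert_of_mem hj)
    have hbi := hb i (Finset.mem_insert_self i S)
    have hci := hc i (Finset.mem_insert_self i S)
    refine ⟨min ε (c i / (b i + 1)), by positivity, (min_le_left _ _).trans h1, fun j hj => ?_⟩
    rcases Finset.mem_insert.1 hj with rfl | hj'
    · calc min ε (c j / (b j + 1)) * b j ≤ c j / (b j + 1) * (b j + 1) := by
            gcongr
            · exact min_le_right _ _
            · linarith
        _ = c j := by field_simp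
    · exact (mul_le_mul_of_nonneg_right (min_le_left _ _)
        (hb j (Finset.mem_insert_of_mem hj'))).trans (h2 j hj')

theorem norm_sub_sq_herm (A : Cn n ≃L[ℂ] Cn n) (x δ : Cn n) :
    ‖A (x - δ)‖ ^ 2 = ‖A x‖ ^ 2 - 2 * (herm A δ x).re + ‖A δ‖ ^ 2 := by
  rw [map_sub, norm_sub_sq (𝕜 := ℂ), inner_re_symm]
  rfl

set_option maxHeartbeats 1000000 in
/-- The kernel of the operator, reproduced from the weight `|Ax|² + ψ` at each point and conjugated
by that weight, is dominated by a convolution kernel. -/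
theorem exists_kernel_bound (A : Cn n ≃L[ℂ] Cn n) {s C D : ℝ} (hs : 1 < s) (hC : 0 ≤ C)
    (hD : 0 ≤ D) :
    ∃ ε c : ℝ, 0 < ε ∧ 0 < c ∧ ∀ (A₀ : ℝ) (a : Cn n → ℂ), GevreyBound s A₀ C a →
      ∀ h : ℝ, 0 < h → h ≤ 1 → ∀ (ψ : Cn n → ℝ) (x z δ : Cn n),
      |ψ z - ψ x| ≤ 2 * (ε * h ^ (1 - 1 / s)) →
      |ψ z - ψ x| ≤ ε * h ^ (1 - 1 / s) * ‖x - z‖ →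
      |ψ z - ψ x + 2 * (herm A δ (x - z)).re| ≤ ε * h ^ (1 - 1 / s) * ‖x - z‖ ^ 2 →
      ‖δ‖ ≤ D * (ε * h ^ (1 - 1 / s)) →
      ‖shiftKernel A h δ x z‖ * ‖wick A h a x (z + δ)‖ *
        Real.exp ((‖A z‖ ^ 2 + ψ z) / h) ≤ A₀ * gaussMass A (4 / h) *
        (Real.exp ((‖A x‖ ^ 2 + ψ x) / h) * (7 * (Real.exp (-(c * (‖x - z‖ ^ 2 / h))) +
          Real.exp (-(c * (‖x - z‖ / h) ^ (1 / s)))))) := by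
  have hs0 : 0 < s := by linarith
  obtain ⟨κ, hκ, -, hAκ⟩ := exists_norm_equiv A
  obtain ⟨Λ, hΛ, hAΛ⟩ := exists_norm_sq_le A
  obtain ⟨c₄, hc₄, hfar⟩ := exists_norm_wick_le_decay A hs hC hκ hAκ
  obtain ⟨ρ, hρ, hρ1, hnear⟩ := exists_norm_wick_le_near A hs hC hΛ hAΛ
  -- The four smallness conditions, in order: far from the diagonal the perturbation costs at most
  -- κ/8 of the Gaussian exponent; there it also costs at most a quarter of the stretched one; near
  -- the diagonal the quadratic remainder is at most half of |A(x-z)|²; the shift is at most ρH/4.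
  obtain ⟨ε, hε, hε1, hεS⟩ := exists_pos_mul_le (Finset.univ : Finset (Fin 4))
    ![4 * Λ * D ^ 2 / ρ ^ 2 + 2 / ρ, 2 * Λ * D ^ 2 / ρ + 2, 1, D]
    ![κ / 8, c₄ / 4, κ / 2, ρ / 4]
    (by
      intro i _
      fin_cases i <;> simp <;> positivity)
    (by
      intro i _
      fin_cases i <;> simp <;> positivity)
  have hε₁ := hεS 0 (Finset.mem_univ _)
  have hε₂ := hεS 1 (Finset.mem_univ _)
  have hε₃ := hεS 2 (Finset.mem_univ _)
  have hε₄ := hεS 3 (Finset.mem_univ _)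
  simp only [Matrix.cons_val, mul_one] at hε₁ hε₂ hε₃ hε₄
  refine ⟨ε, min (κ / 8) (c₄ / 4), hε, by positivity, ?_⟩
  intro A₀ a ha h hh hh1 ψ x z δ hψ1 hψ2 hψ3 hδ
  set c := min (κ / 8) (c₄ / 4)
  set H := h ^ (1 - 1 / s) with hHdef
  have hH : 0 < H := by positivity
  have hA₀ : 0 ≤ A₀ := (norm_nonneg _).trans (ha.norm_le 0)
  have hG := (gaussMass_pos A (show 0 < 4 / h by positivity)).le
  set d := ‖x - z‖ with hd
  have hd0 : 0 ≤ d := norm_nonneg _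
  have hδρ : ‖δ‖ ≤ ρ / 4 * H := by
    calc ‖δ‖ ≤ D * (ε * H) := hδ
      _ = ε * D * H := by ring
      _ ≤ ρ / 4 * H := by gcongr
  have hcκ : c ≤ κ / 8 := min_le_left _ _
  have hcc : c ≤ c₄ / 4 := min_le_right _ _
  have hE1 := (Real.exp_pos (-(c * (d ^ 2 / h)))).le
  have hE2 := (Real.exp_pos (-(c * (d / h) ^ (1 / s)))).le
  -- Conjugation by the weight removes |Ax|² and |Az|², leaving the cost |Aδ|² + ψ(z) - ψ(x) and the
  -- Gaussian centred at z = x - δ.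
  have hW : ∀ w : ℝ, ‖shiftKernel A h δ x z‖ * w * Real.exp ((‖A z‖ ^ 2 + ψ z) / h) =
      Real.exp ((‖A x‖ ^ 2 + ψ x) / h) *
      (Real.exp ((‖A δ‖ ^ 2 + (ψ z - ψ x)) / h) * Real.exp (-(‖A (x - z - δ)‖ ^ 2 / h)) * w) := by
    intro w
    rw [norm_shiftKernel, mul_right_comm, ← Real.exp_add, ← Real.exp_add, ← mul_assoc,
      ← Real.exp_add]
    congr 2
    ring
  have hζ : x - (z + δ) = x - z - δ := by abel
  rw [hW]
  suffices hS : Real.exp ((‖A δ‖ ^ 2 + (ψ z - ψ x)) / h) * Real.exp (-(‖A (x - z - δ)‖ ^ 2 / h)) *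
      ‖wick A h a x (z + δ)‖ ≤ A₀ * gaussMass A (4 / h) *
        (7 * (Real.exp (-(c * (d ^ 2 / h))) + Real.exp (-(c * (d / h) ^ (1 / s))))) by
    calc _ ≤ Real.exp ((‖A x‖ ^ 2 + ψ x) / h) * (A₀ * gaussMass A (4 / h) *
        (7 * (Real.exp (-(c * (d ^ 2 / h))) + Real.exp (-(c * (d / h) ^ (1 / s)))))) := by gcongr
      _ = _ := by ring
  -- Near the diagonal `wick` is bounded and the shift matters; far from it `wick` supplies the
  -- decay and the shift is a harmless displacement, as |δ| ≤ d/2.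
  rcases le_or_gt d (ρ / 2 * H) with hle | hgt
  · have h1 : ‖x - (z + δ)‖ ≤ ρ * H := by
      rw [hζ]
      have := norm_sub_le (x - z) δ
      have hρH : 0 < ρ * H := by positivity
      linarith
    have h2 := hnear A₀ a ha h hh hh1 x (z + δ) h1
    -- Expanding |A(x-z-δ)|² cancels |Aδ|² and produces exactly the linear term 2 Re⟨Aδ, A(x-z)⟩ of
    -- the third hypothesis on ψ; only a quadratic error remains against -|A(x-z)|².
    have h3 : Real.exp ((‖A δ‖ ^ 2 + (ψ z - ψ x)) / h) *
        Real.exp (-(‖A (x - z - δ)‖ ^ 2 / h)) ≤ Real.exp (-(c * (d ^ 2 / h))) := by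
      rw [← Real.exp_add, Real.exp_le_exp, norm_sub_sq_herm, ← neg_div, ← add_div,
        ← mul_div_assoc, ← neg_div]
      refine div_le_div_of_nonneg_right ?_ hh.le
      have h4 := (abs_le.1 hψ3).2
      have h5 := hAκ (x - z)
      have hH1 : H ≤ 1 := by
        refine Real.rpow_le_one hh.le hh1 ?_
        rw [sub_nonneg, div_le_one hs0]
        exact hs.le
      have h6 : ε * H * d ^ 2 ≤ κ / 2 * d ^ 2 := by
        have : ε * H ≤ κ / 2 * 1 := by gcongr
        rw [mul_one] at this
        gcongr
      have h7 : c * d ^ 2 ≤ κ / 8 * d ^ 2 := by gcongr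
      nlinarith [mul_nonneg hκ.le (sq_nonneg d)]
    calc _ ≤ Real.exp (-(c * (d ^ 2 / h))) * (A₀ * gaussMass A (4 / h) * 5) :=
          mul_le_mul h3 h2 (norm_nonneg _) hE1
      _ = A₀ * gaussMass A (4 / h) * (5 * Real.exp (-(c * (d ^ 2 / h)))) := by ring
      _ ≤ _ := by
          refine mul_le_mul_of_nonneg_left ?_ (mul_nonneg hA₀ hG)
          linarith
  · have hHd : H ≤ 2 / ρ * d := by
      rw [div_mul_eq_mul_div, le_div_iff₀ hρ]
      linarith
    set d' := ‖x - (z + δ)‖ with hd'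
    have hdd : d / 2 ≤ d' := by
      rw [hd', hζ]
      have := norm_sub_norm_le (x - z) δ
      linarith
    have h2 := hfar A₀ a ha h hh x (z + δ)
    have hAδ : ‖A δ‖ ^ 2 ≤ ε * (Λ * D ^ 2 * H ^ 2) := by
      calc ‖A δ‖ ^ 2 ≤ Λ * (D * (ε * H)) ^ 2 := (hAΛ δ).trans (by gcongr)
        _ = ε * (ε * (Λ * D ^ 2 * H ^ 2)) := by ring
        _ ≤ ε * (1 * (Λ * D ^ 2 * H ^ 2)) := by gcongr
        _ = _ := by ring
    -- The same cost is bounded twice, once for each kind of decay of `wick`. Here H ≤ 2d/ρ makes it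
    -- quadratic in d.
    have hX1 : (‖A δ‖ ^ 2 + (ψ z - ψ x)) / h ≤ κ / 8 * (d ^ 2 / h) := by
      rw [← mul_div_assoc]
      refine div_le_div_of_nonneg_right ?_ hh.le
      have h3 := (abs_le.1 hψ2).2
      calc ‖A δ‖ ^ 2 + (ψ z - ψ x) ≤ ε * (Λ * D ^ 2 * H ^ 2) + ε * H * d := add_le_add hAδ h3
        _ ≤ ε * (Λ * D ^ 2 * (2 / ρ * d) ^ 2) + ε * (2 / ρ * d) * d := by gcongr
        _ = ε * (4 * Λ * D ^ 2 / ρ ^ 2 + 2 / ρ) * d ^ 2 := by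
            field_simp
            ring
        _ ≤ κ / 8 * d ^ 2 := by gcongr
    have hX2 : (‖A δ‖ ^ 2 + (ψ z - ψ x)) / h ≤ c₄ / 4 * (d / h) ^ (1 / s) := by
      have h1s : 1 / s ≤ 1 := by
        rw [div_le_one hs0]
        exact hs.le
      have h1s0 : 0 < 1 / s := by positivity
      have h3 : H ^ 2 / h ≤ 2 / ρ * (d / h) ^ (1 / s) := by
        have h4 : h ^ (-(1 / s)) ≤ 2 / ρ * (d / h) := by
          rw [← mul_div_assoc, le_div_iff₀ hh, ← Real.rpow_add_one hh.ne', neg_add_eq_sub]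
          exact hHd
        have h5 : (2 / ρ : ℝ) ^ (1 / s) ≤ 2 / ρ := by
          have : 1 ≤ 2 / ρ := by
            rw [le_div_iff₀ hρ]
            linarith
          calc (2 / ρ : ℝ) ^ (1 / s) ≤ (2 / ρ) ^ (1 : ℝ) :=
                Real.rpow_le_rpow_of_exponent_le this h1s
            _ = 2 / ρ := Real.rpow_one _
        -- Since h ≤ 1, the comparison with h^{-1/s²} amounts to (1 - 1/s)² ≥ 0.
        calc H ^ 2 / h = h ^ (1 - 2 * (1 / s)) := by
              rw [hHdef, ← Real.rpow_natCast, ← Real.rpow_mul hh.le, ← Real.rpow_sub_one hh.ne']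
              congr 1
              push_cast
              ring
          _ ≤ h ^ (-(1 / s) * (1 / s)) := by
              refine Real.rpow_le_rpow_of_exponent_ge hh hh1 ?_
              nlinarith [sq_nonneg (1 - 1 / s)]
          _ = (h ^ (-(1 / s))) ^ (1 / s) := Real.rpow_mul hh.le _ _
          _ ≤ (2 / ρ * (d / h)) ^ (1 / s) := Real.rpow_le_rpow (by positivity) h4 h1s0.le
          _ = (2 / ρ) ^ (1 / s) * (d / h) ^ (1 / s) :=
              Real.mul_rpow (by positivity) (by positivity)
          _ ≤ _ := by gcongr
      have h6 : (ψ z - ψ x) / h ≤ ε * 2 * (d / h) ^ (1 / s) := by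
        -- The Lipschitz bound serves for d ≤ 1 and the uniform bound for d ≥ 1; both lie below the
        -- power d^{1/s}, which matches H/h = h^{-1/s}.
        have h7 : ψ z - ψ x ≤ ε * H * (2 * d ^ (1 / s)) := by
          rcases le_total d 1 with hd1 | hd1
          · have h8 : d ≤ d ^ (1 / s) := by
              calc d = d ^ (1 : ℝ) := (Real.rpow_one d).symm
                _ ≤ _ := Real.rpow_le_rpow_of_exponent_ge' hd0 hd1 h1s0.le h1s
            calc ψ z - ψ x ≤ ε * H * d := (abs_le.1 hψ2).2
              _ ≤ ε * H * (2 * d ^ (1 / s)) := by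
                  gcongr
                  linarith
          · have h8 : 1 ≤ d ^ (1 / s) := Real.one_le_rpow hd1 h1s0.le
            calc ψ z - ψ x ≤ 2 * (ε * H) := (abs_le.1 hψ1).2
              _ = ε * H * (2 * 1) := by ring
              _ ≤ _ := by gcongr
        have h9 : H / h = (h ^ (1 / s))⁻¹ := by
          rw [hHdef, Real.rpow_sub hh, Real.rpow_one]
          field_simp
        calc (ψ z - ψ x) / h ≤ ε * H * (2 * d ^ (1 / s)) / h := by gcongr
          _ = ε * 2 * (d ^ (1 / s) * (H / h)) := by ring
          _ = _ := by rw [h9, Real.div_rpow hd0 hh.le, div_eq_mul_inv (d ^ (1 / s))]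
      calc (‖A δ‖ ^ 2 + (ψ z - ψ x)) / h = ‖A δ‖ ^ 2 / h + (ψ z - ψ x) / h := add_div _ _ _
        _ ≤ ε * (Λ * D ^ 2 * H ^ 2) / h + ε * 2 * (d / h) ^ (1 / s) := by gcongr
        _ = ε * (Λ * D ^ 2) * (H ^ 2 / h) + ε * 2 * (d / h) ^ (1 / s) := by ring
        _ ≤ ε * (Λ * D ^ 2) * (2 / ρ * (d / h) ^ (1 / s)) + ε * 2 * (d / h) ^ (1 / s) := by gcongr
        _ = ε * (2 * Λ * D ^ 2 / ρ + 2) * (d / h) ^ (1 / s) := by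
            field_simp
        _ ≤ _ := by gcongr
    rw [hζ] at h2
    have h10 : Real.exp ((‖A δ‖ ^ 2 + (ψ z - ψ x)) / h) * Real.exp (-(κ * (‖x - z - δ‖ ^ 2 / h))) ≤
        Real.exp (-(c * (d ^ 2 / h))) := by
      rw [← Real.exp_add, Real.exp_le_exp]
      have h11 : (d / 2) ^ 2 / h ≤ ‖x - z - δ‖ ^ 2 / h := by
        rw [← hζ]
        gcongr
      have h12 : c * (d ^ 2 / h) ≤ κ / 8 * (d ^ 2 / h) := by gcongr
      have h13 := mul_le_mul_of_nonneg_left h11 hκ.le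
      rw [show κ * ((d / 2) ^ 2 / h) = κ / 4 * (d ^ 2 / h) by ring] at h13
      nlinarith
    have h14 : Real.exp ((‖A δ‖ ^ 2 + (ψ z - ψ x)) / h) *
        Real.exp (-(c₄ * (‖x - z - δ‖ / h) ^ (1 / s))) ≤ Real.exp (-(c * (d / h) ^ (1 / s))) := by
      rw [← Real.exp_add, Real.exp_le_exp]
      have h11 : 1 / 2 * (d / h) ^ (1 / s) ≤ (‖x - z - δ‖ / h) ^ (1 / s) := by
        refine (half_mul_rpow_le hs (by positivity)).trans ?_
        refine Real.rpow_le_rpow (by positivity) ?_ (by positivity)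
        rw [div_right_comm, ← hζ]
        gcongr
      have h12 : c * (d / h) ^ (1 / s) ≤ c₄ / 4 * (d / h) ^ (1 / s) := by gcongr
      have h13 := mul_le_mul_of_nonneg_left h11 hc₄.le
      linarith
    have h15 : Real.exp (-(‖A (x - z - δ)‖ ^ 2 / h)) * Real.exp (‖A (x - z - δ)‖ ^ 2 / h) = 1 := by
      rw [← Real.exp_add, neg_add_cancel, Real.exp_zero]
    set P := Real.exp ((‖A δ‖ ^ 2 + (ψ z - ψ x)) / h)
    set Q := Real.exp (-(‖A (x - z - δ)‖ ^ 2 / h))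
    set R := Real.exp (‖A (x - z - δ)‖ ^ 2 / h)
    set S := Real.exp (-(κ * (‖x - z - δ‖ ^ 2 / h)))
    set T := Real.exp (-(c₄ * (‖x - z - δ‖ / h) ^ (1 / s)))
    calc P * Q * ‖wick A h a x (z + δ)‖
        ≤ P * Q * (A₀ * gaussMass A (4 / h) * (R * (2 * S + 5 * T))) := by gcongr
      _ = A₀ * gaussMass A (4 / h) * ((Q * R) * (2 * (P * S) + 5 * (P * T))) := by ring
      _ ≤ _ := by
          rw [h15, one_mul]
          refine mul_le_mul_of_nonneg_left ?_ (mul_nonneg hA₀ hG)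
          linarith

/-! ### Holomorphic dependence of integrals on a parameter -/

theorem norm_fderiv_le_of_bounded {f : Cn n → ℂ} (hf : Differentiable ℂ f) {x : Cn n} {G : ℝ}
    (hG : ∀ y, ‖y - x‖ ≤ 1 → ‖f y‖ ≤ G) : ‖fderiv ℂ f x‖ ≤ G := by
  have hG0 : 0 ≤ G := (norm_nonneg _).trans (hG x (by simp))
  refine ContinuousLinearMap.opNorm_le_bound _ hG0 fun v => ?_
  rcases eq_or_ne v 0 with rfl | hv
  · simp
  have hv0 : 0 < ‖v‖ := norm_pos_iff.2 hv
  have hline : HasDerivAt (fun t : ℂ => x + t • v) v 0 := by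
    simpa using ((hasDerivAt_id (0 : ℂ)).smul_const v).const_add x
  have hd : HasDerivAt (fun t : ℂ => f (x + t • v)) (fderiv ℂ f x v) 0 := by
    refine HasFDerivAt.comp_hasDerivAt (0 : ℂ) (f := fun t : ℂ => x + t • v) ?_ hline
    rw [zero_smul, add_zero]
    exact (hf x).hasFDerivAt
  rw [← hd.deriv]
  have hdiff : Differentiable ℂ fun t : ℂ => f (x + t • v) :=
    hf.comp ((differentiable_id.smul_const v).const_add x)
  have := Complex.norm_deriv_le_of_forall_mem_sphere_norm_le (c := 0) (R := ‖v‖⁻¹) (C := G)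
    (by positivity) hdiff.diffContOnCl (fun t ht => hG _ (by
      rw [mem_sphere_zero_iff_norm] at ht
      rw [add_sub_cancel_left, norm_smul, ht, inv_mul_cancel₀ hv0.ne']))
  simpa using this

/-- By Cauchy's estimate on unit balls, domination of the integrand alone dominates its derivative.
The radius ‖x₀‖ + 2 leaves one unit for the neighbourhood and one for Cauchy. -/
theorem differentiable_integral_of_locally_dominated {F : Cn n → Cn n → ℂ}
    (hc : Continuous (Function.uncurry F)) (hd : ∀ z, Differentiable ℂ fun x => F x z)
    (hdom : ∀ R : ℝ, ∃ G : Cn n → ℝ, Integrable G ∧ ∀ x z, ‖x‖ ≤ R → ‖F x z‖ ≤ G z) :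
    Differentiable ℂ fun x => ∫ z, F x z := by
  intro x₀
  obtain ⟨G, hG, hFG⟩ := hdom (‖x₀‖ + 2)
  have hmeas : ∀ x, AEStronglyMeasurable (F x) volume := fun x =>
    (hc.comp (Continuous.prodMk_right x)).aestronglyMeasurable
  have hm : AEStronglyMeasurable (fun z => fderiv ℂ (fun x => F x z) x₀) volume := by
    have h1 : Measurable fun p : Cn n × Cn n => fderiv ℂ (fun x => F x p.1) p.2 :=
      measurable_fderiv_with_param ℂ (f := fun z x => F x z) (hc.comp continuous_swap)
    exact (h1.comp (measurable_id.prodMk measurable_const)).aestronglyMeasurable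
  refine (hasFDerivAt_integral_of_dominated_of_fderiv_le (μ := volume) (𝕜 := ℂ) (F := F)
    (F' := fun x z => fderiv ℂ (fun x => F x z) x) (s := Metric.ball x₀ 1) (bound := G)
    (Metric.ball_mem_nhds x₀ one_pos) (Filter.Eventually.of_forall hmeas)
    (hG.mono' (hmeas x₀) (Filter.Eventually.of_forall fun z => hFG x₀ z (by linarith))) hm
    (Filter.Eventually.of_forall fun z x hx => norm_fderiv_le_of_bounded (hd z) fun y hy =>
      hFG y z ?_) hG
    (Filter.Eventually.of_forall fun z x _ => (hd z x).hasFDerivAt)).differentiableAt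
  rw [Metric.mem_ball, dist_eq_norm] at hx
  have h1 := norm_add_le (y - x) (x - x₀)
  have h2 := norm_add_le (y - x₀) x₀
  rw [sub_add_sub_cancel] at h1
  rw [sub_add_cancel] at h2
  linarith

theorem continuous_integral_of_locally_dominated {X : Type*} [TopologicalSpace X]
    [FirstCountableTopology X] {F : X → Cn n → ℂ}
    (hc : Continuous (Function.uncurry F))
    (hdom : ∀ x₀ : X, ∃ G : Cn n → ℝ, Integrable G ∧ ∀ᶠ x in nhds x₀, ∀ z, ‖F x z‖ ≤ G z) :
    Continuous fun x => ∫ z, F x z := by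
  rw [continuous_iff_continuousAt]
  intro x₀
  obtain ⟨G, hG, hFG⟩ := hdom x₀
  exact continuousAt_of_dominated
    (Filter.Eventually.of_forall fun x => (hc.comp (Continuous.prodMk_right x)).aestronglyMeasurable)
    (hFG.mono fun x hx => Filter.Eventually.of_forall hx) hG
    (Filter.Eventually.of_forall fun z => (hc.comp (Continuous.prodMk_left z)).continuousAt)

theorem norm_exp_herm_le (A : Cn n ≃L[ℂ] Cn n) {h : ℝ} (hh : 0 < h) (x ζ m : Cn n) :
    ‖Complex.exp (-4 * herm A (m - ζ) (m - x) / h)‖ ≤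
      Real.exp (8 * (‖A x‖ + ‖A ζ‖) ^ 2 / h) * Real.exp (-(2 / h * ‖A m‖ ^ 2)) := by
  rw [Complex.norm_exp, Complex.div_ofReal_re, ← Real.exp_add, Real.exp_le_exp]
  have e1 : (-4 * herm A (m - ζ) (m - x)).re = -4 * (herm A (m - ζ) (m - x)).re := by simp
  have e2 : (herm A (m - ζ) (m - x)).re = ‖A m‖ ^ 2 - (herm A m x).re - (herm A ζ m).re +
      (herm A ζ x).re := by
    rw [← inner_self_eq_norm_sq (𝕜 := ℂ)]
    simp only [herm, map_sub, inner_sub_left, inner_sub_right, RCLike.re_eq_complex_re,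
      Complex.sub_re]
    ring
  have b1 : (herm A m x).re ≤ ‖A m‖ * ‖A x‖ := re_inner_le_norm (𝕜 := ℂ) (A m) (A x)
  have b2 : (herm A ζ m).re ≤ ‖A ζ‖ * ‖A m‖ := re_inner_le_norm (𝕜 := ℂ) (A ζ) (A m)
  have b3 : -(‖A ζ‖ * ‖A x‖) ≤ (herm A ζ x).re :=
    (abs_le.1 ((Complex.abs_re_le_norm _).trans (norm_inner_le_norm (𝕜 := ℂ) (A ζ) (A x)))).1
  rw [e1, e2, show -(2 / h * ‖A m‖ ^ 2) = (-2 * ‖A m‖ ^ 2) / h by ring, ← add_div]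
  refine div_le_div_of_nonneg_right ?_ hh.le
  nlinarith [sq_nonneg (‖A m‖ - (‖A x‖ + ‖A ζ‖)), norm_nonneg (A x), norm_nonneg (A ζ),
    mul_nonneg (norm_nonneg (A x)) (norm_nonneg (A ζ)), sq_nonneg (‖A x‖), sq_nonneg ‖A ζ‖]

theorem continuous_exp_herm (A : Cn n ≃L[ℂ] Cn n) (h : ℝ) {X : Type*} [TopologicalSpace X]
    {f g : X → Cn n} (hf : Continuous f) (hg : Continuous g) :
    Continuous fun x => Complex.exp (-4 * herm A (f x) (g x) / h) := by
  have := continuous_herm A hf hg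
  fun_prop

theorem wick_domination (A : Cn n ≃L[ℂ] Cn n) {h : ℝ} (hh : 0 < h) {a : Cn n → ℂ} {A₀ : ℝ}
    (hA₀ : ∀ m, ‖a m‖ ≤ A₀) (R : ℝ) :
    ∃ G : Cn n → ℝ, Integrable G ∧ ∀ x ζ m, ‖A x‖ ≤ R → ‖A ζ‖ ≤ R →
      ‖a m * Complex.exp (-4 * herm A (m - ζ) (m - x) / h)‖ ≤ G m := by
  refine ⟨fun m => A₀ * (Real.exp (8 * (R + R) ^ 2 / h) * Real.exp (-(2 / h * ‖A m‖ ^ 2))),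
    ((integrable_gaussian A (show 0 < 2 / h by positivity)).const_mul _).const_mul _,
    fun x ζ m hx hζ => ?_⟩
  rw [norm_mul]
  refine mul_le_mul (hA₀ m) ((norm_exp_herm_le A hh x ζ m).trans ?_) (norm_nonneg _)
    ((norm_nonneg _).trans (hA₀ m))
  gcongr

theorem continuous_wick (A : Cn n ≃L[ℂ] Cn n) {h : ℝ} (hh : 0 < h) {a : Cn n → ℂ}
    (ha : Continuous a) {A₀ : ℝ} (hA₀ : ∀ m, ‖a m‖ ≤ A₀) :
    Continuous fun p : Cn n × Cn n => wick A h a p.1 p.2 := by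
  refine continuous_integral_of_locally_dominated ?_ fun p₀ => ?_
  · exact (ha.comp continuous_snd).mul (continuous_exp_herm A h
      (continuous_snd.sub (continuous_snd.comp continuous_fst))
      (continuous_snd.sub (continuous_fst.comp continuous_fst)))
  · obtain ⟨G, hG, hle⟩ := wick_domination A hh hA₀ (max ‖A p₀.1‖ ‖A p₀.2‖ + 1)
    refine ⟨G, hG, ?_⟩
    have h1 : ∀ᶠ p : Cn n × Cn n in nhds p₀, ‖A p.1‖ < max ‖A p₀.1‖ ‖A p₀.2‖ + 1 :=
      (by fun_prop : Continuous fun p : Cn n × Cn n => ‖A p.1‖).continuousAt.eventually_lt_const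
        (by linarith [le_max_left ‖A p₀.1‖ ‖A p₀.2‖])
    have h2 : ∀ᶠ p : Cn n × Cn n in nhds p₀, ‖A p.2‖ < max ‖A p₀.1‖ ‖A p₀.2‖ + 1 :=
      (by fun_prop : Continuous fun p : Cn n × Cn n => ‖A p.2‖).continuousAt.eventually_lt_const
        (by linarith [le_max_right ‖A p₀.1‖ ‖A p₀.2‖])
    filter_upwards [h1, h2] with p hp1 hp2 m
    exact hle _ _ m hp1.le hp2.le

theorem differentiable_wick (A : Cn n ≃L[ℂ] Cn n) {h : ℝ} (hh : 0 < h) {a : Cn n → ℂ}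
    (ha : Continuous a) {A₀ : ℝ} (hA₀ : ∀ m, ‖a m‖ ≤ A₀) (ζ : Cn n) :
    Differentiable ℂ fun x => wick A h a x ζ := by
  refine differentiable_integral_of_locally_dominated ?_ (fun m => ?_) fun R => ?_
  · exact (ha.comp continuous_snd).mul (continuous_exp_herm A h
      (continuous_snd.sub continuous_const) (continuous_snd.sub continuous_fst))
  · have h1 : Differentiable ℂ fun x => herm A (m - ζ) (m - x) :=
      (differentiable_herm A (m - ζ)).comp (differentiable_id.const_sub m)
    have h3 : Differentiable ℂ fun x => -4 * herm A (m - ζ) (m - x) / (h : ℂ) := by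
      simpa only [div_eq_mul_inv] using (h1.const_mul (-4)).mul_const ((h : ℂ)⁻¹)
    exact h3.cexp.const_mul _
  · obtain ⟨G, hG, hle⟩ := wick_domination A hh hA₀
      (max (‖(A : Cn n →L[ℂ] Cn n)‖ * R) ‖A ζ‖)
    refine ⟨G, hG, fun x m hx => hle x ζ m ?_ (le_max_right _ _)⟩
    exact (((A : Cn n →L[ℂ] Cn n).le_opNorm x).trans (by gcongr)).trans (le_max_left _ _)

theorem differentiable_shiftKernel (A : Cn n ≃L[ℂ] Cn n) (h : ℝ) (δ z : Cn n) :
    Differentiable ℂ fun x => shiftKernel A h δ x z := by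
  have h1 := differentiable_herm A (z + δ)
  have h3 : Differentiable ℂ fun x =>
      (2 * herm A (z + δ) x - 2 * herm A (z + δ) z) / (h : ℂ) := by
    simpa only [div_eq_mul_inv] using ((h1.const_mul 2).sub_const _).mul_const ((h : ℂ)⁻¹)
  exact h3.cexp

/-! ### The operator on all of `H_Φ` -/

/-- The operator with Wick kernel `wick A h a`, the antiholomorphic variable being moved by `δ`. -/
def wickOp (A : Cn n ≃L[ℂ] Cn n) (h : ℝ) (a : Cn n → ℂ) (δ : Cn n) (v : Cn n → ℂ) (x : Cn n) : ℂ :=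
  ∫ z, shiftKernel A h δ x z * wick A h a x (z + δ) * v z

/-- At fixed h, polynomial decay of arbitrary order is all that absolute convergence requires;
uniformity in h plays no role here. -/
theorem exists_norm_wick_le_poly (A : Cn n ≃L[ℂ] Cn n) {s A₀ C : ℝ} (hs : 1 < s) (hC : 0 ≤ C)
    {a : Cn n → ℂ} (ha : GevreyBound s A₀ C a) {h : ℝ} (hh : 0 < h) (N : ℕ) :
    ∃ B : ℝ, 0 ≤ B ∧ ∀ x ζ : Cn n, ‖wick A h a x ζ‖ ≤
      B * (Real.exp (‖A (x - ζ)‖ ^ 2 / h) * ((1 + ‖x - ζ‖) ^ N)⁻¹) := by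
  have hs0 : 0 < s := by linarith
  obtain ⟨κ, hκ, -, hAκ⟩ := exists_norm_equiv A
  obtain ⟨c, hc, hle⟩ := exists_norm_wick_le_decay A hs hC hκ hAκ
  obtain ⟨B₁, hB₁, h1⟩ := exp_neg_mul_rpow_le (show 0 < κ / h by positivity) (p := 2) two_pos N
  obtain ⟨B₂, hB₂, h2⟩ := exp_neg_mul_rpow_le (show 0 < c / h ^ (1 / s) by positivity)
    (p := 1 / s) (by positivity) N
  have hA₀ : 0 ≤ A₀ := (norm_nonneg _).trans (ha.norm_le 0)
  have hG := (gaussMass_pos A (show 0 < 4 / h by positivity)).le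
  refine ⟨A₀ * gaussMass A (4 / h) * (2 * B₁ + 5 * B₂), by positivity, fun x ζ => ?_⟩
  have h3 := h1 ‖x - ζ‖ (norm_nonneg _)
  have h4 := h2 ‖x - ζ‖ (norm_nonneg _)
  rw [Real.rpow_two, div_mul_eq_mul_div, mul_div_assoc] at h3
  rw [div_mul_eq_mul_div, mul_div_assoc, ← Real.div_rpow (norm_nonneg _) hh.le] at h4
  calc _ ≤ _ := hle A₀ a ha h hh x ζ
    _ ≤ A₀ * gaussMass A (4 / h) * (Real.exp (‖A (x - ζ)‖ ^ 2 / h) *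
        (2 * (B₁ * ((1 + ‖x - ζ‖) ^ N)⁻¹) + 5 * (B₂ * ((1 + ‖x - ζ‖) ^ N)⁻¹))) := by gcongr
    _ = _ := by ring

theorem inv_one_add_norm_sub_pow_le (x z : Cn n) (N : ℕ) :
    ((1 + ‖x - z‖) ^ N)⁻¹ ≤ (1 + ‖x‖) ^ N * ((1 + ‖z‖) ^ N)⁻¹ := by
  rw [← div_eq_mul_inv, inv_le_iff_one_le_mul₀ (by positivity), div_mul_eq_mul_div,
    le_div_iff₀ (by positivity), one_mul, ← mul_pow]
  gcongr
  have h1 : ‖z‖ ≤ ‖x‖ + ‖x - z‖ := by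
    have := norm_sub_le x (x - z)
    rwa [sub_sub_cancel] at this
  nlinarith [norm_nonneg x, norm_nonneg (x - z), mul_nonneg (norm_nonneg x) (norm_nonneg (x - z))]

/-- The growth of `wick` cancels the Gaussian of the shifted kernel exactly, and weighted v is only
bounded, so integrability rests on the polynomial decay of order 2n + 1 left in `wick`. -/
theorem exists_wickOp_domination (A : Cn n ≃L[ℂ] Cn n) {s A₀ C : ℝ} (hs : 1 < s) (hC : 0 ≤ C)
    {a : Cn n → ℂ} (ha : GevreyBound s A₀ C a) {h : ℝ} (hh : 0 < h) (δ : Cn n) (B R : ℝ) :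
    ∃ G : Cn n → ℝ, Integrable G ∧ ∀ (x z : Cn n) (v : ℂ), ‖x‖ ≤ R →
      ‖v‖ * Real.exp (-(‖A z‖ ^ 2 / h)) ≤ B →
      ‖shiftKernel A h δ x z * wick A h a x (z + δ) * v‖ ≤ G z := by
  obtain ⟨B₁, hB₁, hle⟩ := exists_norm_wick_le_poly A hs hC ha hh (2 * n + 1)
  set Λ := ‖(A : Cn n →L[ℂ] Cn n)‖
  refine ⟨fun z => Real.exp (((Λ * R) ^ 2 + ‖A δ‖ ^ 2) / h) * (B₁ *
      ((1 + (R + ‖δ‖)) ^ (2 * n + 1) * ((1 + ‖z‖) ^ (2 * n + 1))⁻¹)) * B,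
    ((integrable_inv_one_add_norm_pow.const_mul _).const_mul _).const_mul _ |>.mul_const _,
    fun x z v hx hv => ?_⟩
  have hR : 0 ≤ R := (norm_nonneg x).trans hx
  have hAx : ‖A x‖ ≤ Λ * R := ((A : Cn n →L[ℂ] Cn n).le_opNorm x).trans (by gcongr)
  have hB : 0 ≤ B := le_trans (by positivity) hv
  have h1 := hle x (z + δ)
  have hsub : x - (z + δ) = (x - δ) - z := by abel
  have hsub' : x - z - δ = (x - δ) - z := by abel
  have h2 := inv_one_add_norm_sub_pow_le (x - δ) z (2 * n + 1)
  rw [hsub] at h1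
  have h3 : Real.exp (-(1 / h * ‖A (x - z - δ)‖ ^ 2)) * Real.exp (‖A (x - δ - z)‖ ^ 2 / h) = 1 := by
    rw [hsub', ← Real.exp_add, Real.exp_eq_one_iff]
    ring
  have h4 : 1 + ‖x - δ‖ ≤ 1 + (R + ‖δ‖) := by
    have := norm_sub_le x δ
    linarith
  rw [mul_assoc, norm_mul, norm_mul, norm_shiftKernel_mul]
  set P := Real.exp (-(1 / h * ‖A (x - z - δ)‖ ^ 2))
  set Q := Real.exp (‖A (x - δ - z)‖ ^ 2 / h)
  set S := ‖v‖ * Real.exp (-(‖A z‖ ^ 2 / h)) with hS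
  set W := ‖wick A h a x (z + δ)‖
  set E := Real.exp ((‖A x‖ ^ 2 + ‖A δ‖ ^ 2) / h) with hE
  have hEE : E ≤ Real.exp (((Λ * R) ^ 2 + ‖A δ‖ ^ 2) / h) := by
    rw [hE]
    gcongr
  calc E * (P * (W * ‖v‖ * Real.exp (-(‖A z‖ ^ 2 / h)))) = E * P * W * S := by
        rw [hS]
        ring
    _ ≤ E * P * (B₁ * (Q * ((1 + ‖x - δ - z‖) ^ (2 * n + 1))⁻¹)) * B := by gcongr
    _ = E * (B₁ * (P * Q * ((1 + ‖x - δ - z‖) ^ (2 * n + 1))⁻¹)) * B := by ring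
    _ ≤ Real.exp (((Λ * R) ^ 2 + ‖A δ‖ ^ 2) / h) * (B₁ *
        ((1 + ‖x - δ‖) ^ (2 * n + 1) * ((1 + ‖z‖) ^ (2 * n + 1))⁻¹)) * B := by
        rw [h3, one_mul]
        gcongr
    _ ≤ _ := by
        beta_reduce
        gcongr

theorem continuous_wickOp_integrand (A : Cn n ≃L[ℂ] Cn n) {h : ℝ} (hh : 0 < h) {a : Cn n → ℂ}
    (ha : Continuous a) {A₀ : ℝ} (hA₀ : ∀ m, ‖a m‖ ≤ A₀) (δ : Cn n) {v : Cn n → ℂ}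
    (hv : Continuous v) :
    Continuous (Function.uncurry fun x z =>
      shiftKernel A h δ x z * wick A h a x (z + δ) * v z) := by
  have h1 := continuous_shiftKernel A h (continuous_const (y := δ))
    (continuous_fst (X := Cn n) (Y := Cn n)) continuous_snd
  have h2 := (continuous_wick A hh ha hA₀).comp
    ((continuous_fst (X := Cn n) (Y := Cn n)).prodMk (continuous_snd.add (continuous_const (y := δ))))
  exact (h1.mul h2).mul (hv.comp continuous_snd)

theorem integrable_wickOp_integrand (A : Cn n ≃L[ℂ] Cn n) {s A₀ C : ℝ} (hs : 1 < s) (hC : 0 ≤ C)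
    {a : Cn n → ℂ} (ha : GevreyBound s A₀ C a) {h : ℝ} (hh : 0 < h) (δ x : Cn n)
    {v : Cn n → ℂ} (hv : Continuous v) {B : ℝ}
    (hB : ∀ z, ‖v z‖ * Real.exp (-(‖A z‖ ^ 2 / h)) ≤ B) :
    Integrable fun z => shiftKernel A h δ x z * wick A h a x (z + δ) * v z := by
  obtain ⟨G, hG, hle⟩ := exists_wickOp_domination A hs hC ha hh δ B ‖x‖
  refine hG.mono' ?_ (Filter.Eventually.of_forall fun z => hle x z _ le_rfl (hB z))
  exact ((continuous_wickOp_integrand A hh ha.1.continuous ha.norm_le δ hv).comp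
    (Continuous.prodMk_right x)).aestronglyMeasurable

theorem differentiable_wickOp (A : Cn n ≃L[ℂ] Cn n) {s A₀ C : ℝ} (hs : 1 < s) (hC : 0 ≤ C)
    {a : Cn n → ℂ} (ha : GevreyBound s A₀ C a) {h : ℝ} (hh : 0 < h) (δ : Cn n)
    {v : Cn n → ℂ} (hv : Continuous v) {B : ℝ}
    (hB : ∀ z, ‖v z‖ * Real.exp (-(‖A z‖ ^ 2 / h)) ≤ B) :
    Differentiable ℂ (wickOp A h a δ v) := by
  refine differentiable_integral_of_locally_dominated
    (continuous_wickOp_integrand A hh ha.1.continuous ha.norm_le δ hv) (fun z => ?_) fun R => ?_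
  · exact ((differentiable_shiftKernel A h δ z).mul
      (differentiable_wick A hh ha.1.continuous ha.norm_le (z + δ))).mul_const _
  · obtain ⟨G, hG, hle⟩ := exists_wickOp_domination A hs hC ha hh δ B R
    exact ⟨G, hG, fun x z hx => hle x z _ hx (hB z)⟩

/-- When weighted v is integrable, both sides are the same Weyl integral up to a nonzero constant. A
merely bounded one is reached through the dilates v(τz): for τ < 1 their weighted size gains a
Gaussian, and dominated convergence lets τ tend to 1. -/
theorem wickOp_eq_wickOp_zero (A : Cn n ≃L[ℂ] Cn n) {s A₀ C : ℝ} (hs : 1 < s) (hC : 0 ≤ C)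
    {a : Cn n → ℂ} (ha : GevreyBound s A₀ C a) {h : ℝ} (hh : 0 < h) (δ x : Cn n)
    {v : Cn n → ℂ} (hv : Differentiable ℂ v) {B : ℝ}
    (hB : ∀ z, ‖v z‖ * Real.exp (-(‖A z‖ ^ 2 / h)) ≤ B) :
    wickOp A h a δ v x = wickOp A h a 0 v x := by
  have hB0 : 0 ≤ B := le_trans (by positivity) (hB 0)
  have hvt : ∀ τ : ℝ, Differentiable ℂ fun z => v ((τ : ℂ) • z) := fun τ =>
    hv.comp (by fun_prop : Differentiable ℂ fun z : Cn n => (τ : ℂ) • z)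
  have hbt : ∀ τ : ℝ, ∀ z, ‖v ((τ : ℂ) • z)‖ * Real.exp (-(‖A z‖ ^ 2 / h)) ≤
      B * Real.exp (-((1 - τ ^ 2) / h * ‖A z‖ ^ 2)) := by
    intro τ z
    have h1 := hB ((τ : ℂ) • z)
    rw [map_smul, norm_smul, mul_pow, Complex.norm_real, Real.norm_eq_abs, sq_abs] at h1
    calc ‖v ((τ : ℂ) • z)‖ * Real.exp (-(‖A z‖ ^ 2 / h)) =
        (‖v ((τ : ℂ) • z)‖ * Real.exp (-(τ ^ 2 * ‖A z‖ ^ 2 / h))) *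
          Real.exp (-((1 - τ ^ 2) / h * ‖A z‖ ^ 2)) := by
          rw [mul_assoc, ← Real.exp_add]
          congr 2
          ring
      _ ≤ _ := by gcongr
  have hbB : ∀ τ : ℝ, 0 < τ → τ < 1 → ∀ z, ‖v ((τ : ℂ) • z)‖ * Real.exp (-(‖A z‖ ^ 2 / h)) ≤ B := by
    intro τ h0 h1 z
    refine (hbt τ z).trans (mul_le_of_le_one_right hB0 ?_)
    have : 0 ≤ 1 - τ ^ 2 := by nlinarith
    rw [Real.exp_le_one_iff, neg_nonpos]
    positivity
  have hev : ∀ᶠ τ : ℝ in nhdsWithin 1 (Set.Iio 1), 0 < τ ∧ τ < 1 :=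
    Ioo_mem_nhdsLT one_pos
  have hlim : ∀ δ : Cn n, Filter.Tendsto (fun τ : ℝ => wickOp A h a δ (fun z => v ((τ : ℂ) • z)) x)
      (nhdsWithin 1 (Set.Iio 1)) (nhds (wickOp A h a δ v x)) := by
    intro δ
    obtain ⟨G, hG, hle⟩ := exists_wickOp_domination A hs hC ha hh δ B ‖x‖
    refine tendsto_integral_filter_of_dominated_convergence G
      (Filter.Eventually.of_forall fun τ => ((continuous_wickOp_integrand A hh ha.1.continuous
        ha.norm_le δ (hvt τ).continuous).comp (Continuous.prodMk_right x)).aestronglyMeasurable)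
      (hev.mono fun τ hτ => Filter.Eventually.of_forall fun z =>
        hle x z _ le_rfl (hbB τ hτ.1 hτ.2 z)) hG
      (Filter.Eventually.of_forall fun z => ?_)
    have hc : Continuous fun τ : ℝ =>
        shiftKernel A h δ x z * wick A h a x (z + δ) * v ((τ : ℂ) • z) := by
      have := hv.continuous
      fun_prop
    have := (hc.tendsto 1).mono_left (nhdsWithin_le_nhds (s := Set.Iio (1 : ℝ)))
    simpa using this
  refine tendsto_nhds_unique (hlim δ) ((hlim 0).congr' ?_)
  refine hev.mono fun τ hτ => ?_
  have hint : Integrable fun z => ‖v ((τ : ℂ) • z)‖ * Real.exp (-(‖A z‖ ^ 2 / h)) := by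
    have hpos : 0 < (1 - τ ^ 2) / h := div_pos (by nlinarith [hτ.1, hτ.2]) hh
    refine ((integrable_gaussian A hpos).const_mul B).mono' ?_
      (Filter.Eventually.of_forall fun z => ?_)
    · have := hv.continuous
      exact (by fun_prop : Continuous fun z =>
        ‖v ((τ : ℂ) • z)‖ * Real.exp (-(‖A z‖ ^ 2 / h))).aestronglyMeasurable
    · rw [Real.norm_of_nonneg (by positivity)]
      exact hbt τ z
  have h1 := integral_weylPhase_eq A hh ha.1.continuous ha.norm_le (hvt τ) (hbB τ hτ.1 hτ.2) hint
  have h2 := (h1 δ x).symm.trans (h1 0 x)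
  have hM : (4 ^ n / gaussMass A (2 / h) : ℂ) ≠ 0 := by
    refine div_ne_zero (by positivity) ?_
    exact_mod_cast (gaussMass_pos A (by positivity)).ne'
  exact (mul_left_cancel₀ hM h2).symm

/-! ### Quadratic weights -/

/-- The polar form of a quadratic form, as a continuous bilinear map. -/
def polarCLM (Φ : QuadraticForm ℝ (Cn n)) : Cn n →L[ℝ] Cn n →L[ℝ] ℝ :=
  LinearMap.toContinuousBilinearMap (QuadraticMap.polarBilin Φ)

theorem polarCLM_apply (Φ : QuadraticForm ℝ (Cn n)) (x y : Cn n) :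
    polarCLM Φ x y = QuadraticMap.polar Φ x y := rfl

theorem polarCLM_comm (Φ : QuadraticForm ℝ (Cn n)) (x y : Cn n) :
    polarCLM Φ x y = polarCLM Φ y x := QuadraticMap.polar_comm Φ x y

theorem polarCLM_self (Φ : QuadraticForm ℝ (Cn n)) (x : Cn n) : polarCLM Φ x x = 2 * Φ x := by
  rw [polarCLM_apply, QuadraticMap.polar_self, two_nsmul, two_mul]

theorem hasFDerivAt_quadraticForm (Φ : QuadraticForm ℝ (Cn n)) (x : Cn n) :
    HasFDerivAt (fun y => Φ y) (polarCLM Φ x) x := by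
  have h1 := (polarCLM Φ).hasFDerivAt_of_bilinear (hasFDerivAt_id x) (hasFDerivAt_id x)
  have h2 := h1.const_mul (1 / 2 : ℝ)
  refine (h2.congr_of_eventuallyEq (Filter.Eventually.of_forall fun y => ?_)).congr_fderiv ?_
  · simp only [id, polarCLM_self]
    ring
  · ext v
    change (1 / 2 : ℝ) * (polarCLM Φ x v + polarCLM Φ v x) = polarCLM Φ x v
    rw [polarCLM_comm Φ v x]
    ring

theorem continuous_quadraticForm (Φ : QuadraticForm ℝ (Cn n)) : Continuous fun x => Φ x :=
  continuous_iff_continuousAt.2 fun x => (hasFDerivAt_quadraticForm Φ x).continuousAt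

theorem fderiv_quadraticForm_ofReal (Φ : QuadraticForm ℝ (Cn n)) (x v : Cn n) :
    fderiv ℝ (fun y => (Φ y : ℂ)) x v = (polarCLM Φ x v : ℂ) := by
  have h := (Complex.ofRealCLM.hasFDerivAt (x := Φ x)).comp x (hasFDerivAt_quadraticForm Φ x)
  have h2 : HasFDerivAt (fun y => (Φ y : ℂ)) (Complex.ofRealCLM.comp (polarCLM Φ x)) x := h
  rw [h2.fderiv]
  rfl

/-- `x ↦ ∂Φ/∂x_k (x)` as a real linear map. -/
def dzCLM (Φ : QuadraticForm ℝ (Cn n)) (k : Fin n) : Cn n →L[ℝ] ℂ :=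
  (1 / 2 : ℂ) • (Complex.ofRealCLM.comp ((polarCLM Φ).flip (realDir (k, 0))) -
    Complex.I • Complex.ofRealCLM.comp ((polarCLM Φ).flip (realDir (k, 1))))

theorem dzCLM_apply (Φ : QuadraticForm ℝ (Cn n)) (k : Fin n) (x : Cn n) :
    dzCLM Φ k x = (1 / 2) * ((polarCLM Φ x (realDir (k, 0)) : ℂ) -
      Complex.I * (polarCLM Φ x (realDir (k, 1)) : ℂ)) := rfl

theorem dz_quadraticForm (Φ : QuadraticForm ℝ (Cn n)) (k : Fin n) (x : Cn n) :
    dz k (fun y => (Φ y : ℂ)) x = dzCLM Φ k x := by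
  rw [dz, fderiv_quadraticForm_ofReal, fderiv_quadraticForm_ofReal, dzCLM_apply]

theorem dzbar_dz_quadraticForm (Φ : QuadraticForm ℝ (Cn n)) (j k : Fin n) (x : Cn n) :
    dzbar j (dz k fun y => (Φ y : ℂ)) x =
      (1 / 2) * (dzCLM Φ k (realDir (j, 0)) + Complex.I * dzCLM Φ k (realDir (j, 1))) := by
  have h : (dz k fun y => (Φ y : ℂ)) = dzCLM Φ k := funext fun x => dz_quadraticForm Φ k x
  rw [dzbar, h, ContinuousLinearMap.fderiv]

/-- The complex Hessian `∂²Φ/∂x_j∂x_k`. -/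
def holHessian (Φ : QuadraticForm ℝ (Cn n)) (j k : Fin n) : ℂ :=
  (1 / 2) * (dzCLM Φ k (realDir (j, 0)) - Complex.I * dzCLM Φ k (realDir (j, 1)))

theorem holHessian_comm (Φ : QuadraticForm ℝ (Cn n)) (j k : Fin n) :
    holHessian Φ j k = holHessian Φ k j := by
  simp only [holHessian, dzCLM_apply]
  rw [polarCLM_comm Φ (realDir (k, 0)), polarCLM_comm Φ (realDir (k, 0)),
    polarCLM_comm Φ (realDir (k, 1)), polarCLM_comm Φ (realDir (k, 1))]
  ring

theorem clm_eq_sum_realDir {F : Type*} [NormedAddCommGroup F] [NormedSpace ℝ F]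
    (f : Cn n →L[ℝ] F) (x : Cn n) :
    f x = ∑ j, ((x j).re • f (realDir (j, 0)) + (x j).im • f (realDir (j, 1))) := by
  conv_lhs => rw [eq_sum_realDir x]
  rw [map_sum, Fintype.sum_prod_type]
  simp [Fin.sum_univ_two]

theorem dzCLM_eq_sum (Φ : QuadraticForm ℝ (Cn n)) (k : Fin n) (x : Cn n) :
    dzCLM Φ k x = ∑ j, (x j * holHessian Φ j k + (starRingEnd ℂ) (x j) *
      ((1 / 2) * (dzCLM Φ k (realDir (j, 0)) + Complex.I * dzCLM Φ k (realDir (j, 1))))) := by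
  rw [clm_eq_sum_realDir]
  refine Finset.sum_congr rfl fun j _ => ?_
  rw [holHessian, Complex.real_smul, Complex.real_smul]
  have h1 : x j = (x j).re + (x j).im * Complex.I := (Complex.re_add_im _).symm
  have h2 : (starRingEnd ℂ) (x j) = (x j).re - (x j).im * Complex.I := by
    apply Complex.ext <;> simp
  rw [h2]
  conv_rhs => rw [h1]
  simp only [Complex.add_re, Complex.ofReal_re, Complex.mul_re, Complex.I_re, Complex.ofReal_im,
    Complex.I_im, Complex.add_im, Complex.mul_im]
  simp only [mul_zero, mul_one, sub_self, add_zero, zero_add]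
  linear_combination ((x j).im * dzCLM Φ k (realDir (j, 1))) * Complex.I_sq

theorem quadraticForm_eq_re_sum (Φ : QuadraticForm ℝ (Cn n)) (x : Cn n) :
    Φ x = (∑ k, x k * dzCLM Φ k x).re := by
  have h := clm_eq_sum_realDir (polarCLM Φ x) x
  rw [polarCLM_self] at h
  rw [Complex.re_sum]
  have h2 : ∀ k, (x k * dzCLM Φ k x).re = 1 / 2 * ((x k).re • polarCLM Φ x (realDir (k, 0)) +
      (x k).im • polarCLM Φ x (realDir (k, 1))) := by
    intro k
    rw [dzCLM_apply]
    simp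
    ring
  simp only [h2]
  rw [← Finset.mul_sum, ← h]
  ring

/-- The holomorphic bilinear part of a quadratic weight. -/
def holForm (Φ : QuadraticForm ℝ (Cn n)) (x y : Cn n) : ℂ :=
  ∑ k, y k * ∑ j, x j * holHessian Φ j k

theorem holForm_comm (Φ : QuadraticForm ℝ (Cn n)) (x y : Cn n) :
    holForm Φ x y = holForm Φ y x := by
  simp only [holForm, Finset.mul_sum]
  rw [Finset.sum_comm]
  refine Finset.sum_congr rfl fun j _ => Finset.sum_congr rfl fun k _ => ?_
  rw [holHessian_comm Φ j k]
  ring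

/-- Polarization of a symmetric bilinear form; it makes the holomorphic part of the Weyl phase split
into a function of x minus one of y. -/
theorem holForm_midpoint (Φ : QuadraticForm ℝ (Cn n)) (x y : Cn n) :
    2 * holForm Φ ((1 / 2 : ℝ) • (x + y)) (x - y) = holForm Φ x x - holForm Φ y y := by
  have h := holForm_comm Φ x y
  have h1 : 2 * holForm Φ ((1 / 2 : ℝ) • (x + y)) (x - y) =
      holForm Φ x x + holForm Φ y x - holForm Φ x y - holForm Φ y y := by
    simp only [holForm, PiLp.smul_apply, PiLp.add_apply, PiLp.sub_apply, Complex.real_smul,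
      Finset.mul_sum, ← Finset.sum_add_distrib, ← Finset.sum_sub_distrib]
    refine Finset.sum_congr rfl fun k _ => Finset.sum_congr rfl fun j _ => ?_
    push_cast
    ring
  rw [h1, h]
  ring

theorem differentiable_holForm_self (Φ : QuadraticForm ℝ (Cn n)) :
    Differentiable ℂ fun x => holForm Φ x x := by
  have hc : ∀ k : Fin n, Differentiable ℂ fun x : Cn n => x k := fun k =>
    (EuclideanSpace.proj (𝕜 := ℂ) k).differentiable
  unfold holForm
  fun_prop

open scoped MatrixOrder in
-- A positive definite matrix is u*u with u invertible, and A is the operator of u.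
theorem exists_herm_eq_of_posDef {M : Matrix (Fin n) (Fin n) ℂ} (hM : M.PosDef) :
    ∃ A : Cn n ≃L[ℂ] Cn n, ∀ x y : Cn n,
      herm A x y = ∑ k, y k * ∑ j, (starRingEnd ℂ) (x j) * M j k := by
  obtain ⟨B, hB, rfl⟩ := CStarAlgebra.isStrictlyPositive_iff_eq_star_mul_self.1
    hM.isStrictlyPositive
  obtain ⟨u, rfl⟩ := hB
  have hinv : ∀ (P Q : Matrix (Fin n) (Fin n) ℂ), P * Q = 1 → ∀ x : Cn n,
      Matrix.toEuclideanCLM (𝕜 := ℂ) P (Matrix.toEuclideanCLM (𝕜 := ℂ) Q x) = x := by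
    intro P Q hPQ x
    have h1 := congrArg (fun T : Cn n →L[ℂ] Cn n => T x)
      (map_mul (Matrix.toEuclideanCLM (n := Fin n) (𝕜 := ℂ)) P Q)
    rw [hPQ, map_one] at h1
    exact h1.symm
  refine ⟨ContinuousLinearEquiv.equivOfInverse
    (Matrix.toEuclideanCLM (n := Fin n) (𝕜 := ℂ) (u : Matrix (Fin n) (Fin n) ℂ))
    (Matrix.toEuclideanCLM (n := Fin n) (𝕜 := ℂ) ((u⁻¹ : (Matrix (Fin n) (Fin n) ℂ)ˣ) :
      Matrix (Fin n) (Fin n) ℂ)) (hinv _ _ u.inv_mul) (hinv _ _ u.mul_inv), fun x y => ?_⟩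
  rw [herm, EuclideanSpace.inner_eq_star_dotProduct]
  simp only [ContinuousLinearEquiv.equivOfInverse_apply, Matrix.ofLp_toEuclideanCLM]
  rw [Matrix.star_mulVec, dotProduct_comm, ← Matrix.dotProduct_mulVec,
    Matrix.mulVec_mulVec, Matrix.dotProduct_mulVec, dotProduct_comm]
  simp only [dotProduct, Matrix.vecMul, Matrix.star_eq_conjTranspose, Pi.star_apply]
  rfl

/-- A strictly plurisubharmonic quadratic form is `|Ax|²` plus the real part of a holomorphic
quadratic form. -/
theorem exists_herm_decomposition (Φ : QuadraticForm ℝ (Cn n))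
    (hΦ : StrictlyPlurisubharmonic fun x => Φ x) :
    ∃ A : Cn n ≃L[ℂ] Cn n, (∀ x, Φ x = ‖A x‖ ^ 2 + (holForm Φ x x).re) ∧
      ∀ m w : Cn n, ∑ k, w k * dzCLM Φ k m = herm A m w + holForm Φ m w := by
  -- The Levi matrix of a quadratic form is constant, so the origin stands for every point.
  obtain ⟨A, hA⟩ := exists_herm_eq_of_posDef (hΦ 0)
  have h2 : ∀ m w : Cn n, ∑ k, w k * dzCLM Φ k m = herm A m w + holForm Φ m w := by
    intro m w
    rw [hA, holForm, ← Finset.sum_add_distrib]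
    refine Finset.sum_congr rfl fun k _ => ?_
    rw [← mul_add, ← Finset.sum_add_distrib, dzCLM_eq_sum]
    congr 1
    refine Finset.sum_congr rfl fun j _ => ?_
    rw [Matrix.of_apply, dzbar_dz_quadraticForm]
    ring
  refine ⟨A, fun x => ?_, h2⟩
  rw [quadraticForm_eq_re_sum, h2, herm_self, Complex.add_re, ← Complex.ofReal_pow,
    Complex.ofReal_re]

/-! ### The Weyl integrand for a quadratic weight -/

theorem xiMap_quadraticForm (Φ : QuadraticForm ℝ (Cn n)) (m : Cn n) (j : Fin n) :
    xiMap (fun x => Φ x) m j = (2 / Complex.I) * dzCLM Φ j m := by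
  rw [xiMap, ← dz_quadraticForm]

/-- For a quadratic weight ξ is real linear in x, so the Jacobian of the contour is constant. Its
value is not needed: only its modulus enters the final norm bound. -/
theorem exists_contourDensity_eq (Φ : QuadraticForm ℝ (Cn n)) :
    ∃ D : ℂ, ∀ x y, contourDensity (contour (fun x => Φ x) x) y = D := by
  set Ξ : Cn n →L[ℝ] Cn n := ((PiLp.continuousLinearEquiv 2 ℝ (fun _ : Fin n => ℂ)).symm :
    (Fin n → ℂ) →L[ℝ] Cn n).comp
    (ContinuousLinearMap.pi fun j => (2 / Complex.I) • dzCLM Φ j) with hΞ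
  have hx : ∀ m, xiMap (fun x => Φ x) m = Ξ m := by
    intro m
    ext j
    rw [xiMap_quadraticForm]
    rfl
  have hfd : ∀ x y, fderiv ℝ (contour (fun x => Φ x) x) y = (1 / 2 : ℝ) • Ξ := by
    intro x y
    have h1 : contour (fun x => Φ x) x = fun y => Ξ ((1 / 2 : ℝ) • (x + y)) :=
      funext fun y => hx _
    have h2 : HasFDerivAt (fun y : Cn n => (1 / 2 : ℝ) • (x + y))
        ((1 / 2 : ℝ) • ContinuousLinearMap.id ℝ (Cn n)) y :=
      ((hasFDerivAt_id y).const_add x).const_smul (1 / 2 : ℝ)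
    have h3 : HasFDerivAt (fun y : Cn n => Ξ ((1 / 2 : ℝ) • (x + y)))
        (Ξ.comp ((1 / 2 : ℝ) • ContinuousLinearMap.id ℝ (Cn n))) y := Ξ.hasFDerivAt.comp y h2
    rw [h1, h3.fderiv]
    ext v
    simp
  refine ⟨contourDensity (contour (fun x => Φ x) 0) 0, fun x y => ?_⟩
  simp only [contourDensity, hfd]

/-- On the contour the phase is 2(x-y)·∂Φ(m)/h at the midpoint m; its Hermitian part is the phase
for |Ax|², and its holomorphic part telescopes. -/
theorem weylIntegrand_eq {Φ : QuadraticForm ℝ (Cn n)} {A : Cn n ≃L[ℂ] Cn n}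
    (hA : ∀ m w : Cn n, ∑ k, w k * dzCLM Φ k m = herm A m w + holForm Φ m w) {D : ℂ}
    (hD : ∀ x y, contourDensity (contour (fun x => Φ x) x) y = D) (h : ℝ)
    (a : Lam (fun x => Φ x) → ℂ) (u : Cn n → ℂ) (x y : Cn n) :
    weylIntegrand (fun x => Φ x) h a u x y =
      D * Complex.exp (holForm Φ x x / h) * (weylPhase A h x y *
        a (lamPoint (fun x => Φ x) ((1 / 2 : ℝ) • (x + y))) *
        (Complex.exp (-(holForm Φ y y / h)) * u y)) := by
  have hexp : Complex.I / h * ∑ j, (x j - y j) * contour (fun x => Φ x) x y j =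
      holForm Φ x x / h + (herm A x x - herm A y y - herm A x y + herm A y x) / h +
        -(holForm Φ y y / h) := by
    have h1 : ∑ j, (x j - y j) * contour (fun x => Φ x) x y j =
        (2 / Complex.I) * ∑ j, (x - y) j * dzCLM Φ j ((1 / 2 : ℝ) • (x + y)) := by
      rw [Finset.mul_sum]
      refine Finset.sum_congr rfl fun j _ => ?_
      rw [contour, xiMap_quadraticForm, PiLp.sub_apply]
      ring
    have h2 : 2 * herm A ((1 / 2 : ℝ) • (x + y)) (x - y) =
        herm A x x - herm A y y - herm A x y + herm A y x := by
      have h3 : A ((1 / 2 : ℝ) • (x + y)) = (1 / 2 : ℂ) • (A x + A y) := by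
        rw [map_real_smul, map_add]
        ext j
        simp
      have hc : (starRingEnd ℂ) (1 / 2 : ℂ) = 1 / 2 := by
        rw [map_div₀, map_one, map_ofNat]
      simp only [herm, h3, map_sub, inner_smul_left, inner_add_left, inner_sub_right, hc]
      ring
    rw [h1, hA]
    have h4 := holForm_midpoint Φ x y
    have h5 : Complex.I / h * (2 / Complex.I * (herm A ((1 / 2 : ℝ) • (x + y)) (x - y) +
        holForm Φ ((1 / 2 : ℝ) • (x + y)) (x - y))) =
        (2 * herm A ((1 / 2 : ℝ) • (x + y)) (x - y) +
          2 * holForm Φ ((1 / 2 : ℝ) • (x + y)) (x - y)) / h := by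
      have hI : Complex.I * (2 / Complex.I) = 2 := mul_div_cancel₀ 2 Complex.I_ne_zero
      linear_combination ((herm A ((1 / 2 : ℝ) • (x + y)) (x - y) +
        holForm Φ ((1 / 2 : ℝ) • (x + y)) (x - y)) / h) * hI
    rw [h5, h2, h4]
    ring
  rw [weylIntegrand, hexp, hD, Complex.exp_add, Complex.exp_add, weylPhase]
  ring

/-! ### Pointwise bounds from essential suprema -/

theorem forall_of_ae_of_isOpen_not {p : Cn n → Prop} (hp : IsOpen {x | ¬p x}) (h : ∀ᵐ x, p x) :
    ∀ x, p x := by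
  have h1 : {x | ¬p x} = ∅ := (hp.measure_eq_zero_iff volume).1 (ae_iff.1 h)
  intro x
  by_contra hx
  exact (Set.eq_empty_iff_forall_notMem.1 h1) x hx

theorem ae_norm_le_of_eLpNorm_top_le {F : Type*} [NormedAddCommGroup F] {g : Cn n → F} {b : ℝ}
    (hb : 0 ≤ b) (h : eLpNorm g ∞ volume ≤ ENNReal.ofReal b) : ∀ᵐ x, ‖g x‖ ≤ b := by
  rw [eLpNorm_exponent_top] at h
  filter_upwards [ae_le_eLpNormEssSup (f := g) (μ := volume)] with x hx
  have h1 := hx.trans h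
  rw [← ofReal_norm] at h1
  exact (ENNReal.ofReal_le_ofReal_iff hb).1 h1

theorem norm_le_of_eLpNorm_top_le {F : Type*} [NormedAddCommGroup F] {g : Cn n → F}
    (hg : Continuous g) {b : ℝ} (hb : 0 ≤ b) (h : eLpNorm g ∞ volume ≤ ENNReal.ofReal b) (x : Cn n) :
    ‖g x‖ ≤ b := by
  refine forall_of_ae_of_isOpen_not (p := fun x => ‖g x‖ ≤ b) ?_
    (ae_norm_le_of_eLpNorm_top_le hb h) x
  simp only [not_le]
  exact isOpen_lt continuous_const hg.norm

/-- A Lipschitz map whose derivative is almost everywhere bounded by `b` is `b`-Lipschitz. -/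
theorem norm_sub_apply_le_of_ae_norm_fderiv_le {g : Cn n → Cn n →L[ℝ] ℝ} {L : ℝ≥0}
    (hg : LipschitzWith L g) {b : ℝ} (hb : ∀ᵐ x, ‖fderiv ℝ g x‖ ≤ b) (x v w : Cn n) :
    |g (x + v) w - g x w| ≤ b * ‖v‖ * ‖w‖ := by
  have hgc := hg.continuous
  -- The inequality is closed in x, so almost every x suffices.
  revert x
  refine forall_of_ae_of_isOpen_not ?_ ?_
  · simp only [not_le]
    exact isOpen_lt continuous_const (by fun_prop)
  have hgood : ∀ᵐ x, DifferentiableAt ℝ g x ∧ ‖fderiv ℝ g x‖ ≤ b := hg.ae_differentiableAt.and hb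
  have hmeas : MeasurableSet {x | DifferentiableAt ℝ g x ∧ ‖fderiv ℝ g x‖ ≤ b} :=
    (measurableSet_of_differentiableAt ℝ g).inter
      (measurableSet_le (measurable_fderiv ℝ g).norm measurable_const)
  -- By Rademacher and Fubini, almost every line in the direction v meets the bad set in a null set;
  -- on such a line the fundamental theorem of calculus for Lipschitz functions applies.
  have hline : ∀ᵐ x : Cn n, ∀ᵐ t : ℝ,
      DifferentiableAt ℝ g (x + t • v) ∧ ‖fderiv ℝ g (x + t • v)‖ ≤ b := by
    rw [Measure.ae_ae_comm (p := fun (x : Cn n) (t : ℝ) =>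
      DifferentiableAt ℝ g (x + t • v) ∧ ‖fderiv ℝ g (x + t • v)‖ ≤ b)
      ((by fun_prop : Continuous fun p : Cn n × ℝ => p.1 + p.2 • v).measurable hmeas)]
    exact Filter.Eventually.of_forall fun t =>
      (measurePreserving_add_right volume (t • v)).quasiMeasurePreserving.ae hgood
  filter_upwards [hline] with x hx
  set f : ℝ → ℝ := fun t => g (x + t • v) w with hf
  have hfL : LipschitzWith (L * ‖v‖₊ * ‖w‖₊) f := by
    refine LipschitzWith.of_dist_le_mul fun t r => ?_
    rw [Real.dist_eq, Real.dist_eq]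
    have h1 := hg.dist_le_mul (x + t • v) (x + r • v)
    rw [dist_eq_norm, dist_eq_norm, add_sub_add_left_eq_sub, ← sub_smul, norm_smul,
      Real.norm_eq_abs] at h1
    have h2 := (g (x + t • v) - g (x + r • v)).le_opNorm w
    rw [Real.norm_eq_abs] at h2
    calc |f t - f r| ≤ ‖g (x + t • v) - g (x + r • v)‖ * ‖w‖ := h2
      _ ≤ L * (|t - r| * ‖v‖) * ‖w‖ := by gcongr
      _ = _ := by
        push_cast
        ring
  have hFTC := (hfL.lipschitzOnWith (s := Set.uIcc 0 1)).absolutelyContinuousOnInterval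
    |>.integral_deriv_eq_sub
  have hder : ∀ᵐ t : ℝ, ‖deriv f t‖ ≤ b * ‖v‖ * ‖w‖ := by
    filter_upwards [hx] with t ht
    have h1 : HasDerivAt (fun t : ℝ => x + t • v) v t := by
      simpa using ((hasDerivAt_id t).smul_const v).const_add x
    have h0 : HasDerivAt (fun t : ℝ => g (x + t • v)) (fderiv ℝ g (x + t • v) v) t :=
      HasFDerivAt.comp_hasDerivAt t ht.1.hasFDerivAt h1
    have h2 : HasDerivAt f (fderiv ℝ g (x + t • v) v w) t :=
      (ContinuousLinearMap.apply ℝ ℝ w).hasFDerivAt.comp_hasDerivAt t h0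
    rw [h2.deriv]
    refine (ContinuousLinearMap.le_opNorm _ w).trans ?_
    gcongr
    refine (ContinuousLinearMap.le_opNorm _ v).trans ?_
    gcongr
    exact ht.2
  have h3 := intervalIntegral.norm_integral_le_of_norm_le_const_ae
    (hder.mono fun t ht (_ : t ∈ Set.uIoc (0 : ℝ) 1) => ht)
  rw [hFTC] at h3
  simpa [hf] using h3

theorem abs_sub_sub_fderiv_le {ψ : Cn n → ℝ} (hψ : ContDiff ℝ 1 ψ) {L : ℝ≥0}
    (hL : LipschitzWith L (fderiv ℝ ψ)) {b : ℝ} (hb0 : 0 ≤ b)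
    (hb : ∀ᵐ x, ‖fderiv ℝ (fderiv ℝ ψ) x‖ ≤ b) (x z : Cn n) :
    |ψ z - ψ x - fderiv ℝ ψ x (z - x)| ≤ b * ‖z - x‖ ^ 2 := by
  have hd : Differentiable ℝ ψ := hψ.differentiable one_ne_zero
  set f : Cn n → ℝ := fun y => ψ y - fderiv ℝ ψ x y with hf
  have hfd : ∀ y, HasFDerivAt f (fderiv ℝ ψ y - fderiv ℝ ψ x) y := fun y =>
    (hd y).hasFDerivAt.sub (fderiv ℝ ψ x).hasFDerivAt
  have hbound : ∀ y ∈ Metric.closedBall x ‖z - x‖, ‖fderiv ℝ ψ y - fderiv ℝ ψ x‖ ≤ b * ‖z - x‖ := by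
    intro y hy
    rw [mem_closedBall_iff_norm] at hy
    refine ContinuousLinearMap.opNorm_le_bound _ (by positivity) fun w => ?_
    have := norm_sub_apply_le_of_ae_norm_fderiv_le hL hb x (y - x) w
    rw [add_sub_cancel] at this
    refine this.trans ?_
    gcongr
  have := (convex_closedBall x ‖z - x‖).norm_image_sub_le_of_norm_hasFDerivWithin_le
    (fun y _ => (hfd y).hasFDerivWithinAt) hbound (Metric.mem_closedBall_self (norm_nonneg _))
    (by rw [mem_closedBall_iff_norm] : z ∈ Metric.closedBall x ‖z - x‖)
  rw [Real.norm_eq_abs] at this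
  simp only [hf] at this
  rw [map_sub]
  calc _ = |ψ z - fderiv ℝ ψ x z - (ψ x - fderiv ℝ ψ x x)| := by
        congr 1
        ring
    _ ≤ _ := this
    _ = _ := by ring

theorem abs_sub_le_of_norm_fderiv_le {ψ : Cn n → ℝ} (hψ : ContDiff ℝ 1 ψ) {b : ℝ}
    (hb : ∀ x, ‖fderiv ℝ ψ x‖ ≤ b) (x z : Cn n) : |ψ z - ψ x| ≤ b * ‖x - z‖ := by
  have := convex_univ.norm_image_sub_le_of_norm_fderiv_le (𝕜 := ℝ)
    (fun y _ => hψ.differentiable one_ne_zero y) (fun y _ => hb y) (Set.mem_univ x) (Set.mem_univ z)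
  rwa [Real.norm_eq_abs, norm_sub_rev z x] at this

theorem real_inner_eq_re (x y : Cn n) : inner ℝ x y = (inner ℂ x y : ℂ).re := by
  simp [PiLp.inner_apply, Complex.inner]

/-- Riesz representation for the real inner product Re⟨A·, A·⟩; applied to ψ'(x), it gives the shift
δ. -/
theorem exists_riesz_herm (A : Cn n ≃L[ℂ] Cn n) :
    ∃ D : ℝ, 0 ≤ D ∧ ∀ ℓ : Cn n →L[ℝ] ℝ, ∃ δ : Cn n, ‖δ‖ ≤ D * ‖ℓ‖ ∧
      ∀ v, 2 * (herm A δ v).re = ℓ v := by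
  set T : Cn n →L[ℂ] Cn n := (A.symm : Cn n →L[ℂ] Cn n) with hT
  refine ⟨‖T‖ ^ 2, by positivity, fun ℓ => ?_⟩
  set η := (InnerProductSpace.toDual ℝ (Cn n)).symm (ℓ.comp (T.restrictScalars ℝ)) with hη
  have hη1 : ∀ y, inner ℝ η y = ℓ (T y) := fun y => by
    rw [hη, InnerProductSpace.toDual_symm_apply]
    rfl
  have hη2 : ‖η‖ ≤ ‖ℓ‖ * ‖T‖ := by
    rw [hη, LinearIsometryEquiv.norm_map]
    refine (ContinuousLinearMap.opNorm_comp_le _ _).trans ?_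
    rw [ContinuousLinearMap.norm_restrictScalars]
  refine ⟨T ((1 / 2 : ℝ) • η), ?_, fun v => ?_⟩
  · calc ‖T ((1 / 2 : ℝ) • η)‖ ≤ ‖T‖ * ‖(1 / 2 : ℝ) • η‖ := T.le_opNorm _
      _ ≤ ‖T‖ * (‖ℓ‖ * ‖T‖) := by
          rw [norm_half_smul]
          have := norm_nonneg η
          gcongr
          linarith
      _ = _ := by ring
  · have h1 : A (T ((1 / 2 : ℝ) • η)) = (1 / 2 : ℝ) • η := A.apply_symm_apply _
    rw [herm, h1, ← real_inner_eq_re, real_inner_smul_left, hη1]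
    have h2 : T (A v) = v := A.symm_apply_apply v
    rw [h2]
    ring

/-! ### Weighted `L²` norms -/

theorem eLpNorm_weightMeasure {Φ : Cn n → ℝ} (hΦ : Continuous Φ) {h : ℝ} {u : Cn n → ℂ}
    (hu : Continuous u) :
    eLpNorm u 2 (weightMeasure Φ h) =
      (∫⁻ x, (‖u x‖ₑ * ENNReal.ofReal (Real.exp (-(Φ x / h)))) ^ 2) ^ (1 / 2 : ℝ) := by
  rw [eLpNorm_eq_lintegral_rpow_enorm_toReal two_ne_zero ENNReal.ofNat_ne_top, weightMeasure,
    lintegral_withDensity_eq_lintegral_mul _ (by fun_prop) (by fun_prop)]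
  simp only [ENNReal.toReal_ofNat, Pi.mul_apply]
  congr 1
  refine lintegral_congr fun x => ?_
  rw [ENNReal.rpow_two, mul_pow, ← ENNReal.ofReal_pow (Real.exp_pos _).le, ← Real.exp_nat_mul,
    mul_comm]
  congr 3
  push_cast
  ring

theorem memLp_weightMeasure_iff {Φ : Cn n → ℝ} (hΦ : Continuous Φ) {h : ℝ} {u : Cn n → ℂ}
    (hu : Continuous u) : MemLp u 2 (weightMeasure Φ h) ↔
      Integrable fun x => (‖u x‖ * Real.exp (-(Φ x / h))) ^ 2 := by
  have hc : Continuous fun x => (‖u x‖ * Real.exp (-(Φ x / h))) ^ 2 := by fun_prop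
  have h1 : ∀ x, ‖(‖u x‖ * Real.exp (-(Φ x / h))) ^ 2‖ₑ =
      (‖u x‖ₑ * ENNReal.ofReal (Real.exp (-(Φ x / h)))) ^ 2 := by
    intro x
    rw [Real.enorm_of_nonneg (by positivity), ENNReal.ofReal_pow (by positivity),
      ENNReal.ofReal_mul (norm_nonneg _), ofReal_norm]
  rw [MemLp, and_iff_right hu.aestronglyMeasurable, eLpNorm_weightMeasure hΦ hu, Integrable,
    and_iff_right hc.aestronglyMeasurable, hasFiniteIntegral_iff_enorm]
  simp only [h1]
  rw [ENNReal.rpow_lt_top_iff_of_pos (by norm_num)]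

/-- The convolution kernel dominating the conjugated operator. -/
def decayKernel (c p h : ℝ) (y : Cn n) : ℝ :=
  Real.exp (-(c * (‖y‖ ^ 2 / h))) + Real.exp (-(c * (‖y‖ / h) ^ p))

/-- The Gaussian lives at scale √h and the stretched exponential at scale h, so their masses are of
order h^n and h^{2n} ≤ h^n. -/
theorem exists_integral_decayKernel_le (n : ℕ) {c p : ℝ} (hc : 0 < c) (hp : 0 < p) :
    ∃ I : ℝ, 0 ≤ I ∧ ∀ h : ℝ, 0 < h → h ≤ 1 →
      Integrable (decayKernel (n := n) c p h) ∧ ∫ y, decayKernel (n := n) c p h y ≤ h ^ n * I := by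
  set I₁ := ∫ x : Cn n, Real.exp (-(c * ‖x‖ ^ 2))
  set I₂ := ∫ x : Cn n, Real.exp (-(c * ‖x‖ ^ p))
  have hI₁ : 0 ≤ I₁ := integral_nonneg fun x => (Real.exp_pos _).le
  have hI₂ : 0 ≤ I₂ := integral_nonneg fun x => (Real.exp_pos _).le
  refine ⟨I₁ + I₂, by positivity, fun h hh hh1 => ?_⟩
  have e1 : ∀ y : Cn n, Real.exp (-(c * (‖y‖ ^ 2 / h))) =
      Real.exp (-(c * ‖(Real.sqrt h)⁻¹ • y‖ ^ 2)) := by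
    intro y
    rw [norm_smul, mul_pow, norm_inv, Real.norm_eq_abs, inv_pow, sq_abs, Real.sq_sqrt hh.le]
    ring_nf
  have e2 : ∀ y : Cn n, Real.exp (-(c * (‖y‖ / h) ^ p)) = Real.exp (-(c * ‖h⁻¹ • y‖ ^ p)) := by
    intro y
    rw [norm_smul, norm_inv, Real.norm_of_nonneg hh.le, div_eq_inv_mul]
  have i1 : Integrable fun y : Cn n => Real.exp (-(c * (‖y‖ ^ 2 / h))) := by
    simp only [e1]
    exact (integrable_exp_neg_mul_sq hc).comp_smul (inv_ne_zero (Real.sqrt_pos.2 hh).ne')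
  have i2 : Integrable fun y : Cn n => Real.exp (-(c * (‖y‖ / h) ^ p)) := by
    simp only [e2]
    exact (integrable_exp_neg_mul_rpow hc hp).comp_smul (inv_ne_zero hh.ne')
  refine ⟨i1.add i2, ?_⟩
  have h1 : ∫ y : Cn n, Real.exp (-(c * (‖y‖ ^ 2 / h))) = h ^ n * I₁ := by
    simp only [e1]
    rw [integral_comp_inv_smul (fun x : Cn n => Real.exp (-(c * ‖x‖ ^ 2))) (Real.sqrt_pos.2 hh),
      Real.sq_sqrt hh.le, smul_eq_mul]
  have h2 : ∫ y : Cn n, Real.exp (-(c * (‖y‖ / h) ^ p)) = (h ^ 2) ^ n * I₂ := by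
    simp only [e2]
    rw [integral_comp_inv_smul (fun x : Cn n => Real.exp (-(c * ‖x‖ ^ p))) hh, smul_eq_mul]
  have h3 : (h ^ 2) ^ n ≤ h ^ n := by
    refine pow_le_pow_left₀ (by positivity) ?_ n
    nlinarith
  unfold decayKernel
  rw [integral_add i1 i2, h1, h2, mul_add]
  gcongr

theorem eLpNorm_weightMeasure_le_of_convolution {Φ : Cn n → ℝ} (hΦ : Continuous Φ) {h : ℝ}
    {u w : Cn n → ℂ} (hu : Continuous u) (hw : Continuous w) {k : Cn n → ℝ} (hk : Continuous k)
    (hk0 : ∀ y, 0 ≤ k y) (hki : Integrable k) {M : ℝ} (hM : ∫ y, k y ≤ M)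
    (hle : ∀ x, ‖w x‖ₑ * ENNReal.ofReal (Real.exp (-(Φ x / h))) ≤
      ∫⁻ z, ENNReal.ofReal (k (x - z)) * (‖u z‖ₑ * ENNReal.ofReal (Real.exp (-(Φ z / h))))) :
    eLpNorm w 2 (weightMeasure Φ h) ≤ ENNReal.ofReal M * eLpNorm u 2 (weightMeasure Φ h) := by
  rw [eLpNorm_weightMeasure hΦ hw, eLpNorm_weightMeasure hΦ hu]
  have h1 := lintegral_convolution_sq_le (fun y => ENNReal.ofReal (k y))
    (fun z => ‖u z‖ₑ * ENNReal.ofReal (Real.exp (-(Φ z / h)))) (by fun_prop) (by fun_prop)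
  rw [← ofReal_integral_eq_lintegral_ofReal hki (Filter.Eventually.of_forall hk0)] at h1
  set V := ∫⁻ z, (‖u z‖ₑ * ENNReal.ofReal (Real.exp (-(Φ z / h)))) ^ 2
  calc (∫⁻ x, (‖w x‖ₑ * ENNReal.ofReal (Real.exp (-(Φ x / h)))) ^ 2) ^ (1 / 2 : ℝ)
      ≤ (ENNReal.ofReal M ^ 2 * V) ^ (1 / 2 : ℝ) := by
        refine ENNReal.rpow_le_rpow ?_ (by norm_num)
        calc _ ≤ _ := lintegral_mono fun x => pow_le_pow_left' (hle x) 2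
          _ ≤ _ := h1
          _ ≤ _ := by gcongr
    _ = _ := by
        rw [ENNReal.mul_rpow_of_nonneg _ _ (by norm_num), ← ENNReal.rpow_natCast,
          ← ENNReal.rpow_mul]
        norm_num

/-! ### Functions in the weighted spaces -/

/-- Removing the pluriharmonic part of the weight. -/
def untwist (Φ : QuadraticForm ℝ (Cn n)) (h : ℝ) (u : Cn n → ℂ) (z : Cn n) : ℂ :=
  Complex.exp (-(holForm Φ z z / h)) * u z

theorem differentiable_untwist (Φ : QuadraticForm ℝ (Cn n)) (h : ℝ) {u : Cn n → ℂ}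
    (hu : Differentiable ℂ u) : Differentiable ℂ (untwist Φ h u) := by
  have h1 := differentiable_holForm_self Φ
  have h2 : Differentiable ℂ fun z => -(holForm Φ z z / (h : ℂ)) := by
    simpa only [div_eq_mul_inv] using (h1.mul_const ((h : ℂ)⁻¹)).fun_neg
  exact h2.cexp.mul hu

theorem norm_untwist (Φ : QuadraticForm ℝ (Cn n)) (h : ℝ) (u : Cn n → ℂ) (z : Cn n) :
    ‖untwist Φ h u z‖ = Real.exp (-((holForm Φ z z).re / h)) * ‖u z‖ := by
  rw [untwist, norm_mul, Complex.norm_exp, Complex.neg_re, Complex.div_ofReal_re]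

theorem norm_untwist_mul_exp {Φ : QuadraticForm ℝ (Cn n)} {A : Cn n ≃L[ℂ] Cn n}
    (hA : ∀ x, Φ x = ‖A x‖ ^ 2 + (holForm Φ x x).re) (h : ℝ) (u : Cn n → ℂ) (z : Cn n) :
    ‖untwist Φ h u z‖ * Real.exp (-(‖A z‖ ^ 2 / h)) = ‖u z‖ * Real.exp (-(Φ z / h)) := by
  rw [norm_untwist, mul_right_comm, ← Real.exp_add, mul_comm, hA z]
  congr 2
  ring

/-- A bounded perturbation changes the weight by a factor that is finite at fixed h, so u is square
integrable for Φ as well, and square integrable holomorphic functions are pointwise bounded by the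
weight. -/
theorem exists_untwist_bound {Φ : QuadraticForm ℝ (Cn n)} {A : Cn n ≃L[ℂ] Cn n}
    (hA : ∀ x, Φ x = ‖A x‖ ^ 2 + (holForm Φ x x).re) {h : ℝ} (hh : 0 < h) {Φ₁ : Cn n → ℝ}
    (hΦ₁ : Continuous Φ₁) {b : ℝ} (hb : ∀ x, |Φ₁ x - Φ x| ≤ b) {u : Cn n → ℂ} (hu : u ∈ HSpace Φ₁ h) :
    ∃ B : ℝ, ∀ z, ‖untwist Φ h u z‖ * Real.exp (-(‖A z‖ ^ 2 / h)) ≤ B := by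
  refine bounded_of_integrable_sq A hh (differentiable_untwist Φ h hu.1) ?_
  have h1 := (memLp_weightMeasure_iff hΦ₁ hu.1.continuous).1 hu.2
  refine (h1.const_mul (Real.exp (b / h) ^ 2)).mono' ?_ (Filter.Eventually.of_forall fun z => ?_)
  · have := (differentiable_untwist Φ h hu.1).continuous
    exact (by fun_prop : Continuous fun z =>
      (‖untwist Φ h u z‖ * Real.exp (-(‖A z‖ ^ 2 / h))) ^ 2).aestronglyMeasurable
  · rw [norm_untwist_mul_exp hA, Real.norm_of_nonneg (by positivity), ← mul_pow]
    have h2 : Real.exp (-(Φ z / h)) ≤ Real.exp (b / h) * Real.exp (-(Φ₁ z / h)) := by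
      rw [← Real.exp_add, Real.exp_le_exp, ← neg_div, ← neg_div, ← add_div]
      refine div_le_div_of_nonneg_right ?_ hh.le
      linarith [(abs_le.1 (hb z)).2]
    calc (‖u z‖ * Real.exp (-(Φ z / h))) ^ 2
        ≤ (‖u z‖ * (Real.exp (b / h) * Real.exp (-(Φ₁ z / h)))) ^ 2 := by gcongr
      _ = _ := by ring

/-- The orders N = 0 and N = 2n + 1 give the bound and the integrability respectively, 2n being the
real dimension. -/
theorem weylDomain_bounds {Φ : Cn n → ℝ} (hΦ : Continuous Φ) {h : ℝ} {u : Cn n → ℂ}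
    (hu : u ∈ weylDomain Φ h) :
    (∃ B : ℝ, ∀ z, ‖u z‖ * Real.exp (-(Φ z / h)) ≤ B) ∧
      Integrable fun z => ‖u z‖ * Real.exp (-(Φ z / h)) := by
  have h1 : ∀ N : ℕ, ∃ B : ℝ, ∀ z,
      ‖u z‖ * Real.exp (-(Φ z / h)) ≤ B * (Real.sqrt (1 + ‖z‖ ^ 2))⁻¹ ^ N := by
    intro N
    obtain ⟨B, hB⟩ := hu.2 N
    refine ⟨B, fun z => ?_⟩
    rw [Real.exp_neg, ← div_eq_mul_inv, div_le_iff₀ (Real.exp_pos _)]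
    exact hB z
  refine ⟨?_, ?_⟩
  · obtain ⟨B, hB⟩ := h1 0
    exact ⟨B, fun z => by simpa using hB z⟩
  · obtain ⟨B, hB⟩ := h1 (2 * n + 1)
    have hB0 : 0 ≤ B := by
      have h2 := (mul_nonneg (norm_nonneg _) (Real.exp_pos _).le).trans (hB 0)
      simpa using h2
    refine (integrable_inv_one_add_norm_pow.const_mul (B * 2 ^ (2 * n + 1))).mono' ?_
      (Filter.Eventually.of_forall fun z => ?_)
    · have := hu.1.continuous
      exact (by fun_prop : Continuous fun z =>
        ‖u z‖ * Real.exp (-(Φ z / h))).aestronglyMeasurable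
    · rw [Real.norm_of_nonneg (by positivity)]
      refine (hB z).trans ?_
      have h3 : (Real.sqrt (1 + ‖z‖ ^ 2))⁻¹ ≤ 2 * (1 + ‖z‖)⁻¹ := by
        rw [← div_eq_mul_inv, inv_le_comm₀ (by positivity) (by positivity), inv_div]
        refine Real.le_sqrt_of_sq_le ?_
        nlinarith [sq_nonneg (‖z‖ - 1), norm_nonneg z]
      calc B * (Real.sqrt (1 + ‖z‖ ^ 2))⁻¹ ^ (2 * n + 1)
          ≤ B * (2 * (1 + ‖z‖)⁻¹) ^ (2 * n + 1) := by gcongr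
        _ = _ := by
          rw [mul_pow, inv_pow]
          ring

theorem mem_HSpace_of_mem_weylDomain {Φ : Cn n → ℝ} (hΦ : Continuous Φ) {h : ℝ} (hh : 0 < h)
    {Φ₁ : Cn n → ℝ} (hΦ₁ : Continuous Φ₁) {b : ℝ} (hb : ∀ x, |Φ₁ x - Φ x| ≤ b) {u : Cn n → ℂ}
    (hu : u ∈ weylDomain Φ h) : u ∈ HSpace Φ₁ h := by
  refine ⟨hu.1, (memLp_weightMeasure_iff hΦ₁ hu.1.continuous).2 ?_⟩
  obtain ⟨⟨B, hB⟩, hint⟩ := weylDomain_bounds hΦ hu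
  refine (hint.const_mul (Real.exp (b / h) ^ 2 * B)).mono' ?_
    (Filter.Eventually.of_forall fun z => ?_)
  · have := hu.1.continuous
    exact (by fun_prop : Continuous fun z =>
      (‖u z‖ * Real.exp (-(Φ₁ z / h))) ^ 2).aestronglyMeasurable
  · have h2 : Real.exp (-(Φ₁ z / h)) ≤ Real.exp (b / h) * Real.exp (-(Φ z / h)) := by
      rw [← Real.exp_add, Real.exp_le_exp, ← neg_div, ← neg_div, ← add_div]
      refine div_le_div_of_nonneg_right ?_ hh.le
      linarith [(abs_le.1 (hb z)).1]
    rw [Real.norm_of_nonneg (by positivity)]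
    set F := ‖u z‖ * Real.exp (-(Φ z / h)) with hF
    have hF0 : 0 ≤ F := by positivity
    calc (‖u z‖ * Real.exp (-(Φ₁ z / h))) ^ 2
        ≤ (‖u z‖ * (Real.exp (b / h) * Real.exp (-(Φ z / h)))) ^ 2 := by gcongr
      _ = Real.exp (b / h) ^ 2 * (F * F) := by
          rw [hF]
          ring
      _ ≤ Real.exp (b / h) ^ 2 * (B * F) := by
          gcongr
          exact hB z
      _ = _ := by ring

/-! ### Perturbed weights -/

theorem contDiff_quadraticForm (Φ : QuadraticForm ℝ (Cn n)) : ContDiff ℝ 1 fun x => Φ x := by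
  rw [contDiff_one_iff_fderiv]
  have h : (fderiv ℝ fun x => Φ x) = polarCLM Φ :=
    funext fun x => (hasFDerivAt_quadraticForm Φ x).fderiv
  rw [h]
  exact ⟨fun x => (hasFDerivAt_quadraticForm Φ x).differentiableAt, (polarCLM Φ).continuous⟩

/-- Continuity promotes the essential bounds of orders 0 and 1 to every point. The order 2 bound
holds only almost everywhere, and suffices because the gradient is Lipschitz. -/
theorem perturbation_bounds (Φ : QuadraticForm ℝ (Cn n)) {Φ₁ : Cn n → ℝ} (hΦ₁ : IsC11 Φ₁) {b : ℝ}
    (hb : 0 ≤ b) (hle : ∀ k : ℕ, k ≤ 2 →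
      eLpNorm (iteratedFDeriv ℝ k fun x => Φ₁ x - Φ x) ∞ volume ≤ ENNReal.ofReal b) :
    (∀ x, |Φ₁ x - Φ x| ≤ b) ∧ (∀ x, ‖fderiv ℝ (fun x => Φ₁ x - Φ x) x‖ ≤ b) ∧
    (∀ x z, |(Φ₁ z - Φ z) - (Φ₁ x - Φ x)| ≤ b * ‖x - z‖) ∧
    ∀ x z, |(Φ₁ z - Φ z) - (Φ₁ x - Φ x) - fderiv ℝ (fun x => Φ₁ x - Φ x) x (z - x)| ≤
      b * ‖z - x‖ ^ 2 := by
  set ψ : Cn n → ℝ := fun x => Φ₁ x - Φ x with hψdef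
  have hψ : ContDiff ℝ 1 ψ := hΦ₁.1.sub (contDiff_quadraticForm Φ)
  obtain ⟨L, hL⟩ := hΦ₁.2
  have hfd : fderiv ℝ ψ = fun x => fderiv ℝ Φ₁ x - polarCLM Φ x := funext fun x =>
    ((hΦ₁.1.differentiable one_ne_zero x).hasFDerivAt.sub (hasFDerivAt_quadraticForm Φ x)).fderiv
  have hψL : LipschitzWith (L + ‖polarCLM Φ‖₊) (fderiv ℝ ψ) := by
    rw [hfd]
    exact hL.sub (polarCLM Φ).lipschitz
  have h0 : ∀ x, |ψ x| ≤ b := by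
    intro x
    have := norm_le_of_eLpNorm_top_le (hψ.continuous_iteratedFDeriv (m := 0) (by simp)) hb
      (hle 0 (by norm_num)) x
    rwa [norm_iteratedFDeriv_zero, Real.norm_eq_abs] at this
  have h1 : ∀ x, ‖fderiv ℝ ψ x‖ ≤ b := by
    intro x
    have := norm_le_of_eLpNorm_top_le (hψ.continuous_iteratedFDeriv (m := 1) (by simp)) hb
      (hle 1 (by norm_num)) x
    rwa [norm_iteratedFDeriv_one] at this
  have h2 : ∀ᵐ x, ‖fderiv ℝ (fderiv ℝ ψ) x‖ ≤ b := by
    filter_upwards [ae_norm_le_of_eLpNorm_top_le hb (hle 2 le_rfl)] with x hx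
    rwa [show (2 : ℕ) = 1 + 1 from rfl, ← norm_iteratedFDeriv_fderiv, norm_iteratedFDeriv_one] at hx
  exact ⟨h0, h1, abs_sub_le_of_norm_fderiv_le hψ h1, abs_sub_sub_fderiv_le hψ hψL hb h2⟩

/-! ### The extension of the Weyl quantization -/

/-- The operator with Wick kernel `wick A h a`, acting on functions of exponential type `Φ`. -/
def twistedWickOp (Φ : QuadraticForm ℝ (Cn n)) (A : Cn n ≃L[ℂ] Cn n) (h : ℝ) (a : Cn n → ℂ) (κ : ℂ)
    (u : Cn n → ℂ) (x : Cn n) : ℂ :=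
  κ * Complex.exp (holForm Φ x x / h) * wickOp A h a 0 (untwist Φ h u) x

theorem differentiable_twistedWickOp {Φ : QuadraticForm ℝ (Cn n)} {A : Cn n ≃L[ℂ] Cn n}
    {s A₀ C : ℝ} (hs : 1 < s) (hC : 0 ≤ C) {a : Cn n → ℂ} (ha : GevreyBound s A₀ C a) {h : ℝ}
    (hh : 0 < h) (κ : ℂ) {u : Cn n → ℂ} (hu : Differentiable ℂ u) {B : ℝ}
    (hB : ∀ z, ‖untwist Φ h u z‖ * Real.exp (-(‖A z‖ ^ 2 / h)) ≤ B) :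
    Differentiable ℂ (twistedWickOp Φ A h a κ u) := by
  have h1 : Differentiable ℂ fun z => holForm Φ z z / (h : ℂ) := by
    simpa only [div_eq_mul_inv] using (differentiable_holForm_self Φ).mul_const ((h : ℂ)⁻¹)
  exact (h1.cexp.const_mul κ).mul (differentiable_wickOp A hs hC ha hh 0
    (differentiable_untwist Φ h hu).continuous hB)

theorem twistedWickOp_add {Φ : QuadraticForm ℝ (Cn n)} {A : Cn n ≃L[ℂ] Cn n}
    {s A₀ C : ℝ} (hs : 1 < s) (hC : 0 ≤ C) {a : Cn n → ℂ} (ha : GevreyBound s A₀ C a) {h : ℝ}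
    (hh : 0 < h) (κ : ℂ) {u v : Cn n → ℂ} (hu : Differentiable ℂ u) (hv : Differentiable ℂ v)
    {B B' : ℝ} (hB : ∀ z, ‖untwist Φ h u z‖ * Real.exp (-(‖A z‖ ^ 2 / h)) ≤ B)
    (hB' : ∀ z, ‖untwist Φ h v z‖ * Real.exp (-(‖A z‖ ^ 2 / h)) ≤ B') :
    twistedWickOp Φ A h a κ (u + v) = twistedWickOp Φ A h a κ u + twistedWickOp Φ A h a κ v := by
  funext x
  have h1 := integrable_wickOp_integrand A hs hC ha hh 0 x
    (differentiable_untwist Φ h hu).continuous hB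
  have h2 := integrable_wickOp_integrand A hs hC ha hh 0 x
    (differentiable_untwist Φ h hv).continuous hB'
  rw [Pi.add_apply, twistedWickOp, twistedWickOp, twistedWickOp, ← mul_add, wickOp, wickOp, wickOp,
    ← integral_add h1 h2]
  congr 1
  refine integral_congr_ae (Filter.Eventually.of_forall fun z => ?_)
  simp only [untwist, Pi.add_apply]
  ring

theorem twistedWickOp_smul (Φ : QuadraticForm ℝ (Cn n)) (A : Cn n ≃L[ℂ] Cn n) (h : ℝ) (a : Cn n → ℂ)
    (κ c : ℂ) (u : Cn n → ℂ) :
    twistedWickOp Φ A h a κ (c • u) = c • twistedWickOp Φ A h a κ u := by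
  funext x
  have h1 : wickOp A h a 0 (untwist Φ h (c • u)) x = c * wickOp A h a 0 (untwist Φ h u) x := by
    rw [wickOp, wickOp, ← integral_const_mul]
    refine integral_congr_ae (Filter.Eventually.of_forall fun z => ?_)
    simp only [untwist, Pi.smul_apply, smul_eq_mul]
    ring
  rw [Pi.smul_apply, smul_eq_mul, twistedWickOp, twistedWickOp, h1]
  ring

/-- The pointwise domination by a convolution, given a bound on the kernel for every pair of points
after a shift of the antiholomorphic variable depending on `x` only. -/
theorem enorm_twistedWickOp_le {Φ : QuadraticForm ℝ (Cn n)} {A : Cn n ≃L[ℂ] Cn n}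
    (hA : ∀ x, Φ x = ‖A x‖ ^ 2 + (holForm Φ x x).re)
    {s A₀ C : ℝ} (hs : 1 < s) (hC : 0 ≤ C) {a : Cn n → ℂ} (ha : GevreyBound s A₀ C a) {h : ℝ}
    (hh : 0 < h) (κ : ℂ) {Φ₁ : Cn n → ℝ} {u : Cn n → ℂ} (hu : Differentiable ℂ u) {B : ℝ}
    (hB : ∀ z, ‖untwist Φ h u z‖ * Real.exp (-(‖A z‖ ^ 2 / h)) ≤ B) (δ x : Cn n) {G : ℝ}
    {k : Cn n → ℝ}
    (hk : ∀ z, ‖shiftKernel A h δ x z‖ * ‖wick A h a x (z + δ)‖ *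
      Real.exp ((‖A z‖ ^ 2 + (Φ₁ z - Φ z)) / h) ≤
        G * (Real.exp ((‖A x‖ ^ 2 + (Φ₁ x - Φ x)) / h) * k (x - z))) :
    ‖twistedWickOp Φ A h a κ u x‖ₑ * ENNReal.ofReal (Real.exp (-(Φ₁ x / h))) ≤
      ∫⁻ z, ENNReal.ofReal (‖κ‖ * G * k (x - z)) *
        (‖u z‖ₑ * ENNReal.ofReal (Real.exp (-(Φ₁ z / h)))) := by
  have hδ := wickOp_eq_wickOp_zero A hs hC ha hh δ x (differentiable_untwist Φ h hu) hB
  have hpre : ‖κ * Complex.exp (holForm Φ x x / h)‖ * Real.exp (-(Φ₁ x / h)) =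
      ‖κ‖ * Real.exp (-((‖A x‖ ^ 2 + (Φ₁ x - Φ x)) / h)) := by
    rw [norm_mul, Complex.norm_exp, Complex.div_ofReal_re, mul_assoc, ← Real.exp_add, hA x]
    congr 2
    ring
  have hun : ∀ z, ‖untwist Φ h u z‖ =
      Real.exp ((‖A z‖ ^ 2 + (Φ₁ z - Φ z)) / h) * (‖u z‖ * Real.exp (-(Φ₁ z / h))) := by
    intro z
    rw [norm_untwist, mul_left_comm, ← Real.exp_add, mul_comm, hA z]
    congr 2
    ring
  have hpt : ∀ z, ‖κ * Complex.exp (holForm Φ x x / h)‖ * Real.exp (-(Φ₁ x / h)) *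
      ‖shiftKernel A h δ x z * wick A h a x (z + δ) * untwist Φ h u z‖ ≤
        ‖κ‖ * G * k (x - z) * (‖u z‖ * Real.exp (-(Φ₁ z / h))) := by
    intro z
    rw [hpre, norm_mul, norm_mul, hun z]
    have e1 : Real.exp (-((‖A x‖ ^ 2 + (Φ₁ x - Φ x)) / h)) *
        Real.exp ((‖A x‖ ^ 2 + (Φ₁ x - Φ x)) / h) = 1 := by
      rw [← Real.exp_add, neg_add_cancel, Real.exp_zero]
    calc ‖κ‖ * Real.exp (-((‖A x‖ ^ 2 + (Φ₁ x - Φ x)) / h)) *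
          (‖shiftKernel A h δ x z‖ * ‖wick A h a x (z + δ)‖ *
            (Real.exp ((‖A z‖ ^ 2 + (Φ₁ z - Φ z)) / h) * (‖u z‖ * Real.exp (-(Φ₁ z / h)))))
        = ‖κ‖ * Real.exp (-((‖A x‖ ^ 2 + (Φ₁ x - Φ x)) / h)) * (‖u z‖ * Real.exp (-(Φ₁ z / h))) *
          (‖shiftKernel A h δ x z‖ * ‖wick A h a x (z + δ)‖ *
            Real.exp ((‖A z‖ ^ 2 + (Φ₁ z - Φ z)) / h)) := by ring
      _ ≤ ‖κ‖ * Real.exp (-((‖A x‖ ^ 2 + (Φ₁ x - Φ x)) / h)) * (‖u z‖ * Real.exp (-(Φ₁ z / h))) *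
          (G * (Real.exp ((‖A x‖ ^ 2 + (Φ₁ x - Φ x)) / h) * k (x - z))) :=
        mul_le_mul_of_nonneg_left (hk z) (by positivity)
      _ = ‖κ‖ * G * k (x - z) * (‖u z‖ * Real.exp (-(Φ₁ z / h))) *
          (Real.exp (-((‖A x‖ ^ 2 + (Φ₁ x - Φ x)) / h)) *
            Real.exp ((‖A x‖ ^ 2 + (Φ₁ x - Φ x)) / h)) := by ring
      _ = _ := by rw [e1, mul_one]
  rw [twistedWickOp, ← hδ, wickOp, enorm_mul, mul_right_comm]
  calc _ ≤ ‖κ * Complex.exp (holForm Φ x x / h)‖ₑ * ENNReal.ofReal (Real.exp (-(Φ₁ x / h))) *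
        ∫⁻ z, ‖shiftKernel A h δ x z * wick A h a x (z + δ) * untwist Φ h u z‖ₑ := by
        gcongr
        exact enorm_integral_le_lintegral_enorm _
    _ = ∫⁻ z, ‖κ * Complex.exp (holForm Φ x x / h)‖ₑ * ENNReal.ofReal (Real.exp (-(Φ₁ x / h))) *
        ‖shiftKernel A h δ x z * wick A h a x (z + δ) * untwist Φ h u z‖ₑ :=
        (lintegral_const_mul' _ _ (by finiteness)).symm
    _ ≤ _ := by
        refine lintegral_mono fun z => ?_
        have h1 := ENNReal.ofReal_le_ofReal (hpt z)
        rwa [ENNReal.ofReal_mul (by positivity), ENNReal.ofReal_mul (norm_nonneg _), ofReal_norm,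
          ofReal_norm, ENNReal.ofReal_mul' (by positivity), ENNReal.ofReal_mul (norm_nonneg _),
          ofReal_norm] at h1

theorem continuous_decayKernel (c : ℝ) {p : ℝ} (hp : 0 < p) (h : ℝ) :
    Continuous (decayKernel (n := n) c p h) := by
  unfold decayKernel
  have h1 : Continuous fun y : Cn n => (‖y‖ / h) ^ p :=
    (continuous_norm.div_const h).rpow_const fun _ => Or.inr hp.le
  fun_prop

/-- Boundedness on `H_{Φ₁}`, uniformly in `h` and `Φ₁`. -/
theorem exists_eLpNorm_twistedWickOp_le (Φ : QuadraticForm ℝ (Cn n)) {A : Cn n ≃L[ℂ] Cn n}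
    (hA : ∀ x, Φ x = ‖A x‖ ^ 2 + (holForm Φ x x).re) {s C : ℝ} (hs : 1 < s) (hC : 0 ≤ C) :
    ∃ ε I : ℝ, 0 < ε ∧ 0 ≤ I ∧ ∀ (A₀ : ℝ) (a : Cn n → ℂ), GevreyBound s A₀ C a →
      ∀ h : ℝ, 0 < h → h ≤ 1 → ∀ Φ₁ : Cn n → ℝ, IsC11 Φ₁ →
      (∀ k : ℕ, k ≤ 2 → eLpNorm (iteratedFDeriv ℝ k fun x => Φ₁ x - Φ x) ∞ volume ≤
        ENNReal.ofReal (ε * h ^ (1 - 1 / s))) →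
      ∀ κ : ℂ, ∀ u ∈ HSpace Φ₁ h,
        eLpNorm (twistedWickOp Φ A h a κ u) 2 (weightMeasure Φ₁ h) ≤
          ENNReal.ofReal (‖κ‖ * (A₀ * gaussMass A (4 / h) * 7) * (h ^ n * I)) *
            eLpNorm u 2 (weightMeasure Φ₁ h) := by
  obtain ⟨D, hD, hriesz⟩ := exists_riesz_herm A
  obtain ⟨ε, c, hε, hc, hker⟩ := exists_kernel_bound A hs hC hD
  have hp : 0 < 1 / s := by positivity
  obtain ⟨I, hI, hint⟩ := exists_integral_decayKernel_le n hc hp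
  refine ⟨ε, I, hε, hI, fun A₀ a ha h hh hh1 Φ₁ hΦ₁ hle κ u hu => ?_⟩
  have hb : 0 ≤ ε * h ^ (1 - 1 / s) := by positivity
  obtain ⟨p0, p1, p2, p3⟩ := perturbation_bounds Φ hΦ₁ hb hle
  have hΦ₁c := hΦ₁.1.continuous
  obtain ⟨B, hB⟩ := exists_untwist_bound hA hh hΦ₁c p0 hu
  have hA₀ : 0 ≤ A₀ := (norm_nonneg _).trans (ha.norm_le 0)
  have hG := gaussMass_pos A (show 0 < 4 / h by positivity)
  obtain ⟨hi, hI'⟩ := hint h hh hh1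
  refine eLpNorm_weightMeasure_le_of_convolution hΦ₁c hu.1.continuous
    (differentiable_twistedWickOp hs hC ha hh κ hu.1 hB).continuous
    (k := fun y => ‖κ‖ * (A₀ * gaussMass A (4 / h) * 7) * decayKernel c (1 / s) h y)
    ((continuous_decayKernel c hp h).const_mul _) (fun y => ?_) (hi.const_mul _) ?_ fun x => ?_
  · unfold decayKernel
    positivity
  · rw [integral_const_mul]
    exact mul_le_mul_of_nonneg_left hI' (by positivity)
  -- The shift is chosen anew for each x, from the gradient of the perturbation at x.
  · obtain ⟨δ, hδ, hδv⟩ := hriesz (fderiv ℝ (fun x => Φ₁ x - Φ x) x)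
    refine enorm_twistedWickOp_le hA hs hC ha hh κ hu.1 hB δ x fun z => ?_
    refine (hker A₀ a ha h hh hh1 (fun x => Φ₁ x - Φ x) x z δ ?_ (p2 x z) ?_
      (hδ.trans (by gcongr; exact p1 x))).trans_eq ?_
    · rw [two_mul]
      exact (abs_sub _ _).trans (add_le_add (p0 z) (p0 x))
    · rw [hδv, ← neg_sub z x, map_neg, ← sub_eq_add_neg, norm_neg]
      exact p3 x z
    · unfold decayKernel
      ring

/-- On the initial domain the Weyl quantization is given by an absolutely convergent integral and
agrees with the operator with Wick kernel. -/
theorem weylOp_eq_twistedWickOp {Φ : QuadraticForm ℝ (Cn n)} {A : Cn n ≃L[ℂ] Cn n}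
    (hA : ∀ x, Φ x = ‖A x‖ ^ 2 + (holForm Φ x x).re)
    (hA' : ∀ m w : Cn n, ∑ k, w k * dzCLM Φ k m = herm A m w + holForm Φ m w) {D : ℂ}
    (hD : ∀ x y, contourDensity (contour (fun x => Φ x) x) y = D) {s A₀ C : ℝ}
    {a : Lam (fun x => Φ x) → ℂ} (ha : GevreySymbol (fun x => Φ x) s A₀ C a) {h : ℝ} (hh : 0 < h)
    {u : Cn n → ℂ} (hu : u ∈ weylDomain (fun x => Φ x) h) (x : Cn n) :
    Integrable (weylIntegrand (fun x => Φ x) h a u x) ∧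
      weylOp (fun x => Φ x) h a u x =
        twistedWickOp Φ A h (fun m => a (lamPoint (fun x => Φ x) m))
          (1 / ((2 * Real.pi * h : ℝ) : ℂ) ^ n * D * (4 ^ n / gaussMass A (2 / h))) u x := by
  obtain ⟨⟨B, hB⟩, hint⟩ := weylDomain_bounds (continuous_quadraticForm Φ) hu
  simp only [← norm_untwist_mul_exp hA] at hB hint
  have hv := differentiable_untwist Φ h hu.1
  set v := untwist Φ h u with hvdef
  set b : Cn n → ℂ := fun m => a (lamPoint (fun x => Φ x) m) with hbdef
  have hb : GevreyBound s A₀ C b := ha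
  have hbc : Continuous b := hb.1.continuous
  have heq : weylIntegrand (fun x => Φ x) h a u x = fun y =>
      D * Complex.exp (holForm Φ x x / h) * (weylPhase A h x y * b ((1 / 2 : ℝ) • (x + y)) * v y) :=
    funext fun y => weylIntegrand_eq hA' hD h a u x y
  refine ⟨?_, ?_⟩
  · rw [heq]
    refine Integrable.const_mul ?_ _
    refine (hint.const_mul (Real.exp (‖A x‖ ^ 2 / h) * A₀)).mono' ?_
      (Filter.Eventually.of_forall fun y => ?_)
    · have h1 : Continuous fun y => weylPhase A h x y := by
        have h2 := continuous_herm A (continuous_const (y := x)) (continuous_id (X := Cn n))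
        have h3 := continuous_herm A (continuous_id (X := Cn n)) (continuous_const (y := x))
        have h4 := continuous_herm A (continuous_id (X := Cn n)) (continuous_id (X := Cn n))
        simp only [id] at h2 h3 h4
        unfold weylPhase
        fun_prop
      have := hv.continuous
      exact (by fun_prop : Continuous fun y =>
        weylPhase A h x y * b ((1 / 2 : ℝ) • (x + y)) * v y).aestronglyMeasurable
    · rw [norm_mul, norm_mul, norm_weylPhase, sub_div, sub_eq_add_neg, Real.exp_add]
      calc _ = Real.exp (‖A x‖ ^ 2 / h) * ‖b ((1 / 2 : ℝ) • (x + y))‖ *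
            (‖v y‖ * Real.exp (-(‖A y‖ ^ 2 / h))) := by ring
        _ ≤ _ := by
          gcongr
          exact hb.norm_le _
  · rw [weylOp, heq, integral_const_mul, integral_weylPhase_eq A hh hbc hb.norm_le hv hB hint 0 x,
      twistedWickOp, wickOp]
    ring

/-- The powers of h cancel: h^{-n} from the quantization, h^{-n} from the reproducing constant, h^n
from the Wick average and h^n from the convolution kernel. -/
theorem norm_weylConstant_mul_eq (A : Cn n ≃L[ℂ] Cn n) (D : ℂ) (A₀ I : ℝ) {h : ℝ} (hh : 0 < h) :
    ‖1 / ((2 * Real.pi * h : ℝ) : ℂ) ^ n * D * (4 ^ n / gaussMass A (2 / h))‖ *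
        (A₀ * gaussMass A (4 / h) * 7) * (h ^ n * I) =
      ‖D‖ / (2 * Real.pi) ^ n * (4 ^ n / gaussMass A 2) * (A₀ * gaussMass A 4 * 7) * I := by
  have hG := gaussMass_pos A (two_pos (α := ℝ))
  have hpi : 0 < 2 * Real.pi := by positivity
  rw [gaussMass_div A 2 hh, gaussMass_div A 4 hh, norm_mul, norm_mul, norm_div, norm_div, norm_pow,
    norm_pow, Complex.norm_real, Complex.norm_real, Real.norm_of_nonneg (by positivity),
    Real.norm_of_nonneg (by positivity), norm_one, mul_pow _ h, Complex.norm_ofNat]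
  field_simp

end GevreyWeyl

end

/-! ### The main theorem. -/

open GevreyWeyl

theorem mainTheorem7 (n : ℕ) (Φ₀ : QuadraticForm ℝ (GevreyWeyl.Cn n))
    (hΦ₀ : GevreyWeyl.StrictlyPlurisubharmonic (fun x => Φ₀ x))
    (s : ℝ) (hs : 1 < s) (A C : ℝ) (hA : 0 < A) (hC : 0 < C) :
    ∃ K M : ℝ, 0 < K ∧ 0 < M ∧
      ∀ h : ℝ, 0 < h → h ≤ 1 →
      ∀ Φ₁ : GevreyWeyl.Cn n → ℝ, GevreyWeyl.IsC11 Φ₁ →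
      (∀ k : ℕ, k ≤ 2 →
        eLpNorm (iteratedFDeriv ℝ k (fun x => Φ₁ x - Φ₀ x)) ∞ volume ≤
          ENNReal.ofReal (h ^ (1 - 1 / s) / K)) →
      ∀ a : GevreyWeyl.Lam (fun x => Φ₀ x) → ℂ,
        GevreyWeyl.GevreySymbol (fun x => Φ₀ x) s A C a →
        ∃ T : GevreyWeyl.HSpace Φ₁ h →ₗ[ℂ] GevreyWeyl.HSpace Φ₁ h,
          (∀ u : GevreyWeyl.HSpace Φ₁ h,
            eLpNorm (T u : GevreyWeyl.Cn n → ℂ) 2 (GevreyWeyl.weightMeasure Φ₁ h) ≤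
              ENNReal.ofReal M *
                eLpNorm (u : GevreyWeyl.Cn n → ℂ) 2 (GevreyWeyl.weightMeasure Φ₁ h)) ∧
          ∀ u ∈ GevreyWeyl.weylDomain (fun x => Φ₀ x) h,
            (∀ x, Integrable (GevreyWeyl.weylIntegrand (fun x => Φ₀ x) h a u x)) ∧
            ∃ hu : u ∈ GevreyWeyl.HSpace Φ₁ h,
              ∀ x, (T ⟨u, hu⟩ : GevreyWeyl.Cn n → ℂ) x =
                GevreyWeyl.weylOp (fun x => Φ₀ x) h a u x := by
  obtain ⟨L, hL, hL'⟩ := exists_herm_decomposition Φ₀ hΦ₀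
  obtain ⟨D, hD⟩ := exists_contourDensity_eq Φ₀
  obtain ⟨ε, I, hε, hI, hbound⟩ := exists_eLpNorm_twistedWickOp_le Φ₀ hL hs hC.le
  set M := ‖D‖ / (2 * Real.pi) ^ n * (4 ^ n / gaussMass L 2) * (A * gaussMass L 4 * 7) * I with hM
  have hM0 : 0 ≤ M := by
    have h2 := gaussMass_pos L (two_pos (α := ℝ))
    have h4 := gaussMass_pos L (four_pos (α := ℝ))
    positivity
  -- M is only known to be nonnegative; adding 1 makes the constant positive.
  refine ⟨1 / ε, M + 1, by positivity, by positivity, fun h hh hh1 Φ₁ hΦ₁ hle a ha => ?_⟩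
  rw [div_div_eq_mul_div, div_one, mul_comm] at hle
  set b : Cn n → ℂ := fun m => a (lamPoint (fun x => Φ₀ x) m) with hbdef
  have hb : GevreyBound s A C b := ha
  set κ : ℂ := 1 / ((2 * Real.pi * h : ℝ) : ℂ) ^ n * D * (4 ^ n / gaussMass L (2 / h)) with hκ
  have hnorm : ∀ u ∈ HSpace Φ₁ h, eLpNorm (twistedWickOp Φ₀ L h b κ u) 2 (weightMeasure Φ₁ h) ≤
      ENNReal.ofReal (M + 1) * eLpNorm u 2 (weightMeasure Φ₁ h) := by
    intro u hu
    refine (hbound A b hb h hh hh1 Φ₁ hΦ₁ hle κ u hu).trans ?_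
    rw [hκ, norm_weylConstant_mul_eq L D A I hh]
    gcongr
    linarith
  have hp0 := (perturbation_bounds Φ₀ hΦ₁ (by positivity) hle).1
  have hex := fun u (hu : u ∈ HSpace Φ₁ h) => exists_untwist_bound hL hh hΦ₁.1.continuous hp0 hu
  have hmem : ∀ u ∈ HSpace Φ₁ h, twistedWickOp Φ₀ L h b κ u ∈ HSpace Φ₁ h := by
    intro u hu
    obtain ⟨B, hB⟩ := hex u hu
    have hd := differentiable_twistedWickOp hs hC.le hb hh κ hu.1 hB
    exact ⟨hd, hd.continuous.aestronglyMeasurable,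
      (hnorm u hu).trans_lt (ENNReal.mul_lt_top ENNReal.ofReal_lt_top hu.2.2)⟩
  -- The extension is the Wick integral with δ = 0, already defined on the whole space.
  refine ⟨{ toFun := fun u => ⟨twistedWickOp Φ₀ L h b κ u, hmem u u.2⟩
            map_add' := fun u v => Subtype.ext ?_
            map_smul' := fun c u => Subtype.ext (twistedWickOp_smul Φ₀ L h b κ c u) },
    fun u => hnorm u u.2, fun u hu => ?_⟩
  · obtain ⟨B, hB⟩ := hex u u.2
    obtain ⟨B', hB'⟩ := hex v v.2
    exact twistedWickOp_add hs hC.le hb hh κ u.2.1 v.2.1 hB hB'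
  · have hw := weylOp_eq_twistedWickOp hL hL' hD ha hh hu
    exact ⟨fun x => (hw x).1,
      mem_HSpace_of_mem_weylDomain (continuous_quadraticForm Φ₀) hh hΦ₁.1.continuous hp0 hu,
      fun x => (hw x).2.symm⟩
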